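/- Let $\mathfrak g$ be a finite-dimensional reductive Lie algebra over $\mathbb C$ with Cartan subalgebra $\mathfrak h$, and let $\mathfrak p\subseteq\mathfrak g$ be a parabolic subalgebra with nilpotent radical $\mathfrak u$ and Levi subalgebra $\mathfrak l\supseteq\mathfrak h$, so that $\mathfrak p=\mathfrak l\oplus\mathfrak u$. For a finite-dimensional complex Lie algebra $\mathfrak a$ with a subalgebra $\mathfrak t$, an $(\mathfrak a,\mathfrak t)$-module is an $\mathfrak a$-module which is locally $\mathfrak t$-finite and semisimple as a $\mathfrak t$-module; $\mathcal M(\mathfrak a,\mathfrak t)$ denotes the class of finitely generated $(\mathfrak a,\mathfrak t)$-modules in which each irreducible $\mathfrak t$-module has finite multiplicity. Let $\operatorname{Ext}^i_{\mathfrak a,\mathfrak t}$ be the extension groups in the abelian category of $(\mathfrak a,\mathfrak t)$-modules, and put $$\mathrm{EP}_{\mathfrak a,\mathfrak t}(X,Y)=\sum_{i\ge 0}(-1)^i\dim_{\mathbb C}\operatorname{Ext}^i_{\mathfrak a,\mathfrak t}(X,Y)$$ whenever all these spaces are finite-dimensional and almost all of them vanish. Let $M\in\mathcal M(\mathfrak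 g,\mathfrak h)$ and $V\in\mathcal M(\mathfrak l,\mathfrak h)$. Let $M_{\mathfrak p}(V)=U(\mathfrak g)\otimes_{U(\mathfrak p)}V$, where $\mathfrak u$ acts trivially on $V$, and let $H^i(\mathfrak u,M)$ be the Lie algebra cohomology of $\mathfrak u$ with coefficients in $M$ (the cohomology of the Chevalley–Eilenberg complex $\operatorname{Hom}(\bigwedge^\bullet\mathfrak u,M)$), with its natural $\mathfrak l$-module structure. Then $M_{\mathfrak p}(V)$ is a $(\mathfrak g,\mathfrak h)$-module, every $H^i(\mathfrak u,M)$ is an $(\mathfrak l,\mathfrak h)$-module, $H^i(\mathfrak u,M)=0$ for all large $i$, the pairings $\mathrm{EP}_{\mathfrak g,\mathfrak h}(M_{\mathfrak p}(V),M)$ and $\mathrm{EP}_{\mathfrak l,\mathfrak h}(V,H^i(\mathfrak u,M))$ are well defined, and $$\mathrm{EP}_{\mathfrak g,\mathfrak h}(M_{\mathfrak p}(V),M)=\sum_{i\ge 0}(-1)^i\,\mathrm{EP}_{\mathfrak l,\mathfrak h}\bigl(V,H^i(\mathfrak u,M)\bigr).$$ -/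

import Mathlib

open CategoryTheory
open scoped ModuleCat

universe u

noncomputable section

/-! ## The category of `(𝔞, 𝔱)`-modules and the Euler–Poincaré pairing -/

section Pairs

attribute [local instance] LieRing.ofAssociativeRing

/-- The universal enveloping algebra of a complex Lie algebra. -/
abbrev UEnv (L : Type u) [LieRing L] [LieAlgebra ℂ L] : Type u := UniversalEnvelopingAlgebra ℂ L

/-- The algebra homomorphism `U(𝔱) → U(𝔞)` induced by the inclusion of a Lie subalgebra. -/
def UEnv.incl {a : Type u} [LieRing a] [LieAlgebra ℂ a] (t : LieSubalgebra ℂ a) :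
    UEnv t →ₐ[ℂ] UEnv a :=
  UniversalEnvelopingAlgebra.lift ℂ ((UniversalEnvelopingAlgebra.ι ℂ).comp t.incl)

/-- A copy of the Lie module `M` over `L`, regarded as a left module over `U(L)`. -/
def EnvModule (_ : Type u) (M : Type u) : Type u := M

instance (L M : Type u) [AddCommGroup M] : AddCommGroup (EnvModule L M) :=
  inferInstanceAs (AddCommGroup M)

instance (L M : Type u) [AddCommGroup M] [Module ℂ M] : Module ℂ (EnvModule L M) :=
  inferInstanceAs (Module ℂ M)

instance (L M : Type u) [LieRing L] [LieAlgebra ℂ L] [AddCommGroup M] [Module ℂ M]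
    [LieRingModule L M] [LieModule ℂ L M] : Module (UEnv L) (EnvModule L M) :=
  Module.compHom M (UniversalEnvelopingAlgebra.lift ℂ (LieModule.toEnd ℂ L M)).toRingHom

/-- A Lie module over `L`, as an object of the category of left `U(L)`-modules. -/
abbrev envObj (L M : Type u) [LieRing L] [LieAlgebra ℂ L] [AddCommGroup M] [Module ℂ M]
    [LieRingModule L M] [LieModule ℂ L M] : ModuleCat.{u} (UEnv L) :=
  ModuleCat.of (UEnv L) (EnvModule L M)

/-- A module over a complex algebra `A` which is semisimple, and locally finite: every cyclic
submodule `A v` is finite-dimensional over `ℂ`. -/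
structure IsLocallyFiniteSemisimple (A : Type u) [Ring A] [Algebra ℂ A] (Y : Type u)
    [AddCommGroup Y] [Module ℂ Y] [Module A Y] [IsScalarTower ℂ A Y] : Prop where
  finite : ∀ v : Y, Module.Finite ℂ (Submodule.span A {v})
  semisimple : IsSemisimpleModule A Y

variable {a : Type u} [LieRing a] [LieAlgebra ℂ a] (t : LieSubalgebra ℂ a)

/-- The restriction of a `U(𝔞)`-module to `U(𝔱)`. -/
abbrev resObj (X : ModuleCat.{u} (UEnv a)) : ModuleCat.{u} (UEnv t) :=
  (ModuleCat.restrictScalars (UEnv.incl t).toRingHom).obj X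

/-- `X` is an `(𝔞, 𝔱)`-module: locally `𝔱`-finite and semisimple when restricted to `𝔱`. -/
def IsPairModule : ObjectProperty (ModuleCat.{u} (UEnv a)) :=
  fun X => IsLocallyFiniteSemisimple (UEnv t) (resObj t X)

/-- `X` is admissible: each irreducible `𝔱`-module `S` has finite multiplicity
`dim Hom_𝔱(S, X)` in `X`. -/
def IsAdmissible (X : ModuleCat.{u} (UEnv a)) : Prop :=
  ∀ S : ModuleCat.{u} (UEnv t), IsSimpleModule (UEnv t) S →
    Module.Finite ℂ (S ⟶ resObj t X)

/-- `X` belongs to `𝓜(𝔞, 𝔱)`: it is a finitely generated admissible `(𝔞, 𝔱)`-module. -/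
structure IsFGAdmissible (X : ModuleCat.{u} (UEnv a)) : Prop where
  isPairModule : IsPairModule t X
  isAdmissible : IsAdmissible t X
  finite : Module.Finite (UEnv a) X

namespace IsLocallyFiniteSemisimple

variable {A : Type u} [Ring A] [Algebra ℂ A] {Y Z : Type u} [AddCommGroup Y] [Module ℂ Y]
  [Module A Y] [IsScalarTower ℂ A Y] [AddCommGroup Z] [Module ℂ Z] [Module A Z]
  [IsScalarTower ℂ A Z]

theorem of_injective (f : Y →ₗ[A] Z) (hf : Function.Injective f)
    (h : IsLocallyFiniteSemisimple A Z) : IsLocallyFiniteSemisimple A Y where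
  finite v := by
    have := h.finite (f v)
    refine Module.Finite.of_injective
      ((f.restrict (p := Submodule.span A {v}) (q := Submodule.span A {f v}) ?_).restrictScalars
        ℂ) ?_
    · intro x hx
      obtain ⟨r, rfl⟩ := Submodule.mem_span_singleton.1 hx
      exact Submodule.mem_span_singleton.2 ⟨r, by simp⟩
    · intro x y hxy
      exact Subtype.ext (hf (congrArg Subtype.val hxy))
  semisimple := by
    have := h.semisimple
    exact IsSemisimpleModule.of_injective f hf

theorem of_surjective (f : Y →ₗ[A] Z) (hf : Function.Surjective f)
    (h : IsLocallyFiniteSemisimple A Y) : IsLocallyFiniteSemisimple A Z where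
  finite v := by
    obtain ⟨w, rfl⟩ := hf v
    have := h.finite w
    refine Module.Finite.of_surjective
      ((f.restrict (p := Submodule.span A {w}) (q := Submodule.span A {f w}) ?_).restrictScalars
        ℂ) ?_
    · intro x hx
      obtain ⟨r, rfl⟩ := Submodule.mem_span_singleton.1 hx
      exact Submodule.mem_span_singleton.2 ⟨r, by simp⟩
    · rintro ⟨x, hx⟩
      obtain ⟨r, rfl⟩ := Submodule.mem_span_singleton.1 hx
      exact ⟨⟨r • w, Submodule.mem_span_singleton.2 ⟨r, rfl⟩⟩, Subtype.ext (by simp)⟩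
  semisimple := by
    have := h.semisimple
    exact IsSemisimpleModule.of_surjective f hf

theorem pi {J : Type} [Finite J] {W : J → Type u} [∀ j, AddCommGroup (W j)]
    [∀ j, Module ℂ (W j)] [∀ j, Module A (W j)] [∀ j, IsScalarTower ℂ A (W j)]
    (h : ∀ j, IsLocallyFiniteSemisimple A (W j)) :
    IsLocallyFiniteSemisimple A (∀ j, W j) where
  finite v := by
    have := fun j => (h j).finite (v j)
    let g : Submodule.span A {v} →ₗ[A] ∀ j, Submodule.span A {v j} :=
      LinearMap.pi fun j => (LinearMap.proj (R := A) (φ := W) j).restrict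
        (p := Submodule.span A {v}) (q := Submodule.span A {v j}) (by
          intro x hx
          obtain ⟨r, rfl⟩ := Submodule.mem_span_singleton.1 hx
          exact Submodule.mem_span_singleton.2 ⟨r, by simp⟩)
    refine Module.Finite.of_injective (g.restrictScalars ℂ) ?_
    intro x y hxy
    refine Subtype.ext (funext fun j => ?_)
    exact congrArg Subtype.val (congrFun hxy j)
  semisimple := by
    have := fun j => (h j).semisimple
    infer_instance

end IsLocallyFiniteSemisimple

instance : (IsPairModule t).IsClosedUnderSubobjects where
  prop_of_mono f _ hY :=
    IsLocallyFiniteSemisimple.of_injective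
      ((ModuleCat.restrictScalars (UEnv.incl t).toRingHom).map f).hom
      ((ModuleCat.mono_iff_injective f).1 inferInstance) hY

instance : (IsPairModule t).IsClosedUnderQuotients where
  prop_of_epi f _ hX :=
    IsLocallyFiniteSemisimple.of_surjective
      ((ModuleCat.restrictScalars (UEnv.incl t).toRingHom).map f).hom
      ((ModuleCat.epi_iff_surjective f).1 inferInstance) hX

instance : (IsPairModule t).IsClosedUnderFiniteProducts where
  isClosedUnderLimitsOfShape J _ := by
    refine ⟨?_⟩
    rintro X ⟨p⟩
    let F : J → ModuleCat.{u} (UEnv a) := fun j => p.diag.obj ⟨j⟩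
    let R := ModuleCat.restrictScalars.{u} (UEnv.incl t).toRingHom
    refine IsLocallyFiniteSemisimple.of_injective
      (LinearMap.pi fun j : J => (R.map (p.π.app ⟨j⟩)).hom) ?_
      (IsLocallyFiniteSemisimple.pi fun j : J => p.prop_diag_obj ⟨j⟩)
    intro x y hxy
    refine Limits.Concrete.isLimit_ext _ p.isLimit x y ?_
    rintro ⟨j⟩
    exact congrFun hxy j

instance : (IsPairModule t).ContainsZero where
  exists_zero := by
    refine ⟨ModuleCat.of (UEnv a) PUnit, ModuleCat.isZero_of_subsingleton _, ?_⟩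
    exact IsLocallyFiniteSemisimple.of_injective (Z := ∀ j : Empty, PUnit.{u + 1})
      (0 : resObj t (ModuleCat.of (UEnv a) PUnit) →ₗ[UEnv t] ∀ j : Empty, PUnit.{u + 1})
      (fun x y _ => Subsingleton.elim (α := PUnit) x y)
      (IsLocallyFiniteSemisimple.pi fun j => j.elim)

/-- The category of all `(𝔞, 𝔱)`-modules, a full abelian subcategory of the category of
`𝔞`-modules. -/
abbrev PairCat : Type (u + 1) := (IsPairModule t).FullSubcategory

instance : HasExt.{u + 1} (PairCat t) := HasExt.standard _

/-- The vector space `Ext^i_{𝔞,𝔱}(X, Y)`, formed in the abelian category of `(𝔞, 𝔱)`-modules. -/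
abbrev PairExt (X Y : PairCat t) (i : ℕ) : Type (u + 1) := Abelian.Ext X Y i

/-- The Euler–Poincaré pairing of `X` and `Y` is well defined: all the spaces `Ext^i_{𝔞,𝔱}(X, Y)`
are finite-dimensional, and they vanish for all but finitely many `i`. -/
structure EPWellDefined (X Y : PairCat t) : Prop where
  finite : ∀ i, Module.Finite ℂ (PairExt t X Y i)
  vanish : ∃ n, ∀ i, n ≤ i → Subsingleton (PairExt t X Y i)

/-- The Euler–Poincaré pairing `EP_{𝔞,𝔱}(X, Y) = ∑ᵢ (-1)^i dim Ext^i_{𝔞,𝔱}(X, Y)`. -/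
def EP (X Y : PairCat t) : ℤ :=
  ∑ᶠ i : ℕ, (-1) ^ i * (Module.finrank ℂ (PairExt t X Y i) : ℤ)

end Pairs

/-! ## Pullback of Lie modules -/

section Pullback

variable {L₁ L₂ : Type u} [LieRing L₁] [LieAlgebra ℂ L₁] [LieRing L₂] [LieAlgebra ℂ L₂]

/-- The Lie module `M` over `L₂`, regarded as a Lie module over `L₁` through a homomorphism of Lie
algebras `φ : L₁ → L₂`. -/
def PullModule (_ : L₁ →ₗ⁅ℂ⁆ L₂) (M : Type u) : Type u := M

variable (φ : L₁ →ₗ⁅ℂ⁆ L₂) (M : Type u) [AddCommGroup M] [Module ℂ M] [LieRingModule L₂ M]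

instance : AddCommGroup (PullModule φ M) := inferInstanceAs (AddCommGroup M)

instance : Module ℂ (PullModule φ M) := inferInstanceAs (Module ℂ M)

instance : LieRingModule L₁ (PullModule φ M) := LieRingModule.compLieHom M φ

instance [LieModule ℂ L₂ M] : LieModule ℂ L₁ (PullModule φ M) := LieModule.compLieHom M φ

end Pullback

/-! ## Cohomology of an ideal, by the Chevalley–Eilenberg complex -/

section Cohomology

variable {P : Type u} [LieRing P] [LieAlgebra ℂ P] (I : LieIdeal ℂ P)
  (M : Type u) [AddCommGroup M] [Module ℂ M] [LieRingModule P M] [LieModule ℂ P M]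

/-- The space `Hom(⋀ⁿ I, M)` of Chevalley–Eilenberg cochains, as alternating maps. -/
abbrev CECochain (n : ℕ) : Type u := I [⋀^Fin n]→ₗ[ℂ] M

namespace CECochain

variable {I M} {n : ℕ}

set_option linter.unusedSectionVars false

theorem ext_cons {N : Type*} {F G : (Fin (n + 1) → I) → N}
    (h : ∀ z w, F (Fin.cons z w) = G (Fin.cons z w)) : F = G := by
  funext v
  rw [← Fin.cons_self_tail v]
  exact h _ _

theorem ext_curry {N : Type u} [AddCommGroup N] [Module ℂ N] {f g : CECochain I N (n + 1)}
    (h : ∀ z, f.curryLeft z = g.curryLeft z) : f = g := by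
  refine DFunLike.coe_injective (ext_cons fun z w => ?_)
  exact DFunLike.congr_fun (h z) w

theorem lie_coe_self (z : I) : ⁅(z : P), z⁆ = 0 := Subtype.ext (lie_self (z : P))

/-- A linear map `K` from `I` to `n`-cochains with `K z w = 0` whenever `z` is the first entry
of `w` comes from an `(n + 1)`-cochain. -/
theorem exists_uncurry {n : ℕ} (K : I →ₗ[ℂ] CECochain I M n)
    (hK : ∀ (hn : 0 < n) (w : Fin n → I), K (w ⟨0, hn⟩) w = 0) :
    ∃ F : CECochain I M (n + 1), ∀ v, F v = K (v 0) (Fin.tail v) := by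
  let G : MultilinearMap ℂ (fun _ : Fin (n + 1) => I) M :=
    LinearMap.uncurryLeft (AlternatingMap.toMultilinearMapLM.comp K)
  have hG : ∀ v, G v = K (v 0) (Fin.tail v) := fun v => rfl
  have key : ∀ (v : Fin (n + 1) → I) (a b : Fin (n + 1)), v a = v b → a < b → G v = 0 := by
    intro v a b hv hab
    rw [hG]
    obtain ⟨b, rfl⟩ := Fin.exists_succ_eq.2 (Fin.ne_zero_of_lt hab)
    induction a using Fin.cases with
    | succ a =>
      exact (K (v 0)).map_eq_zero_of_eq (Fin.tail v) hv (fun h => hab.ne (congrArg Fin.succ h))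
    | zero =>
      have hn : 0 < n := Fin.pos b
      by_cases hb : b = ⟨0, hn⟩
      · subst hb
        rw [hv]
        exact hK hn (Fin.tail v)
      · have h1 := (K (v 0)).map_swap (Fin.tail v) hb
        have h2 := hK hn (Fin.tail v ∘ Equiv.swap b ⟨0, hn⟩)
        have h3 : (Fin.tail v ∘ Equiv.swap b ⟨0, hn⟩) ⟨0, hn⟩ = v 0 := by
          simp [Fin.tail, hv]
        rw [h3, h1, neg_eq_zero] at h2
        exact h2
  refine ⟨{ G with map_eq_zero_of_eq' := fun v a b hv hab => ?_ }, hG⟩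
  rcases lt_or_gt_of_ne hab with h | h
  · exact key v a b hv h
  · exact key v b a hv.symm h

theorem act_isAlternating (x : P) (f : CECochain I M n) :
    ∃ F : CECochain I M n, ∀ v,
      F v = ⁅x, f v⁆ - ∑ k, f (Function.update v k ⁅x, v k⁆) := by
  let G : MultilinearMap ℂ (fun _ : Fin n => I) M :=
    (LieModule.toEnd ℂ P M x).compMultilinearMap f.toMultilinearMap -
      ∑ k, f.toMultilinearMap.compLinearMap
        (Function.update (fun _ => LinearMap.id) k (LieModule.toEnd ℂ P I x))
  have hG : ∀ v, G v = ⁅x, f v⁆ - ∑ k, f (Function.update v k ⁅x, v k⁆) := by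
    intro v
    simp only [G, sub_apply, LinearMap.compMultilinearMap_apply,
      LieModule.toEnd_apply_apply, sum_apply, MultilinearMap.compLinearMap_apply]
    congr 1
    refine Finset.sum_congr rfl fun k _ => ?_
    change f _ = f _
    congr 1
    funext i
    by_cases h : i = k
    · subst h; simp
    · simp [h]
  refine ⟨{ G with map_eq_zero_of_eq' := fun v a b hv hab => ?_ }, hG⟩
  change G v = 0
  rw [hG, f.map_eq_zero_of_eq v hv hab, lie_zero, zero_sub, neg_eq_zero,
    Finset.sum_eq_add a b hab]
  · have h := f.map_swap (Function.update v a ⁅x, v a⁆) hab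
    have h2 : Function.update v a ⁅x, v a⁆ ∘ Equiv.swap a b = Function.update v b ⁅x, v b⁆ := by
      funext i
      rcases eq_or_ne i a with rfl | hia
      · simp [hab, hab.symm, hv]
      · rcases eq_or_ne i b with rfl | hib
        · simp [hv]
        · simp [hia, hib, Equiv.swap_apply_of_ne_of_ne]
    rw [← h2, h, add_neg_cancel]
  · intro k _ hk
    exact f.map_eq_zero_of_eq _ (by simp [hk.1.symm, hk.2.symm, hv]) hab
  · simp
  · simp

/-- The natural action of `x ∈ P` on cochains:
`(x · f)(v₁, …, vₙ) = x · f(v₁, …, vₙ) - ∑ₖ f(v₁, …, [x, vₖ], …, vₙ)`. -/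
def act (x : P) (f : CECochain I M n) : CECochain I M n where
  toFun v := ⁅x, f v⁆ - ∑ k, f (Function.update v k ⁅x, v k⁆)
  map_update_add' v k y z := by
    obtain ⟨F, hF⟩ := act_isAlternating x f
    simpa only [hF] using F.map_update_add v k y z
  map_update_smul' v k c y := by
    obtain ⟨F, hF⟩ := act_isAlternating x f
    simpa only [hF] using F.map_update_smul v k c y
  map_eq_zero_of_eq' v i j hv hij := by
    obtain ⟨F, hF⟩ := act_isAlternating x f
    simpa only [hF] using F.map_eq_zero_of_eq v hv hij

theorem act_apply (x : P) (f : CECochain I M n) (v : Fin n → I) :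
    act x f v = ⁅x, f v⁆ - ∑ k, f (Function.update v k ⁅x, v k⁆) := rfl

theorem act_add (x : P) (f g : CECochain I M n) : act x (f + g) = act x f + act x g := by
  ext v
  simp [act_apply, Finset.sum_add_distrib]
  abel

theorem act_smul (c : ℂ) (x : P) (f : CECochain I M n) : act x (c • f) = c • act x f := by
  ext v
  simp [act_apply, Finset.smul_sum, smul_sub]

theorem add_act (x y : P) (f : CECochain I M n) : act (x + y) f = act x f + act y f := by
  ext v
  simp [act_apply, Finset.sum_add_distrib]
  abel

theorem smul_act (c : ℂ) (x : P) (f : CECochain I M n) : act (c • x) f = c • act x f := by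
  ext v
  simp [act_apply, Finset.smul_sum, smul_sub]

theorem act_curryLeft (x : P) (f : CECochain I M (n + 1)) (z : I) :
    (act x f).curryLeft z = act x (f.curryLeft z) - f.curryLeft ⁅x, z⁆ := by
  ext v
  simp only [AlternatingMap.curryLeft_apply_apply, AlternatingMap.sub_apply, act_apply,
    Fin.sum_univ_succ, Matrix.vecCons, Fin.cons_zero, Fin.cons_succ, Fin.update_cons_zero,
    ← Fin.cons_update]
  abel

theorem act_lie (x y : P) (f : CECochain I M n) :
    act x (act y f) = act ⁅x, y⁆ f + act y (act x f) := by
  induction n with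
  | zero =>
    ext v
    simp [act_apply]
  | succ n ih =>
    refine ext_curry fun z => ?_
    have hsub : ∀ (x : P) (f g : CECochain I M n), act x (f - g) = act x f - act x g := by
      intro x f g
      rw [sub_eq_add_neg, act_add, ← neg_one_smul ℂ g, act_smul, neg_one_smul, sub_eq_add_neg]
    rw [AlternatingMap.curryLeft_add, LinearMap.add_apply]
    simp only [act_curryLeft, hsub, ih, lie_lie, map_sub]
    abel

instance : LieRingModule P (CECochain I M n) where
  bracket x f := act x f
  add_lie := add_act
  lie_add := act_add
  leibniz_lie := act_lie

theorem lie_apply (x : P) (f : CECochain I M n) (v : Fin n → I) :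
    ⁅x, f⁆ v = ⁅x, f v⁆ - ∑ k, f (Function.update v k ⁅x, v k⁆) := rfl

theorem lie_curryLeft (x : P) (f : CECochain I M (n + 1)) (z : I) :
    ⁅x, f⁆.curryLeft z = ⁅x, f.curryLeft z⁆ - f.curryLeft ⁅x, z⁆ := act_curryLeft x f z

instance : LieModule ℂ P (CECochain I M n) where
  smul_lie := smul_act
  lie_smul c x f := act_smul c x f

/-- The Chevalley–Eilenberg coboundary of an `n`-cochain `f`:
`(d f)(v₀, …, vₙ) = ∑ᵢ (-1)^i vᵢ · f(v₀, …, v̂ᵢ, …, vₙ)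
  + ∑_{i < j} (-1)^{i + j} f([vᵢ, vⱼ], v₀, …, v̂ᵢ, …, v̂ⱼ, …, vₙ)`,
where `[vᵢ, vⱼ]` has been moved past the `j - 1` entries before the place of `vⱼ`, which
turns the sign `(-1)^{i + j}` into `-(-1)^i`. -/
def dFun (n : ℕ) (f : CECochain I M n) (v : Fin (n + 1) → I) : M :=
  ∑ i : Fin (n + 1), (-1 : ℤ) ^ (i : ℕ) •
    (⁅(v i : P), f (i.removeNth v)⁆ -
      ∑ j : Fin n with i < i.succAbove j,
        f (Function.update (i.removeNth v) j ⁅(v i : P), v (i.succAbove j)⁆))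

theorem dFun_zero (f : CECochain I M 0) (v : Fin 1 → I) :
    dFun 0 f v = ⁅(v 0 : P), f (Fin.tail v)⁆ := by
  simp [dFun]

theorem dFun_cons (f : CECochain I M (n + 1)) (z : I) (w : Fin (n + 1) → I) :
    dFun (n + 1) f (Fin.cons z w) = ⁅(z : P), f⁆ w - dFun n (f.curryLeft z) w := by
  rw [dFun, Fin.sum_univ_succ, sub_eq_add_neg (⁅(z : P), f⁆ w)]
  refine congrArg₂ (· + ·) ?_ ?_
  · simp [lie_apply, Fin.removeNth_zero]
  · rw [dFun, ← Finset.sum_neg_distrib]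
    refine Finset.sum_congr rfl fun i _ => ?_
    have h1 : i.succ.removeNth (Fin.cons z w : Fin (n + 2) → I) =
        Fin.cons z (i.removeNth w) := by
      funext k
      induction k using Fin.cases with
      | zero => simp [Fin.removeNth]
      | succ k => simp [Fin.removeNth]
    rw [h1]
    simp only [Finset.sum_filter, Fin.sum_univ_succ (n := n)]
    simp only [Fin.cons_succ, Fin.succ_succAbove_zero, Fin.not_lt_zero, if_false, zero_add,
      Fin.succ_succAbove_succ, Fin.succ_lt_succ_iff, ← Fin.cons_update,
      AlternatingMap.curryLeft_apply_apply, Matrix.vecCons, Fin.val_succ, pow_succ]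
    simp

theorem dFun_add (f g : CECochain I M n) (v : Fin (n + 1) → I) :
    dFun n (f + g) v = dFun n f v + dFun n g v := by
  simp only [dFun, AlternatingMap.add_apply, lie_add,
    ← Finset.sum_add_distrib, ← smul_add]
  refine Finset.sum_congr rfl fun i _ => ?_
  rw [Finset.sum_add_distrib]
  congr 1
  abel

theorem dFun_smul (c : ℂ) (f : CECochain I M n) (v : Fin (n + 1) → I) :
    dFun n (c • f) v = c • dFun n f v := by
  simp only [dFun, AlternatingMap.smul_apply, lie_smul, ← Finset.smul_sum,
    ← smul_sub]
  rw [Finset.smul_sum]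
  exact Finset.sum_congr rfl fun i _ => smul_comm _ _ _

theorem dFun_isAlternating (f : CECochain I M n) :
    ∃ F : CECochain I M (n + 1), ∀ v, F v = dFun n f v := by
  induction n with
  | zero =>
    let K : I →ₗ[ℂ] CECochain I M 0 :=
      { toFun := fun z => ⁅(z : P), f⁆
        map_add' := fun z w => add_lie (z : P) (w : P) f
        map_smul' := fun c z => smul_lie c (z : P) f }
    obtain ⟨F, hF⟩ := exists_uncurry K (fun hn => absurd hn (lt_irrefl 0))
    refine ⟨F, fun v => ?_⟩
    rw [hF, dFun_zero]
    simp [K, lie_apply]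
  | succ n ih =>
    choose D hD using fun g : CECochain I M n => ih g
    let D' : CECochain I M n →ₗ[ℂ] CECochain I M (n + 1) :=
      { toFun := D
        map_add' := fun g h => by ext v; simp [hD, dFun_add]
        map_smul' := fun c g => by ext v; simp [hD, dFun_smul] }
    let L : I →ₗ[ℂ] CECochain I M (n + 1) :=
      { toFun := fun z => ⁅(z : P), f⁆
        map_add' := fun z w => add_lie (z : P) (w : P) f
        map_smul' := fun c z => smul_lie c (z : P) f }
    have hK : ∀ z w, (L - D'.comp f.curryLeft) z w = dFun (n + 1) f (Fin.cons z w) := by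
      intro z w
      rw [dFun_cons, ← hD]
      rfl
    obtain ⟨F, hF⟩ := exists_uncurry (L - D'.comp f.curryLeft) (by
      intro hn w
      rw [hK, dFun_cons]
      obtain ⟨z, w, rfl⟩ : ∃ z w', w = Fin.cons z w' :=
        ⟨_, _, (Fin.cons_self_tail w).symm⟩
      change ⁅(z : P), f⁆ (Fin.cons z w) - dFun n (f.curryLeft z) (Fin.cons z w) = 0
      have h1 : ⁅(z : P), f⁆ (Fin.cons z w) = ⁅(z : P), f.curryLeft z⁆ w := by
        have := DFunLike.congr_fun (lie_curryLeft (z : P) f z) w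
        rw [lie_coe_self, map_zero, sub_zero] at this
        exact this
      rw [h1]
      cases n with
      | zero =>
        rw [dFun_zero]
        simp [lie_apply]
      | succ n =>
        rw [dFun_cons, AlternatingMap.curryLeft_same]
        simp [dFun])
    refine ⟨F, fun v => ?_⟩
    rw [hF, hK, Fin.cons_self_tail]

/-- The Chevalley–Eilenberg differential `Hom(⋀ⁿ I, M) → Hom(⋀ⁿ⁺¹ I, M)`. -/
def d (I : LieIdeal ℂ P) (M : Type u) [AddCommGroup M] [Module ℂ M] [LieRingModule P M]
    [LieModule ℂ P M] (n : ℕ) : CECochain I M n →ₗ[ℂ] CECochain I M (n + 1) where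
  toFun f :=
    { toFun := dFun n f
      map_update_add' := fun v k y z => by
        obtain ⟨F, hF⟩ := dFun_isAlternating f
        simpa only [hF] using F.map_update_add v k y z
      map_update_smul' := fun v k c y => by
        obtain ⟨F, hF⟩ := dFun_isAlternating f
        simpa only [hF] using F.map_update_smul v k c y
      map_eq_zero_of_eq' := fun v i j hv hij => by
        obtain ⟨F, hF⟩ := dFun_isAlternating f
        simpa only [hF] using F.map_eq_zero_of_eq v hv hij }
  map_add' f g := AlternatingMap.ext (dFun_add f g)
  map_smul' c f := AlternatingMap.ext (dFun_smul c f)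

theorem d_curryLeft (f : CECochain I M (n + 1)) (z : I) :
    (d I M (n + 1) f).curryLeft z = ⁅(z : P), f⁆ - d I M n (f.curryLeft z) :=
  AlternatingMap.ext (dFun_cons f z)

theorem d_zero_curryLeft (f : CECochain I M 0) (z : I) :
    (d I M 0 f).curryLeft z = ⁅(z : P), f⁆ := by
  ext v
  change dFun 0 f (Fin.cons z v) = _
  rw [dFun_zero]
  simp [lie_apply]

theorem d_lie (x : P) (f : CECochain I M n) : d I M n ⁅x, f⁆ = ⁅x, d I M n f⁆ := by
  induction n with
  | zero =>
    refine ext_curry fun z => ?_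
    rw [lie_curryLeft, d_zero_curryLeft, d_zero_curryLeft, d_zero_curryLeft]
    change ⁅(z : P), ⁅x, f⁆⁆ = ⁅x, ⁅(z : P), f⁆⁆ - ⁅⁅x, (z : P)⁆, f⁆
    rw [lie_lie]
    abel
  | succ n ih =>
    refine ext_curry fun z => ?_
    simp only [lie_curryLeft, d_curryLeft, map_sub, ih, lie_sub]
    change ⁅(z : P), ⁅x, f⁆⁆ - _ = _ - (⁅⁅x, (z : P)⁆, f⁆ - _)
    rw [lie_lie]
    abel

theorem d_comp_d (f : CECochain I M n) : d I M (n + 1) (d I M n f) = 0 := by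
  induction n with
  | zero =>
    refine ext_curry fun z => ?_
    rw [d_curryLeft, d_zero_curryLeft, d_lie, sub_self]
    rfl
  | succ n ih =>
    refine ext_curry fun z => ?_
    rw [d_curryLeft, d_curryLeft, map_sub, ih, d_lie, sub_zero, sub_self]
    rfl

end CECochain

/-- The differential as a homomorphism of Lie modules over `P`. -/
def ceDiff (n : ℕ) : CECochain I M n →ₗ⁅ℂ,P⁆ CECochain I M (n + 1) :=
  { CECochain.d I M n with map_lie' := fun {x f} => CECochain.d_lie x f }

/-- The `n`-cocycles. -/
def ceCocycles (n : ℕ) : LieSubmodule ℂ P (CECochain I M n) := (ceDiff I M n).ker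

/-- The `n`-coboundaries. -/
def ceCoboundaries : (n : ℕ) → LieSubmodule ℂ P (CECochain I M n)
  | 0 => ⊥
  | n + 1 => (ceDiff I M n).range

/-- The cohomology `Hⁿ(I, M)` of the ideal `I` with coefficients in `M`, with its natural structure
of a Lie module over `P`. -/
abbrev LieCohomology (n : ℕ) : Type u :=
  ceCocycles I M n ⧸ (ceCoboundaries I M n).comap (ceCocycles I M n).incl

end Cohomology

/-! ## Parabolic subalgebras and parabolic induction -/

section Parabolic

/-- The nilpotent radical `[P, rad P]` of a Lie algebra `P`, that is, the intersection of the
kernels of its irreducible finite-dimensional representations. For a parabolic subalgebra of a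
reductive Lie algebra it is the ideal usually denoted by `𝔲`. -/
def nilpotentRadical (P : Type u) [LieRing P] [LieAlgebra ℂ P] : LieIdeal ℂ P :=
  ⁅(⊤ : LieIdeal ℂ P), LieAlgebra.radical ℂ P⁆

variable {g : Type u} [LieRing g] [LieAlgebra ℂ g]

/-- A Borel subalgebra is a maximal solvable subalgebra. -/
def IsBorel (b : LieSubalgebra ℂ g) : Prop :=
  Maximal (fun s : LieSubalgebra ℂ g => LieAlgebra.IsSolvable s) b

/-- A parabolic subalgebra is a subalgebra that contains a Borel subalgebra. -/
def IsParabolic (p : LieSubalgebra ℂ g) : Prop :=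
  ∃ b : LieSubalgebra ℂ g, IsBorel b ∧ b ≤ p

/-- `𝔩` is a Levi subalgebra of `𝔭`: a subalgebra with `𝔭 = 𝔩 ⊕ 𝔲`, where `𝔲` is the nilpotent
radical of `𝔭`. -/
structure IsLevi (p l : LieSubalgebra ℂ g) : Prop where
  le : l ≤ p
  isCompl : IsCompl (l.toSubmodule.comap p.toSubmodule.subtype) (nilpotentRadical p).toSubmodule

variable {p l : LieSubalgebra ℂ g}

theorem IsLevi.exists_sub_mem (hl : IsLevi p l) (x : p) :
    ∃ y : l, x - LieSubalgebra.inclusion hl.le y ∈ nilpotentRadical p := by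
  have hx : x ∈ l.toSubmodule.comap p.toSubmodule.subtype ⊔ (nilpotentRadical p).toSubmodule := by
    rw [hl.isCompl.sup_eq_top]
    trivial
  obtain ⟨y, hy, z, hz, hyz⟩ := Submodule.mem_sup.1 hx
  refine ⟨⟨(y : g), hy⟩, ?_⟩
  have h : x - y = z := by rw [← hyz, add_sub_cancel_left]
  have h2 : x - y ∈ nilpotentRadical p := h ▸ hz
  exact h2

/-- The component `y ∈ 𝔩` of `x ∈ 𝔭 = 𝔩 ⊕ 𝔲`. -/
def IsLevi.component (hl : IsLevi p l) (x : p) : l := (hl.exists_sub_mem x).choose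

theorem IsLevi.sub_component_mem (hl : IsLevi p l) (x : p) :
    x - LieSubalgebra.inclusion hl.le (hl.component x) ∈ nilpotentRadical p :=
  (hl.exists_sub_mem x).choose_spec

theorem IsLevi.component_eq (hl : IsLevi p l) (x : p) (y : l)
    (hy : x - LieSubalgebra.inclusion hl.le y ∈ nilpotentRadical p) : hl.component x = y := by
  have h1 := sub_mem hy (hl.sub_component_mem x)
  rw [sub_sub_sub_cancel_left, ← map_sub] at h1
  have h2 : LieSubalgebra.inclusion hl.le (hl.component x - y) ∈
      l.toSubmodule.comap p.toSubmodule.subtype := (hl.component x - y).2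
  have h3 := (Submodule.disjoint_def.1 hl.isCompl.disjoint) _ h2 h1
  rw [← sub_eq_zero]
  exact Subtype.ext (congrArg (fun w : p => (w : g)) h3)

/-- The projection `𝔭 = 𝔩 ⊕ 𝔲 → 𝔩` along the nilpotent radical, a homomorphism of Lie algebras. -/
def IsLevi.proj (hl : IsLevi p l) : p →ₗ⁅ℂ⁆ l where
  toFun := hl.component
  map_add' x y := by
    refine hl.component_eq _ _ ?_
    rw [map_add, add_sub_add_comm]
    exact add_mem (hl.sub_component_mem x) (hl.sub_component_mem y)
  map_smul' c x := by
    refine hl.component_eq _ _ ?_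
    rw [RingHom.id_apply, map_smul, ← smul_sub]
    exact (nilpotentRadical p).smul_mem c (hl.sub_component_mem x)
  map_lie' {x y} := by
    refine hl.component_eq _ _ ?_
    have h1 := lie_mem_right ℂ p (nilpotentRadical p) x _ (hl.sub_component_mem y)
    have h2 := lie_mem_left ℂ p (nilpotentRadical p) _
      (LieSubalgebra.inclusion hl.le (hl.component y)) (hl.sub_component_mem x)
    have h3 := add_mem h1 h2
    rw [lie_sub, sub_lie, sub_add_sub_cancel, ← LieHom.map_lie] at h3
    exact h3

/-- The induced module `U(𝔤) ⊗_{U(𝔭)} W` of a `𝔭`-module `W`: the quotient of `U(𝔤) ⊗_ℂ W` by the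
relations `(a b) ⊗ w = a ⊗ (b w)` for `b ∈ U(𝔭)`, with `U(𝔤)` acting by left multiplication. -/
def inducedObj (p : LieSubalgebra ℂ g) (W : Type u) [AddCommGroup W] [Module ℂ W]
    [LieRingModule p W] [LieModule ℂ p W] : ModuleCat.{u} (UEnv g) :=
  ModuleCat.of (UEnv g)
    (TensorProduct ℂ (UEnv g) (EnvModule p W) ⧸
      Submodule.span (UEnv g)
        {t : TensorProduct ℂ (UEnv g) (EnvModule p W) |
          ∃ (a : UEnv g) (b : UEnv p) (w : EnvModule p W),
            t = (a * UEnv.incl p b) ⊗ₜ[ℂ] w - a ⊗ₜ[ℂ] (b • w)})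

/-- The parabolically induced module `M_𝔭(V) = U(𝔤) ⊗_{U(𝔭)} V`, where the `𝔩`-module `V` is
regarded as a `𝔭`-module on which `𝔲` acts trivially. -/
def parabolicInduction (hl : IsLevi p l) (V : Type u) [AddCommGroup V] [Module ℂ V]
    [LieRingModule l V] [LieModule ℂ l V] : ModuleCat.{u} (UEnv g) :=
  inducedObj p (PullModule hl.proj V)

/-- The cohomology `Hⁿ(𝔲, M)` of the nilpotent radical `𝔲` of `𝔭` with coefficients in a
`𝔤`-module `M`, as an `𝔩`-module. -/
def nilpotentCohomology (hl : IsLevi p l) (M : Type u) [AddCommGroup M] [Module ℂ M]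
    [LieRingModule g M] [LieModule ℂ g M] (n : ℕ) : ModuleCat.{u} (UEnv l) :=
  envObj l (PullModule (LieSubalgebra.inclusion hl.le) (LieCohomology (nilpotentRadical p) M n))

end Parabolic

end

/-!
# Euler–Poincaré pairings of parabolically induced modules

The class of `𝔩`-modules `X` for which the identity holds, with `M` fixed and all pairings well
defined, is closed under cokernels of injective maps, because parabolic induction is exact and both
sides are additive on short exact sequences in `X` (`EulerIdentity.of_quotient`). It is therefore
enough to exhibit the identity on a class of modules from which all finitely generated weight modules
are obtained by finitely many such cokernels; this avoids spectral sequences and a derived adjunction.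

*Generation.* The Cartan subalgebra `𝔥` acts diagonalizably on `𝔤` (`isToral_of_isCartanSubalgebra`),
so that `(𝔩, 𝔥)`-modules are the modules that are spanned by weight vectors (`isPairModule_iff`). The
free weight modules, finite direct sums of modules `U(𝔩) ⊗_{U(𝔥)} ℂ_χ`, are free modules over a
polynomial ring up to a filtration, by the Poincaré–Birkhoff–Witt theorem, which is proved for induced
modules (`PBW.comm`, `PBW.desc_bijective`). Lifting a minimal presentation of the leading forms of a
submodule, and Hilbert's syzygy theorem (`pdLE_mvPolynomial`), show that every finitely generated
weight module has a finite resolution by free weight modules (`generation`).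

*The identity on generators* (`eulerIdentity_charMod`). The module `U(𝔩) ⊗_{U(𝔥)} ℂ_χ` is projective
among `(𝔩, 𝔥)`-modules, and its pairing with an admissible module is the dimension of the weight space
of weight `χ` (`ep_charMod`). On the side of `𝔩` this gives the Euler characteristic of the weight
spaces of `H^•(𝔲, M)`, which equals that of the Chevalley–Eilenberg complex: the alternating sum of
`dim M_{χ + α(S)}` over the subsets `S` of a basis of weight vectors of `𝔲`, where `α(S)` is the sum of
the weights of the elements of `S` (`sum_finrank_wt_lieCohomology`). On the side of `𝔤`,
parabolic induction turns the module into `U(𝔤) ⊗_{U(𝔥 + 𝔲)} ℂ_χ` (`exists_equiv_indMod_charMod`). A flag of subalgebras of the solvable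
algebra `𝔲` with weight vectors `e` as successive generators (`IsToral.exists_weightFlag`) yields, by
right multiplication by `e`, short exact sequences between the modules induced from the characters of
two successive subalgebras, and hence the same alternating sum (`WeightFlag.ep_charMod`).
-/

noncomputable section

/-! ### A Poincaré–Birkhoff–Witt theorem for induced modules -/

section PBW

set_option linter.unusedSectionVars false

attribute [local instance 100] LieRing.ofAssociativeRing

variable {a : Type*} [LieRing a] [LieAlgebra ℂ a] {b : LieSubalgebra ℂ a}
  {I : Type*} [Fintype I] [LinearOrder I]
  {W : Type*} [AddCommGroup W] [Module ℂ W] [LieRingModule b W] [LieModule ℂ b W]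

namespace PBW

/-- The linear map `∑ᵢ cᵢ eᵢ + y ↦ T ⊗ w ↦ ∑ᵢ cᵢ (i ::ₘ T) ⊗ w`, the leading part of the action on
`Multiset I →₀ W`. The isomorphism `E` encodes a complement of the subalgebra `b` and its basis
`eᵢ = E (Pi.single i 1, 0)`; that `E (0, y) = y` for `y ∈ b` is assumed where it is needed. -/
def top (E : ((I → ℂ) × b) ≃ₗ[ℂ] a) : (Multiset I →₀ W) →ₗ[ℂ] a →ₗ[ℂ] (Multiset I →₀ W) :=
  Finsupp.lsum ℂ fun T => LinearMap.mk₂ ℂ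
    (fun w z => ∑ i, (E.symm z).1 i • Finsupp.single (i ::ₘ T) w)
    (fun w w' z => by simp [Finset.sum_add_distrib])
    (fun c w z => by
      rw [Finset.smul_sum]
      refine Finset.sum_congr rfl fun i _ => ?_
      rw [← Finsupp.smul_single, smul_comm])
    (fun w z z' => by simp [add_smul, Finset.sum_add_distrib])
    (fun c w z => by simp [Finset.smul_sum, mul_smul])

theorem top_single (E : ((I → ℂ) × b) ≃ₗ[ℂ] a) (T : Multiset I) (w : W) (z : a) :
    top E (Finsupp.single T w) z = ∑ i, (E.symm z).1 i • Finsupp.single (i ::ₘ T) w := by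
  simp [top]

/-- The projection of `a` onto the span of `b` and of the `eᵢ` with `k < i`. -/
def trunc (E : ((I → ℂ) × b) ≃ₗ[ℂ] a) (k : I) : a →ₗ[ℂ] a :=
  E.toLinearMap ∘ₗ
    ((LinearMap.pi fun i => if k < i then LinearMap.proj i else 0).prodMap LinearMap.id) ∘ₗ
    E.symm.toLinearMap

theorem symm_trunc_fst (E : ((I → ℂ) × b) ≃ₗ[ℂ] a) (k i : I) (z : a) :
    (E.symm (trunc E k z)).1 i = if k < i then (E.symm z).1 i else 0 := by
  simp only [trunc, LinearMap.comp_apply, LinearEquiv.coe_coe, LinearEquiv.symm_apply_apply,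
    LinearMap.prodMap_apply, LinearMap.pi_apply]
  split_ifs <;> simp

/-- The correction term `eₖ · (y · (T' ⊗ w) - top y (T' ⊗ w)) + [y, eₖ] · (T' ⊗ w)`, where `y` is
the truncation of `z`, in terms of a provisional action `f`. -/
def corr (E : ((I → ℂ) × b) ≃ₗ[ℂ] a)
    (f : (Multiset I →₀ W) →ₗ[ℂ] a →ₗ[ℂ] (Multiset I →₀ W)) (k : I) (x : Multiset I →₀ W)
    (z : a) : Multiset I →₀ W :=
  f (f x (trunc E k z) - top E x (trunc E k z)) (E (Pi.single k 1, 0)) +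
    f x ⁅trunc E k z, E (Pi.single k 1, 0)⁆

theorem corr_add_left (E : ((I → ℂ) × b) ≃ₗ[ℂ] a)
    (f : (Multiset I →₀ W) →ₗ[ℂ] a →ₗ[ℂ] (Multiset I →₀ W)) (k : I) (x x' : Multiset I →₀ W)
    (z : a) : corr E f k (x + x') z = corr E f k x z + corr E f k x' z := by
  simp only [corr, map_add, map_sub, LinearMap.add_apply, LinearMap.sub_apply]
  abel

theorem corr_smul_left (E : ((I → ℂ) × b) ≃ₗ[ℂ] a)
    (f : (Multiset I →₀ W) →ₗ[ℂ] a →ₗ[ℂ] (Multiset I →₀ W)) (k : I) (c : ℂ)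
    (x : Multiset I →₀ W) (z : a) : corr E f k (c • x) z = c • corr E f k x z := by
  simp only [corr, map_smul, map_sub, LinearMap.smul_apply, LinearMap.sub_apply, smul_add,
    smul_sub]

theorem corr_add_right (E : ((I → ℂ) × b) ≃ₗ[ℂ] a)
    (f : (Multiset I →₀ W) →ₗ[ℂ] a →ₗ[ℂ] (Multiset I →₀ W)) (k : I) (x : Multiset I →₀ W)
    (z z' : a) : corr E f k x (z + z') = corr E f k x z + corr E f k x z' := by
  simp only [corr, map_add, map_sub, LinearMap.add_apply, LinearMap.sub_apply, add_lie]
  abel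

theorem corr_smul_right (E : ((I → ℂ) × b) ≃ₗ[ℂ] a)
    (f : (Multiset I →₀ W) →ₗ[ℂ] a →ₗ[ℂ] (Multiset I →₀ W)) (k : I) (c : ℂ)
    (x : Multiset I →₀ W) (z : a) : corr E f k x (c • z) = c • corr E f k x z := by
  simp only [corr, map_smul, map_sub, LinearMap.smul_apply, LinearMap.sub_apply, smul_add,
    smul_sub, smul_lie]

/-- The least element of a nonempty multiset. -/
def least (T : Multiset I) (hT : T ≠ 0) : I :=
  T.toFinset.min' (by
    obtain ⟨i, hi⟩ := Multiset.exists_mem_of_ne_zero hT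
    exact ⟨i, Multiset.mem_toFinset.2 hi⟩)

theorem least_mem (T : Multiset I) (hT : T ≠ 0) : least T hT ∈ T :=
  Multiset.mem_toFinset.1 (Finset.min'_mem _ _)

theorem least_le (T : Multiset I) (hT : T ≠ 0) {i : I} (hi : i ∈ T) : least T hT ≤ i :=
  Finset.min'_le _ _ (Multiset.mem_toFinset.2 hi)

theorem least_cons {k : I} {T : Multiset I} (h : ∀ i ∈ T, k ≤ i) :
    least (k ::ₘ T) (Multiset.cons_ne_zero) = k := by
  refine le_antisymm (least_le _ _ (Multiset.mem_cons_self _ _)) ?_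
  rcases Multiset.mem_cons.1 (least_mem (k ::ₘ T) Multiset.cons_ne_zero) with h1 | h1
  · exact h1.ge
  · exact h _ h1

/-- Provisional actions on `Multiset I →₀ W`: the `m`-th one is the right one on the elements of
degree at most `m`. -/
def stage (E : ((I → ℂ) × b) ≃ₗ[ℂ] a) :
    ℕ → ((Multiset I →₀ W) →ₗ[ℂ] a →ₗ[ℂ] (Multiset I →₀ W))
  | 0 => Finsupp.lsum ℂ fun T => LinearMap.mk₂ ℂ
      (fun w z => top E (Finsupp.single T w) z + Finsupp.single 0 ⁅(E.symm z).2, w⁆)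
      (fun w w' z => by simp only [Finsupp.single_add, map_add, LinearMap.add_apply, lie_add]; abel)
      (fun c w z => by
        simp only [← Finsupp.smul_single, map_smul, LinearMap.smul_apply, lie_smul, smul_add])
      (fun w z z' => by simp only [map_add, Prod.snd_add, add_lie, Finsupp.single_add]; abel)
      (fun c w z => by
        simp only [map_smul, Prod.smul_snd, smul_lie, smul_add, ← Finsupp.smul_single])
  | m + 1 => Finsupp.lsum ℂ fun T =>
      if h : Multiset.card T = m + 1 then
        have hT : T ≠ 0 := by rintro rfl; simp at h
        LinearMap.mk₂ ℂ
          (fun w z => top E (Finsupp.single T w) z +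
            corr E (stage E m) (least T hT) (Finsupp.single (T.erase (least T hT)) w) z)
          (fun w w' z => by
            simp only [Finsupp.single_add, map_add, LinearMap.add_apply, corr_add_left]; abel)
          (fun c w z => by
            simp only [← Finsupp.smul_single, map_smul, LinearMap.smul_apply, corr_smul_left,
              smul_add])
          (fun w z z' => by simp only [map_add, corr_add_right]; abel)
          (fun c w z => by simp only [map_smul, corr_smul_right, smul_add])
      else stage E m ∘ₗ Finsupp.lsingle T

theorem stage_succ_of_ne (E : ((I → ℂ) × b) ≃ₗ[ℂ] a) (m : ℕ) (T : Multiset I)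
    (h : Multiset.card T ≠ m + 1) (w : W) :
    stage E (m + 1) (Finsupp.single T w) = stage E m (Finsupp.single T w) := by
  rw [stage, Finsupp.lsum_single, dif_neg h]
  rfl

theorem stage_cons (E : ((I → ℂ) × b) ≃ₗ[ℂ] a) (m : ℕ) (k : I) (T : Multiset I)
    (hk : ∀ i ∈ T, k ≤ i) (h : Multiset.card T = m) (w : W) (z : a) :
    stage E (m + 1) (Finsupp.single (k ::ₘ T) w) z =
      top E (Finsupp.single (k ::ₘ T) w) z + corr E (stage E m) k (Finsupp.single T w) z := by
  rw [stage, Finsupp.lsum_single, dif_pos (by simp [h])]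
  simp only [LinearMap.mk₂_apply, least_cons hk, Multiset.erase_cons_head]

theorem stage_zero (E : ((I → ℂ) × b) ≃ₗ[ℂ] a) (w : W) (z : a) :
    stage E 0 (Finsupp.single 0 w) z =
      top E (Finsupp.single 0 w) z + Finsupp.single 0 ⁅(E.symm z).2, w⁆ := by
  rw [stage, Finsupp.lsum_single, LinearMap.mk₂_apply]

theorem stage_add (E : ((I → ℂ) × b) ≃ₗ[ℂ] a) (m n : ℕ) (T : Multiset I)
    (h : Multiset.card T ≤ m) (w : W) :
    stage E (m + n) (Finsupp.single T w) = stage E m (Finsupp.single T w) := by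
  induction n with
  | zero => rfl
  | succ n ih => rw [← add_assoc, stage_succ_of_ne _ _ _ (by omega), ih]

variable (I W) in
/-- The elements of degree less than `n`. -/
def degLT (n : ℕ) : Submodule ℂ (Multiset I →₀ W) :=
  Finsupp.supported W ℂ {T | Multiset.card T < n}

theorem single_mem_degLT {n : ℕ} {T : Multiset I} (h : Multiset.card T < n) (w : W) :
    Finsupp.single T w ∈ degLT I W n :=
  Finsupp.single_mem_supported ℂ w h

theorem degLT_induction {n : ℕ} {p : (Multiset I →₀ W) → Prop}
    (h : ∀ T w, Multiset.card T < n → p (Finsupp.single T w)) (h0 : p 0)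
    (hadd : ∀ x y, p x → p y → p (x + y)) {x : Multiset I →₀ W} (hx : x ∈ degLT I W n) : p x := by
  rw [← Finsupp.sum_single x]
  refine Finset.sum_induction _ p hadd h0 fun T hT => h T _ ?_
  exact (Finsupp.mem_supported ℂ x).1 hx hT

theorem degLT_mono {m n : ℕ} (h : m ≤ n) : degLT I W m ≤ degLT I W n :=
  Finsupp.supported_mono fun _ hT => lt_of_lt_of_le hT h

/-- The action of `a` on `Multiset I →₀ W`, with the vector as first argument. -/
def act (E : ((I → ℂ) × b) ≃ₗ[ℂ] a) :
    (Multiset I →₀ W) →ₗ[ℂ] a →ₗ[ℂ] (Multiset I →₀ W) :=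
  Finsupp.lsum ℂ fun T => stage E (Multiset.card T) ∘ₗ Finsupp.lsingle T

theorem act_single (E : ((I → ℂ) × b) ≃ₗ[ℂ] a) (T : Multiset I) (w : W) :
    act E (Finsupp.single T w) = stage E (Multiset.card T) (Finsupp.single T w) := by
  rw [act, Finsupp.lsum_single]
  rfl

theorem stage_eq_act (E : ((I → ℂ) × b) ≃ₗ[ℂ] a) (m : ℕ) {x : Multiset I →₀ W}
    (hx : x ∈ degLT I W (m + 1)) : stage E m x = act E x := by
  refine degLT_induction (p := fun x => stage E m x = act E x) (fun T w hT => ?_) (by simp)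
    (fun x y hx hy => by rw [map_add, map_add, hx, hy]) hx
  obtain ⟨n, rfl⟩ := Nat.exists_eq_add_of_le (Nat.lt_succ_iff.1 hT)
  rw [act_single, stage_add _ _ _ _ le_rfl]

theorem top_mem (E : ((I → ℂ) × b) ≃ₗ[ℂ] a) {n : ℕ} {x : Multiset I →₀ W}
    (hx : x ∈ degLT I W n) (z : a) : top E x z ∈ degLT I W (n + 1) := by
  refine degLT_induction (p := fun x => top E x z ∈ degLT I W (n + 1)) (fun T w hT => ?_)
    (by simp) (fun x y hx hy => by rw [map_add, LinearMap.add_apply]; exact add_mem hx hy) hx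
  rw [top_single]
  exact Submodule.sum_mem _ fun i _ =>
    Submodule.smul_mem _ _ (single_mem_degLT (by simpa using hT) w)

theorem exists_cons {T : Multiset I} (hT : T ≠ 0) :
    ∃ k T', T = k ::ₘ T' ∧ ∀ i ∈ T', k ≤ i :=
  ⟨least T hT, T.erase (least T hT), (Multiset.cons_erase (least_mem T hT)).symm,
    fun _ hi => least_le T hT (Multiset.mem_of_mem_erase hi)⟩

/-- Up to terms of lower degree, the provisional actions are given by their leading part. -/
theorem stage_sub_top_mem (E : ((I → ℂ) × b) ≃ₗ[ℂ] a) (m : ℕ) {n : ℕ} (hn : n ≤ m + 1)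
    {x : Multiset I →₀ W} (hx : x ∈ degLT I W n) (z : a) :
    stage E m x z - top E x z ∈ degLT I W n := by
  induction m generalizing n x z with
  | zero =>
    refine degLT_induction (p := fun x => stage E 0 x z - top E x z ∈ degLT I W n)
      (fun T w hT => ?_) (by simp) (fun x y hx hy => by
        simp only [map_add, LinearMap.add_apply, add_sub_add_comm]; exact add_mem hx hy) hx
    obtain rfl : T = 0 := by
      rw [← Multiset.card_eq_zero]; omega
    rw [stage_zero, add_sub_cancel_left]
    exact single_mem_degLT hT _
  | succ m ih =>
    refine degLT_induction (p := fun x => stage E (m + 1) x z - top E x z ∈ degLT I W n)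
      (fun T w hT => ?_) (by simp) (fun x y hx hy => by
        simp only [map_add, LinearMap.add_apply, add_sub_add_comm]; exact add_mem hx hy) hx
    by_cases h : Multiset.card T = m + 1
    · obtain ⟨k, T, rfl, hk⟩ := exists_cons (T := T) (by rintro rfl; simp at h)
      rw [Multiset.card_cons, add_left_inj] at h
      have hn' : n = m + 2 := by rw [Multiset.card_cons, h] at hT; omega
      subst hn'
      rw [stage_cons _ _ _ _ hk h, add_sub_cancel_left, corr]
      have hT' : Finsupp.single T w ∈ degLT I W (m + 1) := single_mem_degLT (by omega) w
      have key : ∀ y ∈ degLT I W (m + 1), ∀ z, stage E m y z ∈ degLT I W (m + 2) := by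
        intro y hy z
        have h1 := ih le_rfl hy z
        have h2 := top_mem E hy z
        have := add_mem (degLT_mono (Nat.le_succ _) h1) h2
        rwa [sub_add_cancel] at this
      exact add_mem (key _ (ih le_rfl hT' _) _) (key _ hT' _)
    · rw [stage_succ_of_ne _ _ _ h]
      exact degLT_mono (by omega) (ih (n := min n (m + 1)) (min_le_right _ _)
        (single_mem_degLT (by
          rw [lt_min_iff]; exact ⟨hT, by omega⟩) w) z)

theorem act_sub_top_mem (E : ((I → ℂ) × b) ≃ₗ[ℂ] a) {n : ℕ}
    {x : Multiset I →₀ W} (hx : x ∈ degLT I W n) (z : a) :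
    act E x z - top E x z ∈ degLT I W n := by
  rw [← stage_eq_act E n (degLT_mono (Nat.le_succ n) hx)]
  exact stage_sub_top_mem E n (Nat.le_succ n) hx z

theorem act_zero (E : ((I → ℂ) × b) ≃ₗ[ℂ] a) (w : W) (z : a) :
    act E (Finsupp.single 0 w) z =
      top E (Finsupp.single 0 w) z + Finsupp.single 0 ⁅(E.symm z).2, w⁆ := by
  rw [act_single, Multiset.card_zero, stage_zero]

/-- The recursion that defines the action. The factor `eₖ` is split off, and for the truncation `y` of the
acting element `y · eₖ = eₖ · y + [y, eₖ]` is applied. -/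
theorem act_cons (E : ((I → ℂ) × b) ≃ₗ[ℂ] a) (k : I) (T : Multiset I)
    (hk : ∀ i ∈ T, k ≤ i) (w : W) (z : a) :
    act E (Finsupp.single (k ::ₘ T) w) z =
      top E (Finsupp.single (k ::ₘ T) w) z + corr E (act E) k (Finsupp.single T w) z := by
  have hT : Finsupp.single T w ∈ degLT I W (Multiset.card T + 1) :=
    single_mem_degLT (Nat.lt_succ_self _) w
  rw [act_single, Multiset.card_cons, stage_cons _ _ _ _ hk rfl, corr, corr,
    stage_eq_act _ _ hT, stage_eq_act _ _ (act_sub_top_mem E hT _)]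

/-- The commutator relation `y · (z · x) - z · (y · x) = [y, z] · x`. -/
def Comm (E : ((I → ℂ) × b) ≃ₗ[ℂ] a) (y z : a) (x : Multiset I →₀ W) : Prop :=
  act E (act E x z) y - act E (act E x y) z = act E x ⁅y, z⁆

variable {E : ((I → ℂ) × b) ≃ₗ[ℂ] a}

theorem Comm.symm {y z : a} {x : Multiset I →₀ W} (h : Comm E y z x) : Comm E z y x := by
  rw [Comm, ← neg_sub, h, ← map_neg, lie_skew]

theorem Comm.refl (y : a) (x : Multiset I →₀ W) : Comm E y y x := by simp [Comm]

theorem Comm.add {y z : a} {x x' : Multiset I →₀ W} (h : Comm E y z x) (h' : Comm E y z x') :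
    Comm E y z (x + x') := by
  simp only [Comm, map_add, LinearMap.add_apply] at h h' ⊢
  rw [← h, ← h']
  abel

theorem Comm.smul {y z : a} {x : Multiset I →₀ W} (c : ℂ) (h : Comm E y z x) :
    Comm E y z (c • x) := by
  simp only [Comm, map_smul, LinearMap.smul_apply] at h ⊢
  rw [← smul_sub, h]

theorem Comm.zero (y z : a) : Comm E y z (0 : Multiset I →₀ W) := by simp [Comm]

theorem Comm.add_left {y y' z : a} {x : Multiset I →₀ W} (h : Comm E y z x)
    (h' : Comm E y' z x) : Comm E (y + y') z x := by
  simp only [Comm, map_add, LinearMap.add_apply, add_lie] at h h' ⊢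
  rw [← h, ← h']
  abel

theorem Comm.smul_left {y z : a} {x : Multiset I →₀ W} (c : ℂ) (h : Comm E y z x) :
    Comm E (c • y) z x := by
  simp only [Comm, map_smul, LinearMap.smul_apply, smul_lie] at h ⊢
  rw [← smul_sub, h]

theorem Comm.zero_left (z : a) (x : Multiset I →₀ W) : Comm E 0 z x := by simp [Comm]

/-- A property of elements of `a` stable under linear combinations holds everywhere if it holds
on `b` and for all `eᵢ`. -/
theorem induction_basis {p : a → Prop} (h0 : p 0) (hadd : ∀ x y, p x → p y → p (x + y))
    (hsmul : ∀ (c : ℂ) x, p x → p (c • x)) (he : ∀ i, p (E (Pi.single i 1, 0)))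
    (hb : ∀ y : b, p (E (0, y))) (z : a) : p z := by
  obtain ⟨⟨c, y⟩, rfl⟩ := E.surjective z
  have h1 : (c, y) = ∑ i, c i • ((Pi.single i 1, 0) : (I → ℂ) × b) + (0, y) := by
    refine Prod.ext ?_ ?_
    · simp only [Prod.fst_add, Prod.fst_sum, Prod.smul_fst, add_zero]
      exact pi_eq_sum_univ' c
    · simp [Prod.snd_sum]
  rw [h1, map_add, map_sum]
  refine hadd _ _ (Finset.sum_induction _ p hadd h0 fun i _ => ?_) (hb y)
  rw [map_smul]
  exact hsmul _ _ (he i)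

theorem top_e (i : I) (T : Multiset I) (w : W) :
    top E (Finsupp.single T w) (E (Pi.single i 1, 0)) = Finsupp.single (i ::ₘ T) w := by
  rw [top_single, Finset.sum_eq_single i] <;> simp +contextual

theorem trunc_e_of_le {i k : I} (h : i ≤ k) : trunc E k (E (Pi.single i 1, 0)) = 0 := by
  apply E.symm.injective
  refine Prod.ext ?_ (by simp [trunc])
  funext j
  rw [symm_trunc_fst, map_zero]
  by_cases hj : j = i
  · subst hj; simp [h.not_gt]
  · simp [hj]

theorem trunc_e_of_lt {i k : I} (h : k < i) :
    trunc E k (E (Pi.single i 1, 0)) = E (Pi.single i 1, 0) := by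
  apply E.symm.injective
  refine Prod.ext ?_ (by simp [trunc])
  funext j
  rw [symm_trunc_fst]
  by_cases hj : j = i
  · subst hj; simp [h]
  · simp [hj]

theorem trunc_b (k : I) (y : b) : trunc E k (E (0, y)) = E (0, y) := by
  apply E.symm.injective
  refine Prod.ext ?_ (by simp [trunc])
  funext j
  rw [symm_trunc_fst]
  simp

theorem act_e_of_le (i : I) (T : Multiset I) (h : ∀ j ∈ T, i ≤ j) (w : W) :
    act E (Finsupp.single T w) (E (Pi.single i 1, 0)) = Finsupp.single (i ::ₘ T) w := by
  by_cases hT : T = 0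
  · subst hT
    rw [act_zero, top_e]
    simp
  · obtain ⟨k, T, rfl, hk⟩ := exists_cons hT
    rw [act_cons _ _ _ hk, top_e, corr, trunc_e_of_le (h k (Multiset.mem_cons_self k T))]
    simp

/-- If `i` is at most all entries of `T`, the commutator relation with `eᵢ` on `T ⊗ w` is the
definition of the action on `eᵢ · (T ⊗ w)`. -/
theorem comm_e_of_le (i : I) (T : Multiset I) (h : ∀ j ∈ T, i ≤ j) (w : W) (y : a)
    (hy : trunc E i y = y) : Comm E y (E (Pi.single i 1, 0)) (Finsupp.single T w) := by
  rw [Comm, act_e_of_le i T h, act_cons _ _ _ h, corr, hy, map_sub, LinearMap.sub_apply]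
  have h1 : act E (top E (Finsupp.single T w) y) (E (Pi.single i 1, 0)) =
      top E (Finsupp.single (i ::ₘ T) w) y := by
    rw [top_single, top_single, map_sum, LinearMap.sum_apply]
    refine Finset.sum_congr rfl fun j _ => ?_
    rw [map_smul, LinearMap.smul_apply]
    by_cases hij : i < j
    · rw [act_e_of_le, Multiset.cons_swap]
      intro k hk
      rcases Multiset.mem_cons.1 hk with rfl | hk
      · exact hij.le
      · exact h k hk
    · have : (E.symm y).1 j = 0 := by rw [← hy, symm_trunc_fst, if_neg hij]
      rw [this, zero_smul, zero_smul]
  rw [h1]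
  abel

/-- The inductive step for the commutator relation on `eₖ · (T ⊗ w)`, where `k` is the least entry: it
follows from the relations in lower degree and the Jacobi identity. -/
theorem comm_of_trunc (n : ℕ) (ih : ∀ y z, ∀ x ∈ degLT I W n, Comm E y z x) (k : I)
    (T : Multiset I) (hT : Multiset.card T < n) (hk : ∀ i ∈ T, k ≤ i) (w : W) (y z : a)
    (hy : trunc E k y = y) (hz : trunc E k z = z) :
    Comm E y z (Finsupp.single (k ::ₘ T) w) := by
  have hx : Finsupp.single T w ∈ degLT I W n := single_mem_degLT hT w
  have hx' : Finsupp.single T w ∈ degLT I W (Multiset.card T + 1) :=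
    single_mem_degLT (Nat.lt_succ_self _) w
  -- `[y, eₖ]` acts correctly on `z · (T ⊗ w)`: split off the leading part, all of whose entries
  -- are at least `k`.
  have key : ∀ y z, trunc E k y = y → trunc E k z = z →
      Comm E y (E (Pi.single k 1, 0)) (act E (Finsupp.single T w) z) := by
    intro y z hy hz
    rw [← sub_add_cancel (act E (Finsupp.single T w) z) (top E (Finsupp.single T w) z)]
    refine Comm.add (ih _ _ _ (degLT_mono hT (act_sub_top_mem E hx' z))) ?_
    rw [top_single]
    refine Finset.sum_induction _ (Comm E y _) (fun _ _ => Comm.add) (Comm.zero _ _) fun j _ => ?_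
    by_cases hj : k < j
    · refine Comm.smul _ (comm_e_of_le k _ (fun i hi => ?_) w y hy)
      rcases Multiset.mem_cons.1 hi with rfl | hi
      · exact hj.le
      · exact hk i hi
    · have : (E.symm z).1 j = 0 := by rw [← hz, symm_trunc_fst, if_neg hj]
      rw [this, zero_smul]
      exact Comm.zero _ _
  have h1 := key y z hy hz
  have h2 := key z y hz hy
  have h3 := ih y (E (Pi.single k 1, 0)) _ hx
  have h4 := ih z (E (Pi.single k 1, 0)) _ hx
  have h5 := ih y z _ hx
  have h6 := ih y ⁅z, E (Pi.single k 1, 0)⁆ _ hx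
  have h7 := ih z ⁅y, E (Pi.single k 1, 0)⁆ _ hx
  have h8 := ih ⁅y, z⁆ (E (Pi.single k 1, 0)) _ hx
  have hj : ⁅⁅y, z⁆, E (Pi.single k 1, 0)⁆ =
      ⁅y, ⁅z, E (Pi.single k 1, 0)⁆⁆ - ⁅z, ⁅y, E (Pi.single k 1, 0)⁆⁆ := lie_lie _ _ _
  simp only [Comm] at h1 h2 h3 h4 h5 h6 h7 h8 ⊢
  rw [← act_e_of_le (E := E) k T hk w]
  rw [sub_eq_iff_eq_add] at h3 h4 h8
  rw [h4, h3, h8, hj]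
  simp only [map_add, map_sub, LinearMap.add_apply] at *
  rw [← h5, ← h6, ← h7]
  simp only [map_sub, LinearMap.sub_apply]
  rw [sub_eq_iff_eq_add] at h1 h2
  rw [h1, h2]
  abel

/-- The action respects brackets. For two basis vectors, or one and an element of `b`, either one of
them is a basis vector that precedes all entries of `T`, or the least entry of `T` precedes both. -/
theorem comm (hE : ∀ y : b, E (0, y) = y) (y z : a) (x : Multiset I →₀ W) : Comm E y z x := by
  have main : ∀ n, ∀ y z, ∀ x ∈ degLT I W n, Comm E y z x := by
    intro n
    induction n with
    | zero =>
      intro y z x hx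
      have : x = 0 := by
        rw [degLT, Finsupp.mem_supported] at hx
        rw [← Finsupp.support_eq_empty, Finset.eq_empty_iff_forall_notMem]
        exact fun T hT => absurd (hx hT) (Nat.not_lt_zero _)
      rw [this]
      exact Comm.zero _ _
    | succ n ih =>
      intro y z x hx
      refine degLT_induction (p := Comm E y z) (fun T w hT => ?_) (Comm.zero _ _)
        (fun _ _ => Comm.add) hx
      have hK : ∀ (y z : a) (i : I), ¬ (∀ j ∈ T, i ≤ j) → (∀ k < i, trunc E k y = y) →
          (∀ k < i, trunc E k z = z) → Comm E y z (Finsupp.single T w) := by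
        intro y z i hi hy hz
        have hT0 : T ≠ 0 := by rintro rfl; simp at hi
        obtain ⟨k, T, rfl, hk⟩ := exists_cons hT0
        have hki : k < i := by
          by_contra hki
          refine hi fun j hj => ?_
          rcases Multiset.mem_cons.1 hj with rfl | hj
          · exact not_lt.1 hki
          · exact (not_lt.1 hki).trans (hk j hj)
        rw [Multiset.card_cons] at hT
        exact comm_of_trunc n ih k T (by omega) hk w y z (hy k hki) (hz k hki)
      have hee : ∀ i j, i < j →
          Comm E (E (Pi.single j 1, 0)) (E (Pi.single i 1, 0)) (Finsupp.single T w) := by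
        intro i j hij
        by_cases hi : ∀ k ∈ T, i ≤ k
        · exact comm_e_of_le i T hi w _ (trunc_e_of_lt hij)
        · exact hK _ _ i hi (fun k hk => trunc_e_of_lt (hk.trans hij))
            (fun k hk => trunc_e_of_lt hk)
      have hbe : ∀ (i : I) (y : b),
          Comm E (E (0, y)) (E (Pi.single i 1, 0)) (Finsupp.single T w) := by
        intro i y
        by_cases hi : ∀ k ∈ T, i ≤ k
        · exact comm_e_of_le i T hi w _ (trunc_b i y)
        · exact hK _ _ i hi (fun k hk => trunc_b k y) (fun k hk => trunc_e_of_lt hk)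
      have hbb : ∀ y z : b, Comm E (E (0, y)) (E (0, z)) (Finsupp.single T w) := by
        intro y z
        by_cases hT0 : T = 0
        · subst hT0
          have h1 : ∀ (y : b) (w : W), act E (Finsupp.single 0 w) (E (0, y)) =
              Finsupp.single 0 ⁅y, w⁆ := by
            intro y w
            rw [act_zero, top_single]
            simp
          have h2 : ⁅E (0, y), E (0, z)⁆ = E (0, ⁅y, z⁆) := by rw [hE, hE, hE]; rfl
          rw [Comm, h2, h1, h1, h1, h1, h1, ← Finsupp.single_sub, ← lie_lie]
        · obtain ⟨k, T, rfl, hk⟩ := exists_cons hT0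
          rw [Multiset.card_cons] at hT
          exact comm_of_trunc n ih k T (by omega) hk w _ _ (trunc_b k y) (trunc_b k z)
      refine induction_basis (E := E) (p := fun y => Comm E y z (Finsupp.single T w))
        (Comm.zero_left _ _) (fun _ _ => Comm.add_left) (fun c _ => Comm.smul_left c) ?_ ?_ y
      · intro i
        refine Comm.symm (induction_basis (E := E)
          (p := fun z => Comm E z (E (Pi.single i 1, 0)) (Finsupp.single T w))
          (Comm.zero_left _ _) (fun _ _ => Comm.add_left) (fun c _ => Comm.smul_left c) ?_ ?_ z)
        · intro j
          rcases lt_trichotomy i j with h | rfl | h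
          · exact hee i j h
          · exact Comm.refl _ _
          · exact (hee j i h).symm
        · exact hbe i
      · intro y
        refine Comm.symm (induction_basis (E := E)
          (p := fun z => Comm E z (E (0, y)) (Finsupp.single T w))
          (Comm.zero_left _ _) (fun _ _ => Comm.add_left) (fun c _ => Comm.smul_left c) ?_ ?_ z)
        · exact fun i => (hbe i y).symm
        · exact fun z => hbb z y
  obtain ⟨n, hn⟩ : ∃ n, x ∈ degLT I W n := by
    refine ⟨x.support.sup Multiset.card + 1, ?_⟩
    rw [degLT, Finsupp.mem_supported]
    exact fun T hT => Nat.lt_succ_of_le (Finset.le_sup (f := Multiset.card) hT)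
  exact main n y z x hn

/-- The representation of `a` on `Multiset I →₀ W`, as a homomorphism of algebras. -/
def rep (E : ((I → ℂ) × b) ≃ₗ[ℂ] a) (hE : ∀ y : b, E (0, y) = y) (W : Type*) [AddCommGroup W]
    [Module ℂ W] [LieRingModule b W] [LieModule ℂ b W] :
    UniversalEnvelopingAlgebra ℂ a →ₐ[ℂ] Module.End ℂ (Multiset I →₀ W) :=
  UniversalEnvelopingAlgebra.lift ℂ
    { (act E).flip with
      map_lie' := fun {y z} => by
        refine LinearMap.ext fun x => ?_
        exact Eq.symm (show Comm E y z x from comm hE y z x) }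

theorem rep_ι (hE : ∀ y : b, E (0, y) = y) (z : a) (x : Multiset I →₀ W) :
    rep E hE W (UniversalEnvelopingAlgebra.ι ℂ z) x = act E x z := by
  rw [rep, UniversalEnvelopingAlgebra.lift_ι_apply]
  rfl

end PBW

end PBW

/-! ### The universal property of the Poincaré–Birkhoff–Witt module -/

section PBWModule

set_option linter.unusedSectionVars false

attribute [local instance 100] LieRing.ofAssociativeRing

variable {a : Type u} [LieRing a] [LieAlgebra ℂ a] {b : LieSubalgebra ℂ a}
  {I : Type*} [Fintype I] [LinearOrder I]

/-- The module over `U(a)` induced from the `b`-module `W`, in its Poincaré–Birkhoff–Witt form: the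
underlying space is `Multiset I →₀ W`, where `I` indexes a basis of a complement of `b` given by
the isomorphism `E`. -/
def PBWModule (E : ((I → ℂ) × b) ≃ₗ[ℂ] a) (_ : ∀ y : b, E (0, y) = y) (W : Type*)
    [AddCommGroup W] : Type _ := Multiset I →₀ W

variable {E : ((I → ℂ) × b) ≃ₗ[ℂ] a} {hE : ∀ y : b, E (0, y) = y}
  {W : Type*} [AddCommGroup W] [Module ℂ W] [LieRingModule b W] [LieModule ℂ b W]

instance : AddCommGroup (PBWModule E hE W) := inferInstanceAs (AddCommGroup (Multiset I →₀ W))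

instance : Module ℂ (PBWModule E hE W) := inferInstanceAs (Module ℂ (Multiset I →₀ W))

instance : Module (UEnv a) (PBWModule E hE W) :=
  Module.compHom (Multiset I →₀ W) (PBW.rep E hE W).toRingHom

instance : IsScalarTower ℂ (UEnv a) (PBWModule E hE W) where
  smul_assoc c u x := by
    change PBW.rep E hE W (c • u) x = c • PBW.rep E hE W u x
    rw [map_smul]
    rfl

namespace PBW

theorem ι_smul (z : a) (x : PBWModule E hE W) :
    UniversalEnvelopingAlgebra.ι ℂ z • x = act E x z := rep_ι hE z x

/-- The ordered monomial in `U(a)` with factors `e i` for `i ∈ T`. -/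
def mon (e : I → a) (T : Multiset I) : UEnv a :=
  ((T.sort (· ≤ ·)).map fun i => UniversalEnvelopingAlgebra.ι ℂ (e i)).prod

theorem mon_zero (e : I → a) : mon e 0 = 1 := by simp [mon]

theorem mon_cons (e : I → a) {i : I} {T : Multiset I} (h : ∀ j ∈ T, i ≤ j) :
    mon e (i ::ₘ T) = UniversalEnvelopingAlgebra.ι ℂ (e i) * mon e T := by
  simp [mon, Multiset.sort_cons _ _ _ h]

theorem sort_append (T U : Multiset I) (h : ∀ i ∈ T, ∀ j ∈ U, i ≤ j) :
    (T + U).sort (· ≤ ·) = T.sort (· ≤ ·) ++ U.sort (· ≤ ·) := by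
  refine List.Perm.eq_of_pairwise' (Multiset.pairwise_sort _ _) ?_ ?_
  · rw [List.pairwise_append]
    refine ⟨Multiset.pairwise_sort _ _, Multiset.pairwise_sort _ _, fun i hi j hj => ?_⟩
    exact h i (by simpa using hi) j (by simpa using hj)
  · rw [← Multiset.coe_eq_coe, ← Multiset.coe_add]
    simp

theorem mon_add (e : I → a) (T U : Multiset I) (h : ∀ i ∈ T, ∀ j ∈ U, i ≤ j) :
    mon e (T + U) = mon e T * mon e U := by
  rw [mon, sort_append T U h, List.map_append, List.prod_append]
  rfl

variable (E) in
/-- The basis of the complement of `b` which is given by `E`. -/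
def vec (i : I) : a := E (Pi.single i 1, 0)

theorem multiset_induction {p : Multiset I → Prop} (h0 : p 0)
    (hc : ∀ i T, (∀ j ∈ T, i ≤ j) → p T → p (i ::ₘ T)) (T : Multiset I) : p T := by
  induction h : Multiset.card T generalizing T with
  | zero => rwa [Multiset.card_eq_zero.1 h]
  | succ n ih =>
    obtain ⟨k, T, rfl, hk⟩ := exists_cons (T := T) (by rintro rfl; simp at h)
    exact hc k T hk (ih T (by simpa using h))

theorem mon_smul_single (T : Multiset I) (w : W) :
    mon (vec E) T • (show PBWModule E hE W from Finsupp.single 0 w) = Finsupp.single T w := by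
  induction T using multiset_induction with
  | h0 => rw [mon_zero, one_smul]
  | hc i T hi ih =>
    rw [mon_cons _ hi, mul_smul, ih]
    exact (ι_smul _ _).trans (act_e_of_le i T hi w)

variable {Z : Type*} [AddCommGroup Z] [Module ℂ Z] [Module (UEnv a) Z] [IsScalarTower ℂ (UEnv a) Z]

variable (E) in
/-- The linear map `T ⊗ w ↦ e^T • j w`. -/
def lin (j : W →ₗ[ℂ] Z) : (Multiset I →₀ W) →ₗ[ℂ] Z :=
  Finsupp.lsum ℂ fun T => Algebra.lsmul ℂ ℂ Z (mon (vec E) T) ∘ₗ j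

theorem lin_single (j : W →ₗ[ℂ] Z) (T : Multiset I) (w : W) :
    lin E j (Finsupp.single T w) = mon (vec E) T • j w := by
  simp [lin]

theorem lin_cons (j : W →ₗ[ℂ] Z) {i : I} {T : Multiset I} (h : ∀ j ∈ T, i ≤ j) (w : W) :
    lin E j (Finsupp.single (i ::ₘ T) w) =
      UniversalEnvelopingAlgebra.ι ℂ (vec E i) • lin E j (Finsupp.single T w) := by
  rw [lin_single, lin_single, mon_cons _ h, mul_smul]

/-- The map `T ⊗ w ↦ e^T • j w` is equivariant if `j` is, by the same recursion that defines the action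
on `Multiset I →₀ W`. -/
theorem lin_act (j : W →ₗ[ℂ] Z)
    (hj : ∀ (y : b) (w : W), j ⁅y, w⁆ = UniversalEnvelopingAlgebra.ι ℂ (y : a) • j w)
    (hE : ∀ y : b, E (0, y) = y) (z : a) (x : Multiset I →₀ W) :
    lin E j (act E x z) = UniversalEnvelopingAlgebra.ι ℂ z • lin E j x := by
  let p : a → (Multiset I →₀ W) → Prop := fun z x =>
    lin E j (act E x z) = UniversalEnvelopingAlgebra.ι ℂ z • lin E j x
  have hp0 : ∀ z, p z 0 := fun z => by simp [p]
  have hpadd : ∀ z x x', p z x → p z x' → p z (x + x') := fun z x x' h h' => by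
    simp only [p, map_add, LinearMap.add_apply, smul_add] at h h' ⊢
    rw [h, h']
  have hpsmul : ∀ z (c : ℂ) x, p z x → p z (c • x) := fun z c x h => by
    simp only [p, map_smul, LinearMap.smul_apply] at h ⊢
    rw [h, smul_algebra_smul_comm]
  have hz0 : ∀ x, p 0 x := fun x => by simp [p]
  have hzadd : ∀ x z z', p z x → p z' x → p (z + z') x := fun x z z' h h' => by
    simp only [p, map_add, add_smul] at h h' ⊢
    rw [h, h']
  have hzsmul : ∀ x (c : ℂ) z, p z x → p (c • z) x := fun x c z h => by
    simp only [p, map_smul] at h ⊢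
    rw [h, smul_assoc]
  have main : ∀ n, ∀ z, ∀ x ∈ degLT I W n, p z x := by
    intro n
    induction n with
    | zero =>
      intro z x hx
      refine degLT_induction (p := p z) (fun T w hT => absurd hT (Nat.not_lt_zero _)) (hp0 z)
        (hpadd z) hx
    | succ n ih =>
      intro z x hx
      refine degLT_induction (p := p z) (fun T w hT => ?_) (hp0 z) (hpadd z) hx
      by_cases hT0 : T = 0
      · subst hT0
        change lin E j (act E _ z) = _
        rw [act_zero, top_single]
        obtain ⟨⟨c, y⟩, rfl⟩ := E.surjective z
        have h1 : E (c, y) = ∑ i, c i • vec E i + (y : a) := by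
          rw [← hE y]
          simp only [vec, ← map_smul, ← map_sum, ← map_add]
          congr 1
          refine Prod.ext ?_ ?_
          · simp only [Prod.fst_add, Prod.fst_sum, Prod.smul_fst, add_zero]
            exact pi_eq_sum_univ' c
          · simp [Prod.snd_sum]
        have h2 : UniversalEnvelopingAlgebra.ι ℂ (E (c, y)) =
            ∑ i, c i • UniversalEnvelopingAlgebra.ι ℂ (vec E i) +
              UniversalEnvelopingAlgebra.ι ℂ (y : a) := by
          rw [h1, map_add, map_sum]
          simp only [map_smul]
        rw [h2, add_smul, Finset.sum_smul, map_add, map_sum, lin_single, lin_single, mon_zero,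
          one_smul, one_smul, LinearEquiv.symm_apply_apply, hj]
        refine congrArg₂ (· + ·) (Finset.sum_congr rfl fun i _ => ?_) rfl
        rw [map_smul, lin_single, mon_cons _ (by simp), mon_zero, mul_one, smul_assoc]
      · obtain ⟨k, T, rfl, hk⟩ := exists_cons hT0
        rw [Multiset.card_cons] at hT
        have hx : Finsupp.single T w ∈ degLT I W n := single_mem_degLT (by omega) w
        have hx' : Finsupp.single T w ∈ degLT I W (Multiset.card T + 1) :=
          single_mem_degLT (Nat.lt_succ_self _) w
        have key : ∀ z, trunc E k z = z → p z (Finsupp.single (k ::ₘ T) w) := by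
          intro z hz
          have h1 : p (vec E k) (act E (Finsupp.single T w) z) := by
            rw [← sub_add_cancel (act E (Finsupp.single T w) z) (top E (Finsupp.single T w) z)]
            refine hpadd _ _ _ (ih _ _ (degLT_mono (by omega) (act_sub_top_mem E hx' z))) ?_
            rw [top_single]
            refine Finset.sum_induction _ (p _) (hpadd _) (hp0 _) fun i _ => ?_
            by_cases hi : k < i
            · refine hpsmul _ _ _ ?_
              have hle : ∀ l ∈ i ::ₘ T, k ≤ l := by
                intro l hl
                rcases Multiset.mem_cons.1 hl with rfl | hl
                · exact hi.le
                · exact hk l hl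
              change lin E j (act E _ (E (Pi.single k 1, 0))) = _
              rw [act_e_of_le k _ hle, lin_cons _ hle]
            · have : (E.symm z).1 i = 0 := by rw [← hz, symm_trunc_fst, if_neg hi]
              rw [this, zero_smul]
              exact hp0 _
          have h2 := comm_e_of_le k T hk w z hz
          have h3 : p z _ := ih z _ hx
          have h4 : p ⁅z, vec E k⁆ _ := ih ⁅z, vec E k⁆ _ hx
          rw [Comm, act_e_of_le k T hk, sub_eq_iff_eq_add] at h2
          change lin E j (act E _ z) = _
          simp only [p] at h1 h3 h4
          rw [h2, map_add]
          change lin E j (act E _ ⁅z, vec E k⁆) + lin E j (act E _ (vec E k)) = _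
          rw [h1, h3, h4, lin_cons _ hk, LieHom.map_lie, LieRing.of_associative_ring_bracket,
            sub_smul, mul_smul, mul_smul, sub_add_cancel]
        refine induction_basis (E := E) (p := fun z => p z (Finsupp.single (k ::ₘ T) w)) (hz0 _)
          (hzadd _) (hzsmul _) (fun i => ?_) (fun y => key _ (trunc_b k y)) z
        by_cases hi : k < i
        · exact key _ (trunc_e_of_lt hi)
        · have hle : ∀ l ∈ k ::ₘ T, i ≤ l := by
            intro l hl
            rcases Multiset.mem_cons.1 hl with rfl | hl
            · exact not_lt.1 hi
            · exact (not_lt.1 hi).trans (hk l hl)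
          change lin E j (act E _ _) = _
          rw [act_e_of_le i _ hle, lin_cons _ hle]
          rfl
  obtain ⟨n, hn⟩ : ∃ n, x ∈ degLT I W n := by
    refine ⟨x.support.sup Multiset.card + 1, ?_⟩
    rw [degLT, Finsupp.mem_supported]
    exact fun T hT => Nat.lt_succ_of_le (Finset.le_sup (f := Multiset.card) hT)
  exact main n z x hn

end PBW

theorem UEnv.mem_subalgebra (S : Subalgebra ℂ (UEnv a))
    (h : ∀ z : a, UniversalEnvelopingAlgebra.ι ℂ z ∈ S) (v : UEnv a) : v ∈ S := by
  let f : a →ₗ⁅ℂ⁆ S :=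
    { toFun := fun z => (⟨UniversalEnvelopingAlgebra.ι ℂ z, h z⟩ : S)
      map_add' := fun x y => Subtype.ext (map_add _ x y)
      map_smul' := fun c x => Subtype.ext (map_smul _ c x)
      map_lie' := fun {x y} => Subtype.ext (LieHom.map_lie _ x y) }
  let F : UEnv a →ₐ[ℂ] S := UniversalEnvelopingAlgebra.lift ℂ f
  have h3 : S.val.comp F = AlgHom.id ℂ (UEnv a) := by
    refine UniversalEnvelopingAlgebra.hom_ext ℂ (LieHom.ext fun z => ?_)
    change ((F (UniversalEnvelopingAlgebra.ι ℂ z) : S) : UEnv a) = UniversalEnvelopingAlgebra.ι ℂ z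
    rw [UniversalEnvelopingAlgebra.lift_ι_apply]
    rfl
  have h4 : ((F v : S) : UEnv a) = v := DFunLike.congr_fun h3 v
  exact h4 ▸ (F v).2

/-- A linear map between `U(a)`-modules which commutes with the action of `a` commutes with the
action of `U(a)`. -/
theorem UEnv.map_smul_of_ι {Y Z : Type*} [AddCommGroup Y] [Module ℂ Y] [Module (UEnv a) Y]
    [IsScalarTower ℂ (UEnv a) Y] [AddCommGroup Z] [Module ℂ Z] [Module (UEnv a) Z]
    [IsScalarTower ℂ (UEnv a) Z] (f : Y →ₗ[ℂ] Z)
    (h : ∀ (z : a) (y : Y), f (UniversalEnvelopingAlgebra.ι ℂ z • y) =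
      UniversalEnvelopingAlgebra.ι ℂ z • f y) (v : UEnv a) (y : Y) : f (v • y) = v • f y :=
  UEnv.mem_subalgebra
    { carrier := {v | ∀ y, f (v • y) = v • f y}
      mul_mem' := fun {v w} hv hw y => by
        rw [mul_smul, hv, hw, mul_smul]
      add_mem' := fun {v w} hv hw y => by
        rw [add_smul, map_add, hv, hw, add_smul]
      algebraMap_mem' := fun c y => by rw [algebraMap_smul, algebraMap_smul, map_smul] } h v y

theorem UEnv.smul_mem {Y : Type*} [AddCommGroup Y] [Module ℂ Y] [Module (UEnv a) Y]
    [IsScalarTower ℂ (UEnv a) Y] (N : Submodule ℂ Y)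
    (h : ∀ (z : a), ∀ y ∈ N, UniversalEnvelopingAlgebra.ι ℂ z • y ∈ N) (v : UEnv a) {y : Y}
    (hy : y ∈ N) : v • y ∈ N :=
  UEnv.mem_subalgebra
    { carrier := {v | ∀ y ∈ N, v • y ∈ N}
      mul_mem' := fun {v w} hv hw y hy => by
        rw [mul_smul]; exact hv _ (hw y hy)
      add_mem' := fun {v w} hv hw y hy => by
        rw [add_smul]; exact add_mem (hv y hy) (hw y hy)
      algebraMap_mem' := fun c y hy => by rw [algebraMap_smul]; exact N.smul_mem c hy } h v y hy

/-- A subspace which is stable under `a` is a `U(a)`-submodule. -/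
def UEnv.submodule {Y : Type*} [AddCommGroup Y] [Module ℂ Y] [Module (UEnv a) Y]
    [IsScalarTower ℂ (UEnv a) Y] (N : Submodule ℂ Y)
    (h : ∀ (z : a), ∀ y ∈ N, UniversalEnvelopingAlgebra.ι ℂ z • y ∈ N) : Submodule (UEnv a) Y where
  carrier := N
  add_mem' := add_mem
  zero_mem' := zero_mem _
  smul_mem' v _ hy := UEnv.smul_mem N h v hy

namespace PBW

variable {Z : Type*} [AddCommGroup Z] [Module ℂ Z] [Module (UEnv a) Z] [IsScalarTower ℂ (UEnv a) Z]

/-- The universal property of the induced module: a `b`-equivariant linear map `j : W → Z` into a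
`U(a)`-module extends to a homomorphism of `U(a)`-modules. -/
def desc (j : W →ₗ[ℂ] Z)
    (hj : ∀ (y : b) (w : W), j ⁅y, w⁆ = UniversalEnvelopingAlgebra.ι ℂ (y : a) • j w) :
    PBWModule E hE W →ₗ[UEnv a] Z :=
  { lin E j with
    map_smul' := fun v x => UEnv.map_smul_of_ι (show PBWModule E hE W →ₗ[ℂ] Z from lin E j)
      (fun z x => by rw [ι_smul]; exact lin_act j hj hE z x) v x }

variable (j : W →ₗ[ℂ] Z)
  (hj : ∀ (y : b) (w : W), j ⁅y, w⁆ = UniversalEnvelopingAlgebra.ι ℂ (y : a) • j w)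

variable (E hE W) in
/-- The inclusion of `W` into the induced module. -/
def incl : W →ₗ[ℂ] PBWModule E hE W := Finsupp.lsingle 0

theorem desc_single (T : Multiset I) (w : W) :
    desc (hE := hE) j hj (Finsupp.single T w) = mon (vec E) T • j w := lin_single j T w

theorem desc_incl (w : W) : desc (hE := hE) j hj (incl E hE W w) = j w := by
  refine (desc_single j hj 0 w).trans ?_
  rw [mon_zero, one_smul]

theorem incl_lie (y : b) (w : W) :
    incl E hE W ⁅y, w⁆ = UniversalEnvelopingAlgebra.ι ℂ (y : a) • incl E hE W w := by
  rw [ι_smul]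
  refine Eq.trans ?_ (act_zero E w (y : a)).symm
  rw [← hE y, top_single, LinearEquiv.symm_apply_apply]
  simp only [Pi.zero_apply, zero_smul, Finset.sum_const_zero, zero_add]
  rfl

theorem span_range_incl : Submodule.span (UEnv a) (Set.range (incl E hE W)) = ⊤ := by
  rw [eq_top_iff]
  intro x _
  refine Finsupp.induction_linear (motive := fun x => (show PBWModule E hE W from x) ∈
    Submodule.span (UEnv a) (Set.range (incl E hE W))) x (zero_mem _) (fun _ _ => add_mem)
    fun T w => ?_
  rw [← mon_smul_single (hE := hE)]
  exact Submodule.smul_mem _ _ (Submodule.subset_span ⟨w, rfl⟩)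

theorem hom_ext {f f' : PBWModule E hE W →ₗ[UEnv a] Z}
    (h : ∀ w, f (incl E hE W w) = f' (incl E hE W w)) : f = f' :=
  LinearMap.ext_on_range span_range_incl h

theorem desc_surjective (hgen : Submodule.span (UEnv a) (Set.range j) = ⊤) :
    Function.Surjective (desc (hE := hE) j hj) := by
  rw [← LinearMap.range_eq_top, eq_top_iff, ← hgen, Submodule.span_le]
  rintro _ ⟨w, rfl⟩
  exact ⟨_, desc_incl j hj w⟩

/-- A `U(a)`-module generated by the image of an equivariant map `j` from `W` is the induced module if
`j` has a retraction to the induced module, since there the monomials are independent. -/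
theorem desc_bijective (hgen : Submodule.span (UEnv a) (Set.range j) = ⊤)
    (r : Z →ₗ[UEnv a] PBWModule E hE W) (hr : ∀ w, r (j w) = incl E hE W w) :
    Function.Bijective (desc (hE := hE) j hj) := by
  refine ⟨?_, desc_surjective j hj hgen⟩
  have h : r ∘ₗ desc (hE := hE) j hj = LinearMap.id :=
    hom_ext fun w => by rw [LinearMap.comp_apply, desc_incl, hr, LinearMap.id_apply]
  exact Function.LeftInverse.injective (LinearMap.congr_fun h)

end PBW

end PBWModule

/-! ### Weight vectors -/

section Weights

variable {T : Type*} [AddCommGroup T] [Module ℂ T] {Y Y' : Type*} [AddCommGroup Y] [Module ℂ Y]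
  [AddCommGroup Y'] [Module ℂ Y']

/-- The simultaneous eigenspace of weight `χ` of a family `ρ` of operators. -/
def wt (ρ : T → Module.End ℂ Y) (χ : Module.Dual ℂ T) : Submodule ℂ Y where
  carrier := {y | ∀ x, ρ x y = χ x • y}
  add_mem' := fun {y z} hy hz x => by rw [map_add, hy, hz, smul_add]
  zero_mem' := fun x => by rw [map_zero, smul_zero]
  smul_mem' := fun c y hy x => by rw [map_smul, hy, smul_comm]

theorem mem_wt {ρ : T → Module.End ℂ Y} {χ : Module.Dual ℂ T} {y : Y} :
    y ∈ wt ρ χ ↔ ∀ x, ρ x y = χ x • y := Iff.rfl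

/-- The family of operators `ρ` is simultaneously diagonalizable. -/
def IsDiag (ρ : T → Module.End ℂ Y) : Prop := ⨆ χ, wt ρ χ = ⊤

variable {ρ : T → Module.End ℂ Y} {ρ' : T → Module.End ℂ Y'}

theorem IsDiag.exists_sum (h : IsDiag ρ) (y : Y) :
    ∃ (s : Finset (Module.Dual ℂ T)) (f : Module.Dual ℂ T → Y),
      (∀ χ, f χ ∈ wt ρ χ) ∧ ∑ χ ∈ s, f χ = y := by
  have hy : y ∈ ⨆ χ, wt ρ χ := by rw [h]; trivial
  obtain ⟨f, hf, rfl⟩ := (Submodule.mem_iSup_iff_exists_finsupp _ _).1 hy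
  exact ⟨f.support, f, hf, rfl⟩

theorem isDiag_of_mem (h : ∀ y, y ∈ ⨆ χ, wt ρ χ) : IsDiag ρ := eq_top_iff.2 fun y _ => h y

theorem IsDiag.induction (h : IsDiag ρ) {p : Y → Prop} (hw : ∀ χ, ∀ y ∈ wt ρ χ, p y)
    (hadd : ∀ y z, p y → p z → p (y + z)) (y : Y) : p y := by
  have hy : y ∈ ⨆ χ, wt ρ χ := by rw [h]; trivial
  exact Submodule.iSup_induction _ (motive := p) hy hw (hw 0 0 (zero_mem _)) hadd

/-- The weight components of an element of a stable subspace belong to the subspace. -/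
theorem mem_of_sum_wt_mem (N : Submodule ℂ Y) (hN : ∀ x, ∀ y ∈ N, ρ x y ∈ N)
    (s : Finset (Module.Dual ℂ T)) (f : Module.Dual ℂ T → Y) (hf : ∀ χ ∈ s, f χ ∈ wt ρ χ)
    (hs : ∑ χ ∈ s, f χ ∈ N) (χ : Module.Dual ℂ T) (hχ : χ ∈ s) : f χ ∈ N := by
  classical
  induction h : s.card generalizing s f with
  | zero => rw [Finset.card_eq_zero.1 h] at hχ; simp at hχ
  | succ n ih =>
    by_cases hμ : ∃ μ ∈ s, μ ≠ χ
    · obtain ⟨μ, hμs, hμ⟩ := hμ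
      obtain ⟨x, hx⟩ : ∃ x, χ x - μ x ≠ 0 := by
        by_contra! hx
        exact hμ (LinearMap.ext fun x => (sub_eq_zero.1 (hx x)).symm)
      have h1 := ih (s.erase μ) (fun ν => (ν x - μ x) • f ν)
        (fun ν hν => Submodule.smul_mem _ _ (hf ν (Finset.mem_of_mem_erase hν))) ?_
        (Finset.mem_erase.2 ⟨hμ.symm, hχ⟩) (by rw [Finset.card_erase_of_mem hμs, h]; rfl)
      · exact (N.smul_mem_iff hx).1 h1
      · have h2 : ∑ ν ∈ s.erase μ, (ν x - μ x) • f ν = ∑ ν ∈ s, (ν x - μ x) • f ν :=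
          Finset.sum_erase _ (by simp)
        have h3 : ∑ ν ∈ s, (ν x - μ x) • f ν =
            ρ x (∑ ν ∈ s, f ν) - μ x • ∑ ν ∈ s, f ν := by
          rw [map_sum, Finset.smul_sum, ← Finset.sum_sub_distrib]
          refine Finset.sum_congr rfl fun ν hν => ?_
          rw [hf ν hν x, sub_smul]
        rw [h2, h3]
        exact sub_mem (hN _ _ hs) (N.smul_mem _ hs)
    · push Not at hμ
      have : s = {χ} := Finset.eq_singleton_iff_unique_mem.2 ⟨hχ, hμ⟩
      rwa [this, Finset.sum_singleton] at hs

/-- A stable subspace is spanned by the weight vectors it contains. -/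
theorem IsDiag.induction_mem (h : IsDiag ρ) (N : Submodule ℂ Y) (hN : ∀ x, ∀ y ∈ N, ρ x y ∈ N)
    {p : Y → Prop} (h0 : p 0) (hw : ∀ χ, ∀ y ∈ wt ρ χ, y ∈ N → p y)
    (hadd : ∀ y z, p y → p z → p (y + z)) (y : Y) (hy : y ∈ N) : p y := by
  obtain ⟨s, f, hf, rfl⟩ := h.exists_sum y
  refine Finset.sum_induction _ p hadd h0 fun χ hχ => hw χ _ (hf χ) ?_
  exact mem_of_sum_wt_mem N hN s f (fun χ _ => hf χ) hy χ hχ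

theorem map_mem_wt (f : Y →ₗ[ℂ] Y') (hf : ∀ x y, f (ρ x y) = ρ' x (f y)) {χ : Module.Dual ℂ T}
    {y : Y} (hy : y ∈ wt ρ χ) : f y ∈ wt ρ' χ := fun x => by
  rw [← hf, hy x, map_smul]

theorem mem_wt_of_injective (f : Y →ₗ[ℂ] Y') (hf : ∀ x y, f (ρ x y) = ρ' x (f y))
    (hi : Function.Injective f) {χ : Module.Dual ℂ T} {y : Y} (hy : f y ∈ wt ρ' χ) :
    y ∈ wt ρ χ := fun x => hi (by rw [hf, hy x, map_smul])

theorem IsDiag.of_injective (h : IsDiag ρ') (f : Y →ₗ[ℂ] Y')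
    (hf : ∀ x y, f (ρ x y) = ρ' x (f y)) (hi : Function.Injective f) : IsDiag ρ := by
  refine isDiag_of_mem fun y => ?_
  obtain ⟨z, hz, hzy⟩ : ∃ z, z ∈ (⨆ χ, wt ρ χ) ∧ f z = f y := by
    refine h.induction_mem (LinearMap.range f) ?_ (p := fun y' => ∃ z, z ∈ (⨆ χ, wt ρ χ) ∧
      f z = y') ⟨0, zero_mem _, map_zero f⟩ ?_ ?_ (f y) ⟨y, rfl⟩
    · rintro x _ ⟨y, rfl⟩
      exact ⟨ρ x y, hf x y⟩
    · rintro χ _ hy ⟨z, rfl⟩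
      exact ⟨z, Submodule.mem_iSup_of_mem χ (mem_wt_of_injective f hf hi hy), rfl⟩
    · rintro _ _ ⟨z, hz, rfl⟩ ⟨w, hw, rfl⟩
      exact ⟨z + w, add_mem hz hw, map_add _ _ _⟩
  rwa [← hi hzy]

theorem IsDiag.of_surjective (h : IsDiag ρ) (f : Y →ₗ[ℂ] Y')
    (hf : ∀ x y, f (ρ x y) = ρ' x (f y)) (hs : Function.Surjective f) : IsDiag ρ' := by
  refine isDiag_of_mem fun y' => ?_
  obtain ⟨y, rfl⟩ := hs y'
  refine h.induction (p := fun y => f y ∈ ⨆ χ, wt ρ' χ) (fun χ y hy => ?_) (fun y z hy hz => ?_) y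
  · exact Submodule.mem_iSup_of_mem χ (map_mem_wt f hf hy)
  · rw [map_add]; exact add_mem hy hz

/-- Weight vectors lift along equivariant surjections. -/
theorem IsDiag.exists_lift (h : IsDiag ρ) (f : Y →ₗ[ℂ] Y')
    (hf : ∀ x y, f (ρ x y) = ρ' x (f y)) {χ : Module.Dual ℂ T} {y : Y} (hy : f y ∈ wt ρ' χ) :
    ∃ z ∈ wt ρ χ, f z = f y := by
  classical
  obtain ⟨s, g, hg, rfl⟩ := h.exists_sum y
  -- subtract the vector of weight `χ` from the component of weight `χ`
  have h1 := mem_of_sum_wt_mem (ρ := ρ') ⊥ (fun x y hy => by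
    rw [(Submodule.mem_bot ℂ).1 hy, map_zero]; exact zero_mem _) (insert χ s)
    (fun μ => (if μ ∈ s then f (g μ) else 0) - if μ = χ then f (∑ μ ∈ s, g μ) else 0) ?_ ?_
    χ (Finset.mem_insert_self _ _)
  · rw [if_pos rfl, Submodule.mem_bot, sub_eq_zero] at h1
    split_ifs at h1 with hχ
    · exact ⟨g χ, hg χ, h1⟩
    · exact ⟨0, zero_mem _, by rw [map_zero, h1]⟩
  · intro μ _
    refine sub_mem ?_ ?_
    · split_ifs
      · exact map_mem_wt f hf (hg μ)
      · exact zero_mem _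
    · split_ifs with hμ
      · exact hμ ▸ hy
      · exact zero_mem _
  · rw [Submodule.mem_bot, Finset.sum_sub_distrib, Finset.sum_ite_eq',
      if_pos (Finset.mem_insert_self _ _), Finset.sum_ite_mem, map_sum, sub_eq_zero,
      Finset.inter_eq_right.2 (Finset.subset_insert _ _)]

end Weights

section PairWeights

set_option linter.unusedSectionVars false

attribute [local instance 100] LieRing.ofAssociativeRing

variable {a : Type u} [LieRing a] [LieAlgebra ℂ a]

/-- The action of the elements of `t` on a module over `U(a)`. -/
def actU (t : LieSubalgebra ℂ a) (Y : Type*) [AddCommGroup Y] [Module ℂ Y] [Module (UEnv a) Y]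
    [IsScalarTower ℂ (UEnv a) Y] (x : t) : Module.End ℂ Y :=
  Algebra.lsmul ℂ ℂ Y (UniversalEnvelopingAlgebra.ι ℂ (x : a))

variable {t : LieSubalgebra ℂ a} {Y Z : Type*} [AddCommGroup Y] [Module ℂ Y] [Module (UEnv a) Y]
  [IsScalarTower ℂ (UEnv a) Y] [AddCommGroup Z] [Module ℂ Z] [Module (UEnv a) Z]
  [IsScalarTower ℂ (UEnv a) Z]

theorem actU_apply (x : t) (y : Y) :
    actU t Y x y = UniversalEnvelopingAlgebra.ι ℂ (x : a) • y := rfl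

theorem mem_wt_actU {χ : Module.Dual ℂ t} {y : Y} :
    y ∈ wt (actU t Y) χ ↔ ∀ x : t, UniversalEnvelopingAlgebra.ι ℂ (x : a) • y = χ x • y := Iff.rfl

theorem map_actU (f : Y →ₗ[UEnv a] Z) (x : t) (y : Y) :
    f.restrictScalars ℂ (actU t Y x y) = actU t Z x (f.restrictScalars ℂ y) := map_smul f _ _

/-- The abelian subalgebra `t` of `a` is toral: `a` is spanned by weight vectors for the adjoint
action of `t`. -/
structure IsToral (t : LieSubalgebra ℂ a) : Prop where
  lie_eq_zero : ∀ x y : t, ⁅x, y⁆ = 0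
  isDiag : IsDiag (fun x : t => (LieAlgebra.ad ℂ a (x : a) : Module.End ℂ a))

theorem ι_mul_ι_comm {x y : a} (h : ⁅x, y⁆ = 0) :
    UniversalEnvelopingAlgebra.ι ℂ x * UniversalEnvelopingAlgebra.ι ℂ y =
      UniversalEnvelopingAlgebra.ι ℂ y * UniversalEnvelopingAlgebra.ι ℂ x := by
  have h1 := LieHom.map_lie (UniversalEnvelopingAlgebra.ι ℂ) x y
  rw [h, map_zero, LieRing.of_associative_ring_bracket] at h1
  exact (sub_eq_zero.1 h1.symm)

/-- A vector of weight `α` in `a` maps vectors of weight `χ` to vectors of weight `χ + α`. -/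
theorem ι_smul_mem_wt {α χ : Module.Dual ℂ t} {e : a}
    (he : e ∈ wt (fun x : t => (LieAlgebra.ad ℂ a (x : a) : Module.End ℂ a)) α) {y : Y}
    (hy : y ∈ wt (actU t Y) χ) :
    UniversalEnvelopingAlgebra.ι ℂ e • y ∈ wt (actU t Y) (χ + α) := by
  rw [mem_wt_actU] at hy ⊢
  intro x
  have h1 := LieHom.map_lie (UniversalEnvelopingAlgebra.ι ℂ) (x : a) e
  have h2 : ⁅(x : a), e⁆ = α x • e := he x
  rw [h2, map_smul, LieRing.of_associative_ring_bracket, eq_sub_iff_add_eq] at h1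
  rw [← mul_smul, ← h1, add_smul, mul_smul, hy, smul_assoc, LinearMap.add_apply, add_smul,
    smul_algebra_smul_comm, add_comm]

/-- In a module generated by weight vectors, all vectors are sums of weight vectors. -/
theorem IsToral.isDiag_of_span (ht : IsToral t) {s : Set Y}
    (hs : ∀ y ∈ s, ∃ χ, y ∈ wt (actU t Y) χ) (h : Submodule.span (UEnv a) s = ⊤) :
    IsDiag (actU t Y) := by
  have hstab : ∀ z : a, ∀ y ∈ ⨆ χ, wt (actU t Y) χ,
      UniversalEnvelopingAlgebra.ι ℂ z • y ∈ ⨆ χ, wt (actU t Y) χ := by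
    intro z y hy
    refine ht.isDiag.induction (p := fun z => UniversalEnvelopingAlgebra.ι ℂ z • y ∈ _)
      (fun α e he => ?_) (fun z w hz hw => ?_) z
    · refine Submodule.iSup_induction _
        (motive := fun y => UniversalEnvelopingAlgebra.ι ℂ e • y ∈ _) hy (fun χ y hy => ?_) ?_ ?_
      · exact Submodule.mem_iSup_of_mem _ (ι_smul_mem_wt he hy)
      · rw [smul_zero]; exact zero_mem _
      · intro y z hy hz; rw [smul_add]; exact add_mem hy hz
    · rw [map_add, add_smul]; exact add_mem hz hw
  have h2 : UEnv.submodule _ hstab = ⊤ := by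
    rw [eq_top_iff, ← h, Submodule.span_le]
    intro y hy
    obtain ⟨χ, hχ⟩ := hs y hy
    exact Submodule.mem_iSup_of_mem χ hχ
  exact isDiag_of_mem fun y => (by rw [h2]; trivial : y ∈ UEnv.submodule _ hstab)

section Abelian

variable {s : Type u} [LieRing s] [LieAlgebra ℂ s] {X : Type u} [AddCommGroup X] [Module ℂ X]
  [Module (UEnv s) X] [IsScalarTower ℂ (UEnv s) X]

/-- The action of the elements of a Lie algebra on a module over its enveloping algebra. -/
def selfAct (s : Type u) [LieRing s] [LieAlgebra ℂ s] (X : Type u) [AddCommGroup X] [Module ℂ X]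
    [Module (UEnv s) X] [IsScalarTower ℂ (UEnv s) X] (x : s) : Module.End ℂ X :=
  Algebra.lsmul ℂ ℂ X (UniversalEnvelopingAlgebra.ι ℂ x)

theorem span_singleton_le_of_mem_wt {χ : Module.Dual ℂ s} {y : X} (hy : y ∈ wt (selfAct s X) χ)
    (v : UEnv s) : v • y ∈ Submodule.span ℂ {y} := by
  refine UEnv.smul_mem _ (fun z w hw => ?_) v (Submodule.mem_span_singleton_self y)
  obtain ⟨c, rfl⟩ := Submodule.mem_span_singleton.1 hw
  rw [smul_algebra_smul_comm]
  refine Submodule.smul_mem _ _ ?_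
  rw [show UniversalEnvelopingAlgebra.ι ℂ z • y = χ z • y from hy z]
  exact Submodule.smul_mem _ _ (Submodule.mem_span_singleton_self y)

theorem IsDiag.isLocallyFiniteSemisimple (h : IsDiag (selfAct s X)) :
    IsLocallyFiniteSemisimple (UEnv s) X where
  finite v := by
    obtain ⟨S, f, hf, rfl⟩ := h.exists_sum v
    have h1 : ((Submodule.span (UEnv s) {∑ χ ∈ S, f χ}).restrictScalars ℂ) ≤
        Submodule.span ℂ (f '' S) := by
      intro w hw
      obtain ⟨r, rfl⟩ := Submodule.mem_span_singleton.1 hw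
      rw [Finset.smul_sum]
      refine Submodule.sum_mem _ fun χ hχ => ?_
      refine Submodule.span_mono ?_ (span_singleton_le_of_mem_wt (hf χ) r)
      rw [Set.singleton_subset_iff]
      exact ⟨χ, hχ, rfl⟩
    have : FiniteDimensional ℂ (Submodule.span ℂ (f '' S)) :=
      FiniteDimensional.span_of_finite ℂ (S.finite_toSet.image f)
    exact Submodule.finiteDimensional_of_le h1
  semisimple := by
    let p : {y : X // ∃ χ, y ∈ wt (selfAct s X) χ} → Submodule (UEnv s) X :=
      fun y => Submodule.span (UEnv s) {y.1}
    refine isSemisimpleModule_of_isSemisimpleModule_submodule' (p := p) ?_ ?_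
    · rintro ⟨y, χ, hy⟩
      by_cases hy0 : y = 0
      · have : p ⟨y, χ, hy⟩ = ⊥ := by simp [p, hy0]
        rw [this, isSemisimpleModule_iff]
        have : Subsingleton (Submodule (UEnv s) (⊥ : Submodule (UEnv s) X)) :=
          (Submodule.subsingleton_iff _).2 inferInstance
        exact Subsingleton.instComplementedLattice
      · have : IsSimpleModule (UEnv s) (p ⟨y, χ, hy⟩) := by
          rw [isSimpleModule_iff_isAtom]
          refine ⟨?_, fun N hN => ?_⟩
          · rw [ne_eq, Submodule.span_singleton_eq_bot]; exact hy0
          · by_contra hN0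
            obtain ⟨w, hw, hw0⟩ := N.ne_bot_iff.1 hN0
            obtain ⟨r, hr⟩ := Submodule.mem_span_singleton.1 (hN.le hw)
            obtain ⟨c, hc⟩ := Submodule.mem_span_singleton.1 (span_singleton_le_of_mem_wt hy r)
            have hc0 : c ≠ 0 := by
              rintro rfl
              exact hw0 (by rw [← hr, ← hc, zero_smul])
            refine hN.not_ge ((Submodule.span_singleton_le_iff_mem _ _).2 ?_)
            have : c • y ∈ N := by rw [hc, hr]; exact hw
            exact ((N.restrictScalars ℂ).smul_mem_iff hc0).1 this
        infer_instance
    · rw [eq_top_iff]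
      intro y _
      refine h.induction (p := fun y => y ∈ iSup p) (fun χ y hy => ?_) (fun _ _ => add_mem) y
      exact Submodule.mem_iSup_of_mem ⟨y, χ, hy⟩ (Submodule.mem_span_singleton_self y)

/-- Simple modules over an abelian Lie algebra that are finite-dimensional consist of weight vectors, by
Schur's lemma. -/
theorem exists_weight_of_isSimpleModule (hs : ∀ x y : s, ⁅x, y⁆ = 0) [IsSimpleModule (UEnv s) X]
    [Module.Finite ℂ X] : ∃ χ, ∀ y : X, y ∈ wt (selfAct s X) χ := by
  have hnt : Nontrivial X := IsSimpleModule.nontrivial (UEnv s) X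
  have h1 : ∀ x : s, ∃ c : ℂ, ∀ y : X, selfAct s X x y = c • y := by
    intro x
    obtain ⟨c, hc⟩ := Module.End.exists_eigenvalue (selfAct s X x)
    have hst : ∀ z : s, ∀ y ∈ (selfAct s X x).eigenspace c,
        UniversalEnvelopingAlgebra.ι ℂ z • y ∈ (selfAct s X x).eigenspace c := by
      intro z y hy
      rw [Module.End.mem_eigenspace_iff] at hy ⊢
      change UniversalEnvelopingAlgebra.ι ℂ x • (UniversalEnvelopingAlgebra.ι ℂ z • y) = _
      rw [← mul_smul, ι_mul_ι_comm (hs x z), mul_smul]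
      rw [show UniversalEnvelopingAlgebra.ι ℂ x • y = c • y from hy, smul_algebra_smul_comm]
    have h2 : UEnv.submodule _ hst = ⊤ := by
      rcases eq_bot_or_eq_top (UEnv.submodule _ hst) with h | h
      · exfalso
        obtain ⟨y, hy⟩ := hc.exists_hasEigenvector
        have : y ∈ UEnv.submodule _ hst := hy.1
        rw [h] at this
        exact hy.2 ((Submodule.mem_bot _).1 this)
      · exact h
    refine ⟨c, fun y => ?_⟩
    have : y ∈ UEnv.submodule _ hst := by rw [h2]; trivial
    exact Module.End.mem_eigenspace_iff.1 this
  choose c hc using h1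
  obtain ⟨v, hv⟩ := exists_ne (0 : X)
  refine ⟨{ toFun := c, map_add' := fun x z => ?_, map_smul' := fun r x => ?_ }, fun y x => hc x y⟩
  · refine smul_left_injective ℂ hv ?_
    change c (x + z) • v = (c x + c z) • v
    rw [← hc, add_smul, ← hc, ← hc, selfAct, map_add, map_add]
    rfl
  · refine smul_left_injective ℂ hv ?_
    change c (r • x) • v = (r • c x) • v
    rw [← hc, smul_assoc, ← hc, selfAct, map_smul, map_smul]
    rfl

theorem IsLocallyFiniteSemisimple.isDiag (hs : ∀ x y : s, ⁅x, y⁆ = 0)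
    (h : IsLocallyFiniteSemisimple (UEnv s) X) : IsDiag (selfAct s X) := by
  have hstab : ∀ z : s, ∀ y ∈ ⨆ χ, wt (selfAct s X) χ,
      UniversalEnvelopingAlgebra.ι ℂ z • y ∈ ⨆ χ, wt (selfAct s X) χ := by
    intro z y hy
    refine Submodule.iSup_induction _
      (motive := fun y => UniversalEnvelopingAlgebra.ι ℂ z • y ∈ _) hy (fun χ y hy => ?_) ?_ ?_
    · rw [show UniversalEnvelopingAlgebra.ι ℂ z • y = χ z • y from hy z]
      exact Submodule.smul_mem _ _ (Submodule.mem_iSup_of_mem χ hy)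
    · rw [smul_zero]; exact zero_mem _
    · intro y z hy hz; rw [smul_add]; exact add_mem hy hz
  have h2 : UEnv.submodule _ hstab = ⊤ := by
    have := h.semisimple
    rw [eq_top_iff, ← IsSemisimpleModule.sSup_simples_eq_top (UEnv s) X]
    refine sSup_le fun S hS => ?_
    have hS' : IsSimpleModule (UEnv s) S := hS
    have hnt : Nontrivial S := IsSimpleModule.nontrivial (UEnv s) S
    obtain ⟨v, hv⟩ := exists_ne (0 : S)
    have hSv : S = Submodule.span (UEnv s) {(v : X)} := by
      have h3 : Submodule.span (UEnv s) {(v : X)} ≤ S :=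
        (Submodule.span_singleton_le_iff_mem _ _).2 v.2
      rcases (isSimpleModule_iff_isAtom.1 hS').le_iff.1 h3 with h4 | h4
      · rw [Submodule.span_singleton_eq_bot] at h4
        exact absurd (Subtype.ext h4) hv
      · exact h4.symm
    have : Module.Finite ℂ S := by rw [hSv]; exact h.finite _
    obtain ⟨χ, hχ⟩ := exists_weight_of_isSimpleModule (X := S) hs
    intro y hy
    refine Submodule.mem_iSup_of_mem χ fun x => ?_
    exact congrArg Subtype.val (hχ ⟨y, hy⟩ x)
  exact isDiag_of_mem fun y => (by rw [h2]; trivial : y ∈ UEnv.submodule _ hstab)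

end Abelian

theorem incl_ι (x : t) : UEnv.incl t (UniversalEnvelopingAlgebra.ι ℂ x) =
    UniversalEnvelopingAlgebra.ι ℂ (x : a) := by
  rw [UEnv.incl, UniversalEnvelopingAlgebra.lift_ι_apply]
  rfl

theorem resObj_smul (X : ModuleCat.{u} (UEnv a)) (c : ℂ) (y : X) :
    (c • (show resObj t X from y) : resObj t X) = (c • y : X) := by
  change (UEnv.incl t) (algebraMap ℂ (UEnv t) c) • y = algebraMap ℂ (UEnv a) c • y
  rw [AlgHom.commutes]

theorem resObj_mem_wt (X : ModuleCat.{u} (UEnv a)) (χ : Module.Dual ℂ t) (y : X) :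
    (show resObj t X from y) ∈ wt (selfAct t (resObj t X)) χ ↔ y ∈ wt (actU t X) χ := by
  refine forall_congr' fun x => ?_
  change UEnv.incl t (UniversalEnvelopingAlgebra.ι ℂ x) • y = _ ↔ _
  rw [incl_ι, resObj_smul]
  rfl

/-- For abelian `t`, locally finite and semisimple means simultaneously diagonalizable. -/
theorem isPairModule_iff (ht : ∀ x y : t, ⁅x, y⁆ = 0) (X : ModuleCat.{u} (UEnv a)) :
    IsPairModule t X ↔ IsDiag (actU t X) := by
  let f : X →ₗ[ℂ] resObj t X :=
    { toFun := fun y => y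
      map_add' := fun _ _ => rfl
      map_smul' := fun c y => (resObj_smul X c y).symm }
  have hf : ∀ (x : t) (y : X), f (actU t X x y) = selfAct t (resObj t X) x (f y) := by
    intro x y
    change _ = UEnv.incl t (UniversalEnvelopingAlgebra.ι ℂ x) • y
    rw [incl_ι]
    rfl
  constructor
  · intro h
    exact (IsLocallyFiniteSemisimple.isDiag ht h).of_injective f hf fun _ _ h => h
  · intro h
    exact (h.of_surjective f hf fun y => ⟨y, rfl⟩).isLocallyFiniteSemisimple

end PairWeights

/-! ### Euler–Poincaré pairings and short exact sequences -/

section LongExact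

theorem finite_of_exact {U V W : Type*} [AddCommGroup U] [AddCommGroup V] [AddCommGroup W]
    [Module ℂ U] [Module ℂ V] [Module ℂ W] (f : U →ₗ[ℂ] V) (g : V →ₗ[ℂ] W)
    (h : LinearMap.ker g ≤ LinearMap.range f) [Module.Finite ℂ U] [Module.Finite ℂ W] :
    Module.Finite ℂ V := by
  have h1 : Module.Finite ℂ (LinearMap.ker g) := Submodule.finiteDimensional_of_le h
  have h2 : Module.Finite ℂ (V ⧸ LinearMap.ker g) :=
    Module.Finite.equiv g.quotKerEquivRange.symm
  exact Module.Finite.of_submodule_quotient (LinearMap.ker g)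

/-- The alternating sum of the dimensions in the first `N` rows of a long exact sequence
`0 → A₀ → B₀ → C₀ → A₁ → B₁ → C₁ → ⋯` is, up to sign, the dimension of the kernel of
`A_N → B_N`. -/
theorem alternating_sum_of_longExact {A B C : ℕ → Type*} [∀ n, AddCommGroup (A n)]
    [∀ n, AddCommGroup (B n)] [∀ n, AddCommGroup (C n)] [∀ n, Module ℂ (A n)]
    [∀ n, Module ℂ (B n)] [∀ n, Module ℂ (C n)] [∀ n, Module.Finite ℂ (A n)]
    [∀ n, Module.Finite ℂ (B n)] [∀ n, Module.Finite ℂ (C n)]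
    (f : ∀ n, A n →ₗ[ℂ] B n) (g : ∀ n, B n →ₗ[ℂ] C n) (δ : ∀ n, C n →ₗ[ℂ] A (n + 1))
    (h0 : Function.Injective (f 0)) (hg : ∀ n, LinearMap.ker (g n) = LinearMap.range (f n))
    (hδ : ∀ n, LinearMap.ker (δ n) = LinearMap.range (g n))
    (hf : ∀ n, LinearMap.ker (f (n + 1)) = LinearMap.range (δ n)) (N : ℕ) :
    ∑ n ∈ Finset.range N, (-1 : ℤ) ^ n *
      ((Module.finrank ℂ (A n) : ℤ) - Module.finrank ℂ (B n) + Module.finrank ℂ (C n)) =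
      -(-1) ^ N * Module.finrank ℂ (LinearMap.ker (f N)) := by
  induction N with
  | zero => rw [LinearMap.ker_eq_bot.2 h0]; simp
  | succ N ih =>
    rw [Finset.sum_range_succ, ih, hf]
    have h1 := (f N).finrank_range_add_finrank_ker
    have h2 := (g N).finrank_range_add_finrank_ker
    have h3 := (δ N).finrank_range_add_finrank_ker
    rw [hg] at h2
    rw [hδ] at h3
    rw [← h1, ← h2, ← h3, pow_succ]
    push_cast
    ring

end LongExact

section EulerPoincare

attribute [local instance 100] LieRing.ofAssociativeRing

variable {a : Type u} [LieRing a] [LieAlgebra ℂ a] {t : LieSubalgebra ℂ a}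

open Abelian

namespace PairCat

variable {S : ShortComplex (PairCat t)}

/-- Composition with a morphism, on extension groups. -/
def extMap {X X' : PairCat t} (f : X ⟶ X') (Y : PairCat t) (n : ℕ) :
    PairExt t X' Y n →ₗ[ℂ] PairExt t X Y n :=
  Ext.bilinearCompOfLinear ℂ X X' Y 0 n n (zero_add n) (Ext.mk₀ f)

/-- The connecting homomorphism. -/
def extδ (hS : S.ShortExact) (Y : PairCat t) (n : ℕ) :
    PairExt t S.X₁ Y n →ₗ[ℂ] PairExt t S.X₃ Y (n + 1) :=
  Ext.bilinearCompOfLinear ℂ S.X₃ S.X₁ Y 1 n (n + 1) (add_comm 1 n) hS.extClass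

theorem ker_extMap_f (hS : S.ShortExact) (Y : PairCat t) (n : ℕ) :
    LinearMap.ker (extMap S.f Y n) = LinearMap.range (extMap S.g Y n) := by
  refine le_antisymm (fun x hx => Ext.contravariant_sequence_exact₂ hS Y x hx) ?_
  rintro _ ⟨x, rfl⟩
  change (Ext.mk₀ S.f).comp ((Ext.mk₀ S.g).comp x (zero_add n)) (zero_add n) = 0
  simp

theorem ker_extδ (hS : S.ShortExact) (Y : PairCat t) (n : ℕ) :
    LinearMap.ker (extδ hS Y n) = LinearMap.range (extMap S.f Y n) := by
  refine le_antisymm (fun x hx => Ext.contravariant_sequence_exact₁ hS Y x (add_comm 1 n) hx) ?_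
  rintro _ ⟨x, rfl⟩
  change hS.extClass.comp ((Ext.mk₀ S.f).comp x (zero_add n)) (add_comm 1 n) = 0
  rw [← Ext.comp_assoc (a₁₂ := 1) (a₂₃ := n) _ _ _ (by omega) (by omega) (by omega)]
  simp

theorem ker_extMap_g (hS : S.ShortExact) (Y : PairCat t) (n : ℕ) :
    LinearMap.ker (extMap S.g Y (n + 1)) = LinearMap.range (extδ hS Y n) := by
  refine le_antisymm (fun x hx => Ext.contravariant_sequence_exact₃ hS Y x hx (add_comm 1 n)) ?_
  rintro _ ⟨x, rfl⟩
  change (Ext.mk₀ S.g).comp (hS.extClass.comp x (add_comm 1 n)) (zero_add (n + 1)) = 0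
  rw [← Ext.comp_assoc (a₁₂ := 1) (a₂₃ := n + 1) _ _ _ (by omega) (by omega) (by omega)]
  simp

theorem extMap_g_injective (hS : S.ShortExact) (Y : PairCat t) :
    Function.Injective (extMap S.g Y 0) := by
  have := hS.epi_g
  exact Ext.precomp_mk₀_injective_of_epi Y S.g

/-- If the pairings of the first two terms of a short exact sequence with `Y` are well defined, so is
that of the third. -/
theorem epWellDefined_X₃ (hS : S.ShortExact) (Y : PairCat t)
    (h₁ : EPWellDefined t S.X₁ Y) (h₂ : EPWellDefined t S.X₂ Y) :
    EPWellDefined t S.X₃ Y where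
  finite i := by
    have := h₂.finite i
    cases i with
    | zero => exact Module.Finite.of_injective (extMap S.g Y 0) (extMap_g_injective hS Y)
    | succ i =>
      have := h₁.finite i
      exact finite_of_exact (extδ hS Y i) (extMap S.g Y (i + 1)) (ker_extMap_g hS Y i).le
  vanish := by
    obtain ⟨m, hm⟩ := h₁.vanish
    obtain ⟨n, hn⟩ := h₂.vanish
    refine ⟨max m n + 1, fun i hi => ?_⟩
    obtain ⟨i, rfl⟩ := Nat.exists_eq_add_of_le' (show 1 ≤ i by omega)
    have := hm i (by omega)
    have := hn (i + 1) (by omega)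
    refine ⟨fun x y => ?_⟩
    have key : ∀ x : PairExt t S.X₃ Y (i + 1), x = 0 := by
      intro x
      have hx : x ∈ LinearMap.ker (extMap S.g Y (i + 1)) := Subsingleton.elim _ _
      rw [ker_extMap_g hS Y i] at hx
      obtain ⟨z, rfl⟩ := hx
      rw [Subsingleton.elim z 0, map_zero]
    rw [key x, key y]

theorem epWellDefined_X₂ (hS : S.ShortExact) (Y : PairCat t)
    (h₁ : EPWellDefined t S.X₁ Y) (h₃ : EPWellDefined t S.X₃ Y) :
    EPWellDefined t S.X₂ Y where
  finite i := by
    have := h₁.finite i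
    have := h₃.finite i
    exact finite_of_exact (extMap S.g Y i) (extMap S.f Y i) (ker_extMap_f hS Y i).le
  vanish := by
    obtain ⟨m, hm⟩ := h₁.vanish
    obtain ⟨n, hn⟩ := h₃.vanish
    refine ⟨max m n, fun i hi => ?_⟩
    have := hm i (by omega)
    have := hn i (by omega)
    refine ⟨fun x y => ?_⟩
    have key : ∀ x : PairExt t S.X₂ Y i, x = 0 := by
      intro x
      have hx : x ∈ LinearMap.ker (extMap S.f Y i) := Subsingleton.elim _ _
      rw [ker_extMap_f hS Y i] at hx
      obtain ⟨z, rfl⟩ := hx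
      rw [Subsingleton.elim z 0, map_zero]
    rw [key x, key y]

end PairCat

theorem EPWellDefined.ep_eq_sum {X Y : PairCat t} {N : ℕ}
    (h : ∀ i, N ≤ i → Subsingleton (PairExt t X Y i)) :
    EP t X Y = ∑ i ∈ Finset.range N, (-1) ^ i * (Module.finrank ℂ (PairExt t X Y i) : ℤ) := by
  refine finsum_eq_sum_of_support_subset _ fun i hi => ?_
  by_contra hiN
  have := h i (by simpa using hiN)
  refine hi ?_
  simp only [Module.finrank_zero_of_subsingleton, Nat.cast_zero, mul_zero]

namespace PairCat

/-- The Euler–Poincaré pairing is additive in its first argument. -/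
theorem ep_X₂ {S : ShortComplex (PairCat t)} (hS : S.ShortExact) (Y : PairCat t)
    (h₁ : EPWellDefined t S.X₁ Y) (h₂ : EPWellDefined t S.X₂ Y) (h₃ : EPWellDefined t S.X₃ Y) :
    EP t S.X₂ Y = EP t S.X₁ Y + EP t S.X₃ Y := by
  obtain ⟨n₁, hn₁⟩ := h₁.vanish
  obtain ⟨n₂, hn₂⟩ := h₂.vanish
  obtain ⟨n₃, hn₃⟩ := h₃.vanish
  let N := max n₁ (max n₂ n₃)
  have := h₁.finite
  have := h₂.finite
  have := h₃.finite
  have key := alternating_sum_of_longExact (extMap S.g Y) (extMap S.f Y) (extδ hS Y)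
    (extMap_g_injective hS Y) (ker_extMap_f hS Y) (ker_extδ hS Y) (ker_extMap_g hS Y) N
  have h0 : Module.finrank ℂ (LinearMap.ker (extMap S.g Y N)) = 0 := by
    have := hn₃ N (by omega)
    exact Module.finrank_zero_of_subsingleton
  rw [h0, Nat.cast_zero, mul_zero] at key
  simp only [mul_add, mul_sub, Finset.sum_add_distrib, Finset.sum_sub_distrib] at key
  rw [EPWellDefined.ep_eq_sum (N := N) fun i hi => hn₁ i (by omega),
    EPWellDefined.ep_eq_sum (N := N) fun i hi => hn₂ i (by omega),
    EPWellDefined.ep_eq_sum (N := N) fun i hi => hn₃ i (by omega)]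
  linarith

end PairCat

/-- The short complex of `(𝔞, 𝔱)`-modules which is given by two homomorphisms of `U(𝔞)`-modules. -/
def pairComplex {A B C : ModuleCat.{u} (UEnv a)} (hA : IsPairModule t A) (hB : IsPairModule t B)
    (hC : IsPairModule t C) (f : A →ₗ[UEnv a] B) (g : B →ₗ[UEnv a] C)
    (hfg : Function.Exact f g) : ShortComplex (PairCat t) :=
  ShortComplex.mk (X₁ := ⟨A, hA⟩) (X₂ := ⟨B, hB⟩) (X₃ := ⟨C, hC⟩)
    (ObjectProperty.homMk (ModuleCat.ofHom f)) (ObjectProperty.homMk (ModuleCat.ofHom g)) (by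
      apply ObjectProperty.hom_ext
      apply ModuleCat.hom_ext
      exact hfg.linearMap_comp_eq_zero)

theorem pairComplex_shortExact {A B C : ModuleCat.{u} (UEnv a)} (hA : IsPairModule t A)
    (hB : IsPairModule t B) (hC : IsPairModule t C) (f : A →ₗ[UEnv a] B) (g : B →ₗ[UEnv a] C)
    (hfg : Function.Exact f g) (hf : Function.Injective f) (hg : Function.Surjective g) :
    (pairComplex hA hB hC f g hfg).ShortExact where
  exact := by
    refine (IsPairModule t).ι.reflects_exact_of_faithful _ ?_
    rw [ShortComplex.ShortExact.moduleCat_exact_iff_function_exact]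
    exact hfg
  mono_f := (IsPairModule t).ι.mono_of_mono_map ((ModuleCat.mono_iff_injective _).2 hf)
  epi_g := (IsPairModule t).ι.epi_of_epi_map ((ModuleCat.epi_iff_surjective _).2 hg)

theorem isPairModule_of_injective {A B : ModuleCat.{u} (UEnv a)} (f : A →ₗ[UEnv a] B)
    (hf : Function.Injective f) (hB : IsPairModule t B) : IsPairModule t A := by
  have : Mono (ModuleCat.ofHom f) := (ModuleCat.mono_iff_injective _).2 hf
  exact (IsPairModule t).prop_of_mono (ModuleCat.ofHom f) hB

theorem isPairModule_of_surjective {A B : ModuleCat.{u} (UEnv a)} (f : A →ₗ[UEnv a] B)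
    (hf : Function.Surjective f) (hA : IsPairModule t A) : IsPairModule t B := by
  have : Epi (ModuleCat.ofHom f) := (ModuleCat.epi_iff_surjective _).2 hf
  exact (IsPairModule t).prop_of_epi (ModuleCat.ofHom f) hA

/-- Extension groups and their dimensions only depend on the isomorphism class of the first
argument. -/
def extEquiv {X X' : PairCat t} (e : X ≅ X') (Y : PairCat t) (n : ℕ) :
    PairExt t X' Y n ≃ₗ[ℂ] PairExt t X Y n :=
  LinearEquiv.ofLinearMap (PairCat.extMap e.hom Y n) (PairCat.extMap e.inv Y n)
    (LinearMap.ext fun x => by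
      change (Ext.mk₀ e.hom).comp ((Ext.mk₀ e.inv).comp x (zero_add n)) (zero_add n) = x
      simp)
    (LinearMap.ext fun x => by
      change (Ext.mk₀ e.inv).comp ((Ext.mk₀ e.hom).comp x (zero_add n)) (zero_add n) = x
      simp)

theorem EPWellDefined.of_iso {X X' : PairCat t} (e : X ≅ X') {Y : PairCat t}
    (h : EPWellDefined t X Y) : EPWellDefined t X' Y where
  finite i := have := h.finite i; Module.Finite.equiv (extEquiv e Y i).symm
  vanish := by
    obtain ⟨n, hn⟩ := h.vanish
    refine ⟨n, fun i hi => ?_⟩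
    have := hn i hi
    exact (extEquiv e Y i).toEquiv.subsingleton

theorem ep_of_iso {X X' : PairCat t} (e : X ≅ X') (Y : PairCat t) : EP t X Y = EP t X' Y := by
  rw [EP, EP]
  exact finsum_congr fun i => by rw [(extEquiv e Y i).finrank_eq]

/-- The isomorphism in the category of `(𝔞, 𝔱)`-modules which is given by an isomorphism of
`U(𝔞)`-modules. -/
def pairIso {A B : ModuleCat.{u} (UEnv a)} (hA : IsPairModule t A) (hB : IsPairModule t B)
    (e : A ≃ₗ[UEnv a] B) : (⟨A, hA⟩ : PairCat t) ≅ ⟨B, hB⟩ :=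
  ObjectProperty.isoMk _ e.toModuleIso

end EulerPoincare

/-! ### Syzygies over polynomial rings -/

section Syzygies

/-- A form of the statement that the module `N` over the `ℂ`-algebra `A` has projective dimension at
most `q` at the ideal `𝔪`. For `q = 0` it says that vectors of `N` which are linearly independent
over `ℂ` modulo `𝔪 N` are linearly independent over `A`; for larger `q` it says that the kernels
of all surjections from free modules of finite rank have projective dimension at most `q - 1`. -/
def PdLE (A : Type) [CommRing A] [Algebra ℂ A] (𝔪 : Ideal A) :
    ℕ → ∀ (N : Type) [AddCommGroup N] [Module A N], Prop
  | 0, N, _, _ => ∀ (r : ℕ) (v : Fin r → N),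
      (∀ c : Fin r → ℂ, ∑ s, algebraMap ℂ A (c s) • v s ∈ 𝔪 • (⊤ : Submodule A N) → c = 0) →
        ∀ b : Fin r → A, ∑ s, b s • v s = 0 → b = 0
  | q + 1, N, _, _ => ∀ (r : ℕ) (f : (Fin r → A) →ₗ[A] N), Function.Surjective f →
      PdLE A 𝔪 q (LinearMap.ker f)

variable {A B : Type} [CommRing A] [Algebra ℂ A] [CommRing B] [Algebra ℂ B] {𝔪 : Ideal A}

/-- If `x` is regular on `N`, then the projective dimension of `N` is bounded by that of `N / x N`
as a module over `B / x B`. -/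
theorem PdLE.of_quotient
    (ε : B →ₐ[ℂ] A) (hε : Function.Surjective ε) {x : B} (hx : ∀ b, ε b = 0 ↔ x ∣ b)
    (hreg : ∀ b, x * b = 0 → b = 0) (hsep : ∀ b, (∀ n : ℕ, x ^ n ∣ b) → b = 0)
    (q : ℕ) : ∀ (N N' : Type) [AddCommGroup N] [Module B N]
    [AddCommGroup N'] [Module A N'] (ρ : N →+ N') (_ : ∀ (b : B) (y : N), ρ (b • y) = ε b • ρ y)
    (_ : Function.Surjective ρ) (_ : ∀ y, ρ y = 0 → ∃ z, y = x • z)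
    (_ : ∀ y : N, x • y = 0 → y = 0), PdLE A 𝔪 q N' → PdLE B (𝔪.comap ε) q N := by
  have hεx : ε x = 0 := (hx x).2 dvd_rfl
  induction q with
  | zero =>
    intro N N' _ _ _ _ ρ hρ hs hk hN h r v hv
    have h1 := h r (fun s => ρ (v s)) (fun c hc => hv c (by
      have key : ∀ y' ∈ 𝔪 • (⊤ : Submodule A N'), ∀ y, ρ y = y' →
          y ∈ 𝔪.comap ε • (⊤ : Submodule B N) := by
        have hlift : ∀ y' ∈ 𝔪 • (⊤ : Submodule A N'),
            ∃ y ∈ 𝔪.comap ε • (⊤ : Submodule B N), ρ y = y' := by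
          intro y' hy'
          refine Submodule.smul_induction_on hy' (fun a ha n _ => ?_) ?_
          · obtain ⟨b, rfl⟩ := hε a
            obtain ⟨y, rfl⟩ := hs n
            exact ⟨b • y, Submodule.smul_mem_smul ha trivial, hρ b y⟩
          · rintro _ _ ⟨y, hy, rfl⟩ ⟨z, hz, rfl⟩
            exact ⟨y + z, add_mem hy hz, map_add _ _ _⟩
        intro y' hy' y hy
        obtain ⟨z, hz, rfl⟩ := hlift y' hy'
        obtain ⟨w, hw⟩ := hk (y - z) (by rw [map_sub, hy, sub_self])
        rw [← sub_add_cancel y z, hw]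
        refine add_mem (Submodule.smul_mem_smul ?_ trivial) hz
        rw [Ideal.mem_comap, hεx]
        exact zero_mem _
      refine key _ hc _ ?_
      rw [map_sum]
      exact Finset.sum_congr rfl fun s _ => by rw [hρ, AlgHom.commutes]))
    have h2 : ∀ b : Fin r → B, ∑ s, b s • v s = 0 →
        ∃ b' : Fin r → B, (∀ s, b s = x * b' s) ∧ ∑ s, b' s • v s = 0 := by
      intro b hb
      have h3 := h1 (fun s => ε (b s)) (by
        rw [← map_zero ρ, ← hb, map_sum]
        exact Finset.sum_congr rfl fun s _ => (hρ _ _).symm)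
      choose b' hb' using fun s => (hx (b s)).1 (congrFun h3 s)
      refine ⟨b', hb', hN _ ?_⟩
      rw [← hb, Finset.smul_sum]
      exact Finset.sum_congr rfl fun s _ => by rw [hb' s, mul_smul]
    have h4 : ∀ n : ℕ, ∀ b : Fin r → B, ∑ s, b s • v s = 0 → ∀ s, x ^ n ∣ b s := by
      intro n
      induction n with
      | zero => intro b _ s; simp
      | succ n ih =>
        intro b hb s
        obtain ⟨b', hb', hb''⟩ := h2 b hb
        rw [hb' s, pow_succ']
        exact mul_dvd_mul_left x (ih b' hb'' s)
    exact fun b hb => funext fun s => hsep _ fun n => h4 n b hb s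
  | succ q ih =>
    intro N N' _ _ _ _ ρ hρ hs hk hN h r f hf
    let f' : (Fin r → A) →ₗ[A] N' := Fintype.linearCombination A fun s => ρ (f (Pi.single s 1))
    have hf' : ∀ y : Fin r → B, f' (fun s => ε (y s)) = ρ (f y) := by
      intro y
      conv_rhs => rw [pi_eq_sum_univ' y]
      rw [Fintype.linearCombination_apply, map_sum, map_sum]
      exact Finset.sum_congr rfl fun s _ => by rw [map_smul, hρ]
    have hlift : ∀ a : Fin r → A, ∃ y : Fin r → B, (fun s => ε (y s)) = a := fun a => by
      choose y hy using fun s => hε (a s)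
      exact ⟨y, funext hy⟩
    let ρK : LinearMap.ker f →+ LinearMap.ker f' :=
      { toFun := fun y => ⟨fun s => ε (y.1 s), by
          rw [LinearMap.mem_ker, hf', LinearMap.mem_ker.1 y.2, map_zero]⟩
        map_zero' := Subtype.ext (funext fun s => map_zero ε)
        map_add' := fun y z => Subtype.ext (funext fun s => map_add ε _ _) }
    refine ih _ _ ρK (fun b y => Subtype.ext (funext fun s => map_mul ε _ _)) ?_ ?_ ?_ (h r f' ?_)
    · rintro ⟨a, ha⟩
      obtain ⟨y, rfl⟩ := hlift a
      rw [LinearMap.mem_ker, hf'] at ha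
      obtain ⟨n, hn⟩ := hk _ ha
      obtain ⟨z, rfl⟩ := hf n
      refine ⟨⟨y - x • z, ?_⟩, Subtype.ext (funext fun s => ?_)⟩
      · rw [LinearMap.mem_ker, map_sub, map_smul, hn, sub_self]
      · change ε (y s - x * z s) = ε (y s)
        rw [map_sub, map_mul, hεx, zero_mul, sub_zero]
    · rintro ⟨y, hy⟩ h0
      have h1 : ∀ s, ε (y s) = 0 := fun s => congrFun (congrArg Subtype.val h0) s
      choose z hz using fun s => (hx _).1 (h1 s)
      have hyz : y = x • z := funext hz
      refine ⟨⟨z, ?_⟩, Subtype.ext hyz⟩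
      refine hN _ ?_
      rw [← map_smul, ← hyz]
      exact hy
    · rintro ⟨y, hy⟩ h0
      have h1 : x • y = 0 := congrArg Subtype.val h0
      exact Subtype.ext (funext fun s => hreg _ (congrFun h1 s))
    · intro n'
      obtain ⟨n, rfl⟩ := hs n'
      obtain ⟨y, rfl⟩ := hf n
      exact ⟨_, hf' y⟩

/-- If all modules over `A = B / x B` have projective dimension at most `q`, then all modules over `B`
have projective dimension at most `q + 1`: a kernel `K` of a map from a free module is `x`-regular, and
its dimension is bounded by that of `K / x K`. -/
theorem PdLE.succ_of_forall
    (ε : B →ₐ[ℂ] A) (hε : Function.Surjective ε) {x : B} (hx : ∀ b, ε b = 0 ↔ x ∣ b)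
    (hreg : ∀ b, x * b = 0 → b = 0) (hsep : ∀ b, (∀ n : ℕ, x ^ n ∣ b) → b = 0)
    {q : ℕ}
    (h : ∀ (N : Type) [AddCommGroup N] [Module A N], PdLE A 𝔪 q N)
    (N : Type) [AddCommGroup N] [Module B N] : PdLE B (𝔪.comap ε) (q + 1) N := by
  intro r f _
  let K := LinearMap.ker f
  let L : Submodule B K := LinearMap.range (LinearMap.lsmul B K x)
  have hL : ∀ b, ε b = 0 → ∀ y : K ⧸ L, b • y = 0 := by
    intro b hb y
    obtain ⟨y, rfl⟩ := Submodule.mkQ_surjective L y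
    obtain ⟨c, rfl⟩ := (hx b).1 hb
    rw [← map_smul, Submodule.mkQ_apply, Submodule.Quotient.mk_eq_zero]
    exact ⟨c • y, by rw [LinearMap.lsmul_apply, mul_smul]⟩
  let _ : SMul A (K ⧸ L) := ⟨fun a y => (hε a).choose • y⟩
  have hsmul : ∀ (b : B) (y : K ⧸ L), ε b • y = b • y := by
    intro b y
    change (hε (ε b)).choose • y = b • y
    rw [← sub_eq_zero, ← sub_smul]
    exact hL _ (by rw [map_sub, (hε (ε b)).choose_spec, sub_self]) y
  let _ : Module A (K ⧸ L) := Function.Surjective.moduleLeft ε.toRingHom hε hsmul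
  refine PdLE.of_quotient ε hε hx hreg hsep q K (K ⧸ L) L.mkQ.toAddMonoidHom
    (fun b y => ?_) (Submodule.mkQ_surjective L) (fun y hy => ?_) (fun y hy => ?_) (h _)
  · exact (map_smul L.mkQ b y).trans (hsmul b _).symm
  · obtain ⟨z, rfl⟩ := (Submodule.Quotient.mk_eq_zero L).1 hy
    exact ⟨z, rfl⟩
  · have h1 : x • (y : Fin r → B) = 0 := congrArg Subtype.val hy
    exact Subtype.ext (funext fun s => hreg _ (congrFun h1 s))

end Syzygies

section Polynomials

open MvPolynomial

/-- The ideal of the polynomials with constant term `0`. -/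
abbrev augIdeal (m : ℕ) : Ideal (MvPolynomial (Fin m) ℂ) :=
  RingHom.ker (constantCoeff (R := ℂ) (σ := Fin m))

/-- Hilbert's syzygy theorem: modules over a polynomial ring in `m` variables have projective
dimension at most `m`. -/
theorem pdLE_mvPolynomial (m : ℕ) : ∀ (N : Type) [AddCommGroup N]
    [Module (MvPolynomial (Fin m) ℂ) N],
    PdLE (MvPolynomial (Fin m) ℂ) (augIdeal m) m N := by
  induction m with
  | zero =>
    intro N _ _ r v hv b hb
    have h1 := hv (fun s => constantCoeff (b s)) (by
      have : ∀ s, algebraMap ℂ (MvPolynomial (Fin 0) ℂ) (constantCoeff (b s)) = b s := fun s =>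
        (eq_C_of_isEmpty (b s)).symm
      simp only [this, hb]
      exact zero_mem _)
    funext s
    rw [eq_C_of_isEmpty (b s)]
    have := congrFun h1 s
    simp only [constantCoeff_eq] at this
    rw [this]
    simp
  | succ m ih =>
    intro N _ _
    let ε : MvPolynomial (Fin (m + 1)) ℂ →ₐ[ℂ] MvPolynomial (Fin m) ℂ := aeval (Fin.cases 0 X)
    have hεX : ∀ i : Fin m, ε (X i.succ) = X i := fun i => by simp [ε]
    have hε : Function.Surjective ε := by
      intro p
      refine ⟨rename Fin.succ p, ?_⟩
      simp only [ε, aeval_rename]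
      exact (congrArg (fun f : Fin m → MvPolynomial (Fin m) ℂ => aeval f p)
        (funext fun i => rfl)).trans (aeval_X_left_apply p)
    have hε' : ∀ b, ε b = (finSuccEquiv ℂ m b).coeff 0 := by
      intro b
      have : ε.toRingHom = (Polynomial.constantCoeff (R := MvPolynomial (Fin m) ℂ)).comp
          (finSuccEquiv ℂ m).toRingEquiv.toRingHom := by
        refine ringHom_ext (fun c => by simp [ε, finSuccEquiv_eq]) (fun i => ?_)
        refine Fin.cases ?_ (fun i => ?_) i
        · simp [ε, finSuccEquiv_X_zero]
        · simp [ε, finSuccEquiv_X_succ]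
      exact DFunLike.congr_fun this b
    have hx : ∀ b, ε b = 0 ↔ X 0 ∣ b := by
      intro b
      rw [hε', ← Polynomial.X_dvd_iff, ← finSuccEquiv_X_zero (R := ℂ),
        map_dvd_iff]
    have hcomap : (augIdeal m).comap ε = augIdeal (m + 1) := by
      ext b
      rw [Ideal.mem_comap, RingHom.mem_ker, RingHom.mem_ker]
      have : (constantCoeff (R := ℂ) (σ := Fin m)).comp ε.toRingHom = constantCoeff := by
        refine ringHom_ext (fun c => by simp [ε]) (fun i => ?_)
        refine Fin.cases ?_ (fun i => ?_) i
        · simp [ε]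
        · simp [ε]
      rw [← this]
      rfl
    rw [← hcomap]
    refine PdLE.succ_of_forall ε hε hx (fun b hb => ?_) (fun b hb => ?_) ih N
    · exact (mul_eq_zero.1 hb).resolve_left (X_ne_zero 0)
    · refine (map_eq_zero_iff _ (finSuccEquiv ℂ m).injective).1 (Polynomial.ext fun n => ?_)
      have := map_dvd (finSuccEquiv ℂ m) (hb (n + 1))
      rw [map_pow, finSuccEquiv_X_zero, Polynomial.X_pow_dvd_iff] at this
      rw [this n (Nat.lt_succ_self n), Polynomial.coeff_zero]

end Polynomials

/-! ### Graded free modules over polynomial rings and leading forms -/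

section Graded

open MvPolynomial

variable {m r : ℕ}

theorem homogeneousComponent_X_mul_succ (n : ℕ) (i : Fin m) (p : MvPolynomial (Fin m) ℂ) :
    homogeneousComponent (n + 1) (X i * p) = X i * homogeneousComponent n p := by
  induction p using MvPolynomial.induction_on' with
  | monomial u c =>
    rw [X, monomial_mul, one_mul,
      homogeneousComponent_of_mem (isHomogeneous_monomial c (n := (Finsupp.single i 1 + u).degree) rfl),
      homogeneousComponent_of_mem (isHomogeneous_monomial c (n := u.degree) rfl)]
    have : (Finsupp.single i 1 + u).degree = u.degree + 1 := by
      rw [map_add, Finsupp.degree_single, add_comm]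
    rw [this]
    by_cases h : u.degree = n
    · rw [if_pos (by omega), if_pos h.symm, monomial_mul, one_mul]
    · rw [if_neg (by omega), if_neg (Ne.symm h), mul_zero]
  | add p q hp hq => rw [mul_add, map_add, hp, hq, map_add, mul_add]

theorem homogeneousComponent_X_mul_zero (i : Fin m) (p : MvPolynomial (Fin m) ℂ) :
    homogeneousComponent 0 (X i * p) = 0 := by
  rw [homogeneousComponent_zero, ← constantCoeff_eq, map_mul, constantCoeff_X, zero_mul, C_0]

/-- The component of degree `k` in the free module in which the `s`-th basis vector has
degree `d s`. -/
def homPart (d : Fin r → ℕ) (k : ℕ) :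
    (Fin r → MvPolynomial (Fin m) ℂ) →ₗ[ℂ] (Fin r → MvPolynomial (Fin m) ℂ) :=
  LinearMap.pi fun s =>
    if d s ≤ k then (homogeneousComponent (k - d s)).comp (LinearMap.proj s) else 0

variable (d : Fin r → ℕ)

theorem homPart_apply (k : ℕ) (g : Fin r → MvPolynomial (Fin m) ℂ) (s : Fin r) :
    homPart d k g s = if d s ≤ k then homogeneousComponent (k - d s) (g s) else 0 := by
  rw [homPart, LinearMap.pi_apply]
  split_ifs <;> rfl

theorem homPart_homPart (k l : ℕ) (g : Fin r → MvPolynomial (Fin m) ℂ) :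
    homPart d l (homPart d k g) = if l = k then homPart d k g else 0 := by
  funext s
  rw [homPart_apply, homPart_apply]
  by_cases hk : d s ≤ k
  · rw [if_pos hk, homogeneousComponent_of_mem (homogeneousComponent_isHomogeneous (k - d s) (g s))]
    by_cases h : l = k
    · subst h
      rw [if_pos hk, if_pos rfl, if_pos rfl, homPart_apply, if_pos hk]
    · rw [if_neg h]
      by_cases hl : d s ≤ l
      · rw [if_pos hl, if_neg (by omega)]; rfl
      · rw [if_neg hl]; rfl
  · rw [if_neg hk, map_zero, ite_self]
    by_cases h : l = k
    · rw [if_pos h, homPart_apply, if_neg hk]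
    · rw [if_neg h]; rfl

theorem homPart_homPart_self (k : ℕ) (g : Fin r → MvPolynomial (Fin m) ℂ) :
    homPart d k (homPart d k g) = homPart d k g := by
  rw [homPart_homPart, if_pos rfl]

theorem homPart_X_smul_succ (k : ℕ) (i : Fin m) (g : Fin r → MvPolynomial (Fin m) ℂ) :
    homPart d (k + 1) ((X i : MvPolynomial (Fin m) ℂ) • g) =
      (X i : MvPolynomial (Fin m) ℂ) • homPart d k g := by
  funext s
  rw [Pi.smul_apply, homPart_apply, homPart_apply, Pi.smul_apply, smul_eq_mul, smul_eq_mul]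
  by_cases hk : d s ≤ k
  · rw [if_pos hk, if_pos (by omega), Nat.succ_sub hk, homogeneousComponent_X_mul_succ]
  · rw [if_neg hk, mul_zero]
    split_ifs with h
    · rw [show k + 1 - d s = 0 by omega, homogeneousComponent_X_mul_zero]
    · rfl

theorem homPart_X_smul_zero (i : Fin m) (g : Fin r → MvPolynomial (Fin m) ℂ) :
    homPart d 0 ((X i : MvPolynomial (Fin m) ℂ) • g) = 0 := by
  funext s
  rw [homPart_apply, Pi.smul_apply, smul_eq_mul, Nat.zero_sub, homogeneousComponent_X_mul_zero,
    ite_self]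
  rfl

theorem eq_zero_of_homPart {g : Fin r → MvPolynomial (Fin m) ℂ} (h : ∀ k, homPart d k g = 0) :
    g = 0 := by
  funext s
  rw [← sum_homogeneousComponent (g s)]
  refine Finset.sum_eq_zero fun n _ => ?_
  have := congrFun (h (n + d s)) s
  rwa [homPart_apply, if_pos (by omega), Nat.add_sub_cancel] at this

/-- The vectors of degree less than `k` in the graded free module. -/
def gradedLT (m : ℕ) (d : Fin r → ℕ) (k : ℕ) : Submodule ℂ (Fin r → MvPolynomial (Fin m) ℂ) :=
  ⨅ l : ℕ, ⨅ _ : k ≤ l, LinearMap.ker (homPart d l)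

theorem mem_gradedLT {k : ℕ} {g : Fin r → MvPolynomial (Fin m) ℂ} :
    g ∈ gradedLT m d k ↔ ∀ l, k ≤ l → homPart d l g = 0 := by
  simp [gradedLT]

variable {d}

theorem gradedLT_mono {k l : ℕ} (h : k ≤ l) : gradedLT m d k ≤ gradedLT m d l := fun g hg => by
  rw [mem_gradedLT] at hg ⊢
  exact fun n hn => hg n (h.trans hn)

theorem exists_mem_gradedLT (g : Fin r → MvPolynomial (Fin m) ℂ) : ∃ k, g ∈ gradedLT m d k := by
  refine ⟨∑ s, (d s + (g s).totalDegree + 1), ?_⟩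
  rw [mem_gradedLT]
  intro l hl
  funext s
  have h := Finset.single_le_sum (f := fun s => d s + (g s).totalDegree + 1)
    (fun _ _ => Nat.zero_le _) (Finset.mem_univ s)
  have h2 : d s + (g s).totalDegree + 1 ≤ l := h.trans hl
  rw [homPart_apply, if_pos (by omega), homogeneousComponent_eq_zero _ _ (by omega)]
  rfl

theorem homPart_mem_gradedLT (k : ℕ) (g : Fin r → MvPolynomial (Fin m) ℂ) :
    homPart d k g ∈ gradedLT m d (k + 1) := by
  rw [mem_gradedLT]
  intro l hl
  rw [homPart_homPart, if_neg (by omega)]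

theorem mem_gradedLT_of_homPart {k : ℕ} {g : Fin r → MvPolynomial (Fin m) ℂ}
    (hg : g ∈ gradedLT m d (k + 1)) (h : homPart d k g = 0) : g ∈ gradedLT m d k := by
  rw [mem_gradedLT] at hg ⊢
  intro l hl
  rcases hl.eq_or_lt with rfl | hl
  · exact h
  · exact hg l hl

theorem homPart_eq_zero {k : ℕ} {g : Fin r → MvPolynomial (Fin m) ℂ}
    (hg : g ∈ gradedLT m d k) : homPart d k g = 0 := (mem_gradedLT d).1 hg k le_rfl

theorem gradedLT_zero {g : Fin r → MvPolynomial (Fin m) ℂ} (hg : g ∈ gradedLT m d 0) : g = 0 :=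
  eq_zero_of_homPart d fun k => (mem_gradedLT d).1 hg k (Nat.zero_le k)

theorem X_smul_mem_gradedLT {k : ℕ} {g : Fin r → MvPolynomial (Fin m) ℂ}
    (hg : g ∈ gradedLT m d k) (i : Fin m) :
    (X i : MvPolynomial (Fin m) ℂ) • g ∈ gradedLT m d (k + 1) := by
  rw [mem_gradedLT] at hg ⊢
  intro l hl
  obtain ⟨l, rfl⟩ : ∃ n, l = n + 1 := ⟨l - 1, by omega⟩
  rw [homPart_X_smul_succ, hg l (by omega), smul_zero]

theorem sum_homPart {k : ℕ} {g : Fin r → MvPolynomial (Fin m) ℂ} (hg : g ∈ gradedLT m d k) :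
    ∑ l ∈ Finset.range k, homPart d l g = g := by
  rw [← sub_eq_zero]
  refine eq_zero_of_homPart d fun n => ?_
  rw [map_sub, map_sum, sub_eq_zero]
  simp only [homPart_homPart]
  rw [Finset.sum_ite_eq]
  split_ifs with h
  · rfl
  · exact ((mem_gradedLT d).1 hg n (by simpa using h)).symm

theorem homPart_smul {e : ℕ} {g : Fin r → MvPolynomial (Fin m) ℂ} (hg : homPart d e g = g)
    (p : MvPolynomial (Fin m) ℂ) (k : ℕ) :
    homPart d k (p • g) = (if e ≤ k then homogeneousComponent (k - e) p else 0) • g := by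
  induction p using MvPolynomial.induction_on generalizing k with
  | C a =>
    rw [← algebraMap_eq, algebraMap_smul, map_smul, ← hg, homPart_homPart, algebraMap_eq]
    by_cases h : k = e
    · subst h
      rw [if_pos rfl, if_pos le_rfl, Nat.sub_self, homogeneousComponent_zero, coeff_C, if_pos rfl,
        ← algebraMap_eq, algebraMap_smul]
    · rw [if_neg h, smul_zero]
      by_cases hk : e ≤ k
      · rw [if_pos hk, homogeneousComponent_of_mem (isHomogeneous_C _ a), if_neg (by omega),
          zero_smul]
      · rw [if_neg hk, zero_smul]
  | add p q hp hq =>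
    rw [add_smul, map_add, hp, hq, ← add_smul]
    split_ifs
    · rw [map_add]
    · rw [add_zero]
  | mul_X p i hp =>
    rw [mul_comm, mul_smul]
    rcases k with _ | k
    · rw [homPart_X_smul_zero, Nat.zero_sub, homogeneousComponent_X_mul_zero, ite_self, zero_smul]
    · rw [homPart_X_smul_succ, hp, ← mul_smul]
      congr 1
      by_cases h : e ≤ k
      · rw [if_pos h, if_pos (by omega), Nat.succ_sub h, homogeneousComponent_X_mul_succ]
      · rw [if_neg h, mul_zero]
        split_ifs with h1
        · rw [show k + 1 - e = 0 by omega, homogeneousComponent_X_mul_zero]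
        · rfl

/-- A map of free modules which sends the basis vectors to homogeneous vectors is graded. -/
theorem homPart_linearCombination {r' : ℕ} (d' : Fin r' → ℕ)
    (g : Fin r' → Fin r → MvPolynomial (Fin m) ℂ) (hg : ∀ s, homPart d (d' s) (g s) = g s)
    (p : Fin r' → MvPolynomial (Fin m) ℂ) (k : ℕ) :
    homPart d k (∑ s, p s • g s) = ∑ s, homPart d' k p s • g s := by
  rw [map_sum]
  exact Finset.sum_congr rfl fun s _ => by rw [homPart_smul (hg s), homPart_apply]

end Graded

section LeadingForms

open MvPolynomial

variable {m r : ℕ} {F : Type*} [AddCommGroup F] [Module ℂ F]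

/-- The `S`-module of leading forms of the subspace `K` of a filtered vector space `F` whose
associated graded space is a graded free module over the polynomial ring `S`. The subspace has to
be stable under multiplication by the variables up to terms of lower degree. -/
def leadMod (c : F ≃ₗ[ℂ] (Fin r → MvPolynomial (Fin m) ℂ)) (d : Fin r → ℕ) (K : Submodule ℂ F)
    (hK : ∀ i k, ∀ x ∈ K, c x ∈ gradedLT m d k →
      ∃ y ∈ K, c y - (X i : MvPolynomial (Fin m) ℂ) • c x ∈ gradedLT m d k) :
    Submodule (MvPolynomial (Fin m) ℂ) (Fin r → MvPolynomial (Fin m) ℂ) where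
  carrier := {g | ∀ k, ∃ x ∈ K, c x ∈ gradedLT m d (k + 1) ∧ homPart d k (c x) = homPart d k g}
  zero_mem' := fun k => ⟨0, zero_mem _, by rw [map_zero]; exact zero_mem _, by rw [map_zero]⟩
  add_mem' := by
    intro g g' hg hg' k
    obtain ⟨x, hx, h1, h2⟩ := hg k
    obtain ⟨x', hx', h1', h2'⟩ := hg' k
    exact ⟨x + x', add_mem hx hx', by rw [map_add]; exact add_mem h1 h1',
      by rw [map_add, map_add, map_add, h2, h2']⟩
  smul_mem' := by
    intro p
    induction p using MvPolynomial.induction_on with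
    | C a =>
      intro g hg k
      obtain ⟨x, hx, h1, h2⟩ := hg k
      refine ⟨a • x, K.smul_mem a hx, by rw [map_smul]; exact Submodule.smul_mem _ _ h1, ?_⟩
      rw [← algebraMap_eq, algebraMap_smul, map_smul, map_smul, map_smul, h2]
    | add p q hp hq =>
      intro g hg k
      obtain ⟨x, hx, h1, h2⟩ := hp hg k
      obtain ⟨x', hx', h1', h2'⟩ := hq hg k
      exact ⟨x + x', add_mem hx hx', by rw [map_add]; exact add_mem h1 h1',
        by rw [map_add, map_add, add_smul, map_add, h2, h2']⟩
    | mul_X p i hp =>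
      intro g hg k
      rw [mul_comm, mul_smul]
      rcases k with _ | k
      · exact ⟨0, zero_mem _, by rw [map_zero]; exact zero_mem _,
          by rw [homPart_X_smul_zero, map_zero, map_zero]⟩
      · obtain ⟨x, hx, h1, h2⟩ := hp hg k
        obtain ⟨y, hy, h3⟩ := hK i (k + 1) x hx h1
        refine ⟨y, hy, ?_, ?_⟩
        · rw [← sub_add_cancel (c y) ((X i : MvPolynomial (Fin m) ℂ) • c x)]
          exact add_mem (gradedLT_mono (Nat.le_succ _) h3) (X_smul_mem_gradedLT h1 i)
        · have h4 := homPart_eq_zero h3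
          rw [map_sub, sub_eq_zero] at h4
          rw [h4, homPart_X_smul_succ, h2, homPart_X_smul_succ]

variable {c : F ≃ₗ[ℂ] (Fin r → MvPolynomial (Fin m) ℂ)} {d : Fin r → ℕ} {K : Submodule ℂ F}
  {hK : ∀ i k, ∀ x ∈ K, c x ∈ gradedLT m d k →
      ∃ y ∈ K, c y - (X i : MvPolynomial (Fin m) ℂ) • c x ∈ gradedLT m d k}

theorem mem_leadMod {g : Fin r → MvPolynomial (Fin m) ℂ} : g ∈ leadMod c d K hK ↔
    ∀ k, ∃ x ∈ K, c x ∈ gradedLT m d (k + 1) ∧ homPart d k (c x) = homPart d k g := Iff.rfl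

theorem homPart_mem_leadMod {x : F} (hx : x ∈ K) {k : ℕ} (h : c x ∈ gradedLT m d (k + 1)) :
    homPart d k (c x) ∈ leadMod c d K hK := by
  intro l
  by_cases hl : l = k
  · subst hl
    exact ⟨x, hx, h, (homPart_homPart_self d l _).symm⟩
  · exact ⟨0, zero_mem _, by rw [map_zero]; exact zero_mem _,
      by rw [homPart_homPart, if_neg hl, map_zero, map_zero]⟩

theorem homPart_mem_leadMod_of_mem {g : Fin r → MvPolynomial (Fin m) ℂ}
    (hg : g ∈ leadMod c d K hK) (k : ℕ) : homPart d k g ∈ leadMod c d K hK := by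
  obtain ⟨x, hx, h1, h2⟩ := hg k
  rw [← h2]
  exact homPart_mem_leadMod hx h1

/-- Nakayama's lemma for submodules of a graded free module and homogeneous vectors. -/
theorem mem_range_of_span_mod (N : Submodule (MvPolynomial (Fin m) ℂ) (Fin r → MvPolynomial (Fin m) ℂ))
    {r' : ℕ} (d' : Fin r' → ℕ) (g : Fin r' → N)
    (hg : ∀ s, homPart d (d' s) (g s : Fin r → MvPolynomial (Fin m) ℂ) = g s)
    (hspan : ∀ n : N, ∃ b : Fin r' → ℂ,
      n - ∑ s, algebraMap ℂ (MvPolynomial (Fin m) ℂ) (b s) • g s ∈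
        augIdeal m • (⊤ : Submodule (MvPolynomial (Fin m) ℂ) N)) (n : N) :
    ∃ p : Fin r' → MvPolynomial (Fin m) ℂ, ∑ s, p s • g s = n := by
  let R : Submodule (MvPolynomial (Fin m) ℂ) (Fin r → MvPolynomial (Fin m) ℂ) :=
    LinearMap.range (Fintype.linearCombination (MvPolynomial (Fin m) ℂ)
      fun s => (g s : Fin r → MvPolynomial (Fin m) ℂ))
  have hgR : ∀ s, (g s : Fin r → MvPolynomial (Fin m) ℂ) ∈ R := fun s =>
    ⟨Pi.single s 1, by rw [Fintype.linearCombination_apply_single, one_smul]⟩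
  have hC : ∀ (b : ℂ) (f : Fin r → MvPolynomial (Fin m) ℂ), f ∈ R → b • f ∈ R := fun b f hf => by
    rw [← algebraMap_smul (MvPolynomial (Fin m) ℂ) b f]; exact R.smul_mem _ hf
  have main : ∀ k, ∀ n ∈ N, homPart d k n ∈ R := by
    intro k
    induction k using Nat.strong_induction_on with
    | _ k ih =>
      have h1 : ∀ a ∈ augIdeal m, ∀ n ∈ N, homPart d k (a • n) ∈ R := by
        have : augIdeal m = Ideal.span (Set.range (X : Fin m → MvPolynomial (Fin m) ℂ)) := by
          refine Ideal.ext fun p => ?_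
          have := mem_pow_idealOfVars_iff' (σ := Fin m) (R := ℂ) 1 p
          rw [pow_one] at this
          refine Iff.trans ?_ this.symm
          rw [RingHom.mem_ker, constantCoeff_eq]
          refine ⟨fun h x hx => ?_, fun h => h 0 (by simp)⟩
          rw [(Finsupp.degree_eq_zero_iff x).1 (Nat.lt_one_iff.1 hx)]
          exact h
        rw [this]
        intro a ha
        induction ha using Submodule.span_induction with
        | mem a ha =>
          obtain ⟨i, rfl⟩ := ha
          intro n hn
          rcases k with _ | k
          · rw [homPart_X_smul_zero]; exact zero_mem _
          · rw [homPart_X_smul_succ]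
            exact R.smul_mem _ (ih k (Nat.lt_succ_self k) n hn)
        | zero => intro n _; rw [zero_smul, map_zero]; exact zero_mem _
        | add a b _ _ ha hb =>
          intro n hn
          rw [add_smul, map_add]
          exact add_mem (ha n hn) (hb n hn)
        | smul p a _ ha =>
          intro n hn
          rw [smul_eq_mul, mul_comm, mul_smul]
          exact ha _ (N.smul_mem p hn)
      have h2 : ∀ y ∈ augIdeal m • (⊤ : Submodule (MvPolynomial (Fin m) ℂ) N),
          homPart d k (y : Fin r → MvPolynomial (Fin m) ℂ) ∈ R := by
        intro y hy
        refine Submodule.smul_induction_on hy (fun a ha n _ => h1 a ha n n.2) fun y z hy hz => ?_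
        rw [Submodule.coe_add, map_add]
        exact add_mem hy hz
      intro n hn
      obtain ⟨b, hb⟩ := hspan ⟨n, hn⟩
      have h3 := h2 _ hb
      rw [Submodule.coe_sub, map_sub] at h3
      refine (R.sub_mem_iff_left ?_).1 h3
      rw [Submodule.coe_sum, map_sum]
      refine Submodule.sum_mem _ fun s _ => ?_
      rw [Submodule.coe_smul, algebraMap_smul, map_smul]
      refine hC _ _ ?_
      rw [← hg s, homPart_homPart]
      split_ifs
      · rw [hg s]; exact hgR s
      · exact zero_mem _
  obtain ⟨k, hk⟩ := exists_mem_gradedLT (d := d) (n : Fin r → MvPolynomial (Fin m) ℂ)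
  have h4 : (n : Fin r → MvPolynomial (Fin m) ℂ) ∈ R := by
    rw [← sum_homPart hk]
    exact Submodule.sum_mem _ fun l _ => main l n n.2
  obtain ⟨p, hp⟩ := h4
  refine ⟨p, Subtype.ext ?_⟩
  rw [← hp, Fintype.linearCombination_apply, Submodule.coe_sum]
  rfl

/-- A spanning set of a finitely generated module contains a family which is a basis modulo the
augmentation ideal. -/
theorem exists_basis_mod (N : Type) [AddCommGroup N] [Module (MvPolynomial (Fin m) ℂ) N]
    [Module.Finite (MvPolynomial (Fin m) ℂ) N] (G : Set N)
    (hG : ∀ n : N, ∃ (k : ℕ) (v : Fin k → N), (∀ s, v s ∈ G) ∧ ∑ s, v s = n) :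
    ∃ (k : ℕ) (v : Fin k → N), (∀ s, v s ∈ G) ∧
      (∀ b : Fin k → ℂ, ∑ s, algebraMap ℂ (MvPolynomial (Fin m) ℂ) (b s) • v s ∈
        augIdeal m • (⊤ : Submodule (MvPolynomial (Fin m) ℂ) N) → b = 0) ∧
      ∀ n : N, ∃ b : Fin k → ℂ,
        n - ∑ s, algebraMap ℂ (MvPolynomial (Fin m) ℂ) (b s) • v s ∈
          augIdeal m • (⊤ : Submodule (MvPolynomial (Fin m) ℂ) N) := by
  let _ : Module ℂ N := Module.compHom N (algebraMap ℂ (MvPolynomial (Fin m) ℂ))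
  have : IsScalarTower ℂ (MvPolynomial (Fin m) ℂ) N := ⟨fun a p n => by
    rw [Algebra.smul_def, mul_smul]; rfl⟩
  let L := augIdeal m • (⊤ : Submodule (MvPolynomial (Fin m) ℂ) N)
  let π : N →ₗ[ℂ] N ⧸ L := L.mkQ.restrictScalars ℂ
  have hfin : Module.Finite ℂ (N ⧸ L) := by
    obtain ⟨S, hS⟩ := Module.Finite.fg_top (R := MvPolynomial (Fin m) ℂ) (M := N)
    have h1 : ∀ n : N, π n ∈ Submodule.span ℂ (π '' S) := by
      intro n
      have hn : n ∈ Submodule.span (MvPolynomial (Fin m) ℂ) (S : Set N) := by rw [hS]; trivial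
      induction hn using Submodule.span_induction with
      | mem n hn => exact Submodule.subset_span ⟨n, hn, rfl⟩
      | zero => rw [map_zero]; exact zero_mem _
      | add n n' _ _ hn hn' => rw [map_add]; exact add_mem hn hn'
      | smul p n _ hn =>
        have h2 : π (p • n) = constantCoeff p • π n := by
          rw [← map_smul, ← sub_eq_zero, ← map_sub]
          refine (Submodule.Quotient.mk_eq_zero L).2 ?_
          rw [← algebraMap_smul (MvPolynomial (Fin m) ℂ) (constantCoeff p) n, ← sub_smul]
          refine Submodule.smul_mem_smul ?_ trivial
          rw [RingHom.mem_ker, map_sub, algebraMap_eq, constantCoeff_C, sub_self]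
        rw [h2]
        exact Submodule.smul_mem _ _ hn
    refine ⟨⟨(S.finite_toSet.image π).toFinset, ?_⟩⟩
    rw [Set.Finite.coe_toFinset, eq_top_iff]
    intro y _
    obtain ⟨n, rfl⟩ := L.mkQ_surjective y
    exact h1 n
  have hspan : Submodule.span ℂ (π '' G) = ⊤ := by
    rw [eq_top_iff]
    intro y _
    obtain ⟨n, rfl⟩ := L.mkQ_surjective y
    obtain ⟨k, v, hv, rfl⟩ := hG n
    rw [map_sum]
    exact Submodule.sum_mem _ fun s _ => Submodule.subset_span ⟨v s, hv s, rfl⟩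
  obtain ⟨f, hf, hf2, hf3⟩ := Submodule.exists_fun_fin_finrank_span_eq ℂ (π '' G)
  choose v hv hvf using hf
  have key : ∀ b : Fin _ → ℂ, π (∑ s, algebraMap ℂ (MvPolynomial (Fin m) ℂ) (b s) • v s) =
      ∑ s, b s • f s := by
    intro b
    rw [map_sum]
    exact Finset.sum_congr rfl fun s _ => by rw [algebraMap_smul, map_smul, hvf]
  refine ⟨_, v, hv, fun b hb => ?_, fun n => ?_⟩
  · refine funext (Fintype.linearIndependent_iff.1 hf3 b ?_)
    rw [← key]
    exact (Submodule.Quotient.mk_eq_zero L).2 hb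
  · have h1 : π n ∈ Submodule.span ℂ (Set.range f) := by rw [hf2, hspan]; trivial
    obtain ⟨b, hb⟩ := (Submodule.mem_span_range_iff_exists_fun ℂ).1 h1
    refine ⟨b, (Submodule.Quotient.mk_eq_zero L).1 ?_⟩
    change π _ = 0
    rw [map_sub, key, hb, sub_self]

/-- The module of leading forms has homogeneous generators which are leading forms of vectors
with the property `W` and form a basis modulo the augmentation ideal. -/
theorem exists_leading_family (W : F → Prop)
    (hW : ∀ k, ∀ x ∈ K, c x ∈ gradedLT m d k → ∃ (n : ℕ) (w : Fin n → F),
      (∀ s, W (w s) ∧ w s ∈ K ∧ c (w s) ∈ gradedLT m d k) ∧ ∑ s, w s = x) :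
    ∃ (r' : ℕ) (d' : Fin r' → ℕ) (w : Fin r' → F) (g : Fin r' → leadMod c d K hK),
      (∀ s, W (w s) ∧ w s ∈ K ∧ c (w s) ∈ gradedLT m d (d' s + 1) ∧
        (g s : Fin r → MvPolynomial (Fin m) ℂ) = homPart d (d' s) (c (w s))) ∧
      (∀ b : Fin r' → ℂ, ∑ s, algebraMap ℂ (MvPolynomial (Fin m) ℂ) (b s) • g s ∈
        augIdeal m • (⊤ : Submodule (MvPolynomial (Fin m) ℂ) (leadMod c d K hK)) → b = 0) ∧
      Function.Surjective (Fintype.linearCombination (MvPolynomial (Fin m) ℂ) g) := by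
  let G : Set (leadMod c d K hK) := {n | ∃ (k : ℕ) (w : F), W w ∧ w ∈ K ∧
    c w ∈ gradedLT m d (k + 1) ∧ (n : Fin r → MvPolynomial (Fin m) ℂ) = homPart d k (c w)}
  have hG : ∀ n : leadMod c d K hK, ∃ (k : ℕ) (v : Fin k → leadMod c d K hK),
      (∀ s, v s ∈ G) ∧ ∑ s, v s = n := by
    have hadd : ∀ n n' : leadMod c d K hK,
        (∃ (k : ℕ) (v : Fin k → leadMod c d K hK), (∀ s, v s ∈ G) ∧ ∑ s, v s = n) →
        (∃ (k : ℕ) (v : Fin k → leadMod c d K hK), (∀ s, v s ∈ G) ∧ ∑ s, v s = n') →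
        (∃ (k : ℕ) (v : Fin k → leadMod c d K hK), (∀ s, v s ∈ G) ∧ ∑ s, v s = n + n') := by
      rintro _ _ ⟨k, v, hv, rfl⟩ ⟨k', v', hv', rfl⟩
      refine ⟨k + k', Fin.append v v', fun s => ?_, ?_⟩
      · refine Fin.addCases (fun s => ?_) (fun s => ?_) s
        · rw [Fin.append_left]; exact hv s
        · rw [Fin.append_right]; exact hv' s
      · rw [Fin.sum_univ_add]
        simp only [Fin.append_left, Fin.append_right]
    have h1 : ∀ k, ∀ n : leadMod c d K hK,
        ∃ (k' : ℕ) (v : Fin k' → leadMod c d K hK), (∀ s, v s ∈ G) ∧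
          ∑ s, v s = ⟨homPart d k n, homPart_mem_leadMod_of_mem n.2 k⟩ := by
      intro k n
      obtain ⟨x, hx, h1, h2⟩ := n.2 k
      obtain ⟨j, w, hw, rfl⟩ := hW (k + 1) x hx h1
      refine ⟨j, fun s => ⟨homPart d k (c (w s)), homPart_mem_leadMod (hw s).2.1 (hw s).2.2⟩,
        fun s => ⟨k, w s, (hw s).1, (hw s).2.1, (hw s).2.2, rfl⟩, Subtype.ext ?_⟩
      change _ = homPart d k _
      rw [← h2, Submodule.coe_sum, map_sum, map_sum]
    intro n
    obtain ⟨k, hk⟩ := exists_mem_gradedLT (d := d) (n : Fin r → MvPolynomial (Fin m) ℂ)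
    have h2 : n = ∑ l ∈ Finset.range k, ⟨homPart d l n, homPart_mem_leadMod_of_mem n.2 l⟩ := by
      refine Subtype.ext ?_
      rw [Submodule.coe_sum]
      exact (sum_homPart hk).symm
    rw [h2]
    exact Finset.sum_induction _ _ hadd ⟨0, Fin.elim0, fun s => s.elim0, by simp⟩
      fun l _ => h1 l n
  obtain ⟨r', g, hg, hind, hspan⟩ := exists_basis_mod (m := m) (leadMod c d K hK) G hG
  choose d' w hw using hg
  refine ⟨r', d', w, g, hw, hind, fun n => ?_⟩
  exact mem_range_of_span_mod (leadMod c d K hK) d' g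
    (fun s => by rw [(hw s).2.2.2, homPart_homPart_self]) hspan n

variable {r' : ℕ} {F' : Type*} [AddCommGroup F'] [Module ℂ F']
  {c' : F' ≃ₗ[ℂ] (Fin r' → MvPolynomial (Fin m) ℂ)} {d' : Fin r' → ℕ}

/-- A filtered map whose leading part is onto the leading forms of `K` is strictly onto `K`. -/
theorem exists_preimage_of_leading (Ψ : F' →ₗ[ℂ] F) (hΨ : ∀ x, Ψ x ∈ K)
    (g : Fin r' → leadMod c d K hK)
    (hg : ∀ s, homPart d (d' s) (g s : Fin r → MvPolynomial (Fin m) ℂ) = g s)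
    (hlead : ∀ k x, c' x ∈ gradedLT m d' (k + 1) →
      c (Ψ x) - ∑ s, c' x s • (g s : Fin r → MvPolynomial (Fin m) ℂ) ∈ gradedLT m d k)
    (hsurj : Function.Surjective (Fintype.linearCombination (MvPolynomial (Fin m) ℂ) g)) (k : ℕ) :
    ∀ y ∈ K, c y ∈ gradedLT m d k → ∃ x, c' x ∈ gradedLT m d' k ∧ Ψ x = y := by
  induction k with
  | zero =>
    intro y _ hy
    exact ⟨0, by rw [map_zero]; exact zero_mem _,
      by rw [map_zero, (map_eq_zero_iff c c.injective).1 (gradedLT_zero hy)]⟩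
  | succ k ih =>
    intro y hy hyk
    obtain ⟨p, hp⟩ := hsurj ⟨homPart d k (c y), homPart_mem_leadMod hy hyk⟩
    have hp' := congrArg Subtype.val hp
    rw [Fintype.linearCombination_apply, Submodule.coe_sum] at hp'
    have h1 : c' (c'.symm (homPart d' k p)) ∈ gradedLT m d' (k + 1) := by
      rw [LinearEquiv.apply_symm_apply]
      exact homPart_mem_gradedLT k p
    have h2 := hlead k _ h1
    rw [LinearEquiv.apply_symm_apply, ← homPart_linearCombination d' _ hg] at h2
    have h3 : homPart d k (∑ s, p s • (g s : Fin r → MvPolynomial (Fin m) ℂ)) = homPart d k (c y) :=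
      (congrArg (homPart d k) hp').trans (homPart_homPart_self d k _)
    rw [h3] at h2
    have h4 : c (y - Ψ (c'.symm (homPart d' k p))) ∈ gradedLT m d k := by
      refine mem_gradedLT_of_homPart ?_ ?_
      · rw [map_sub]
        refine sub_mem hyk ?_
        rw [← sub_add_cancel (c (Ψ _)) (homPart d k (c y))]
        exact add_mem (gradedLT_mono (Nat.le_succ k) h2) (homPart_mem_gradedLT k _)
      · have h5 := homPart_eq_zero h2
        rw [map_sub, homPart_homPart_self, sub_eq_zero] at h5
        rw [map_sub, map_sub, h5, sub_self]
    obtain ⟨x, hx, hxy⟩ := ih _ (sub_mem hy (hΨ _)) h4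
    refine ⟨x + c'.symm (homPart d' k p), ?_, ?_⟩
    · rw [map_add]
      exact add_mem (gradedLT_mono (Nat.le_succ k) hx) h1
    · rw [map_add, hxy, sub_add_cancel]

/-- The leading forms of the kernel of a filtered map whose leading part is onto the leading forms
of `K` are the kernel of the leading part. -/
theorem leadMod_ker (Ψ : F' →ₗ[ℂ] F) (hΨ : ∀ x, Ψ x ∈ K)
    (g : Fin r' → leadMod c d K hK)
    (hg : ∀ s, homPart d (d' s) (g s : Fin r → MvPolynomial (Fin m) ℂ) = g s)
    (hlead : ∀ k x, c' x ∈ gradedLT m d' (k + 1) →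
      c (Ψ x) - ∑ s, c' x s • (g s : Fin r → MvPolynomial (Fin m) ℂ) ∈ gradedLT m d k)
    (hsurj : Function.Surjective (Fintype.linearCombination (MvPolynomial (Fin m) ℂ) g))
    (hK' : ∀ i k, ∀ x ∈ LinearMap.ker Ψ, c' x ∈ gradedLT m d' k →
      ∃ y ∈ LinearMap.ker Ψ, c' y - (X i : MvPolynomial (Fin m) ℂ) • c' x ∈ gradedLT m d' k) :
    leadMod c' d' (LinearMap.ker Ψ) hK' =
      LinearMap.ker (Fintype.linearCombination (MvPolynomial (Fin m) ℂ) g) := by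
  have hker : ∀ p, p ∈ LinearMap.ker (Fintype.linearCombination (MvPolynomial (Fin m) ℂ) g) ↔
      ∑ s, p s • (g s : Fin r → MvPolynomial (Fin m) ℂ) = 0 := by
    intro p
    rw [LinearMap.mem_ker, Fintype.linearCombination_apply, ← Submodule.coe_eq_zero,
      Submodule.coe_sum]
    rfl
  ext p
  rw [hker]
  constructor
  · intro hp
    refine eq_zero_of_homPart d fun k => ?_
    obtain ⟨x, hx, h1, h2⟩ := hp k
    rw [homPart_linearCombination d' _ hg, ← h2, ← homPart_linearCombination d' _ hg]
    have h3 := homPart_eq_zero (hlead k x h1)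
    rw [LinearMap.mem_ker.1 hx, map_zero, zero_sub, map_neg, neg_eq_zero] at h3
    exact h3
  · intro hp k
    have h1 : c' (c'.symm (homPart d' k p)) ∈ gradedLT m d' (k + 1) := by
      rw [LinearEquiv.apply_symm_apply]
      exact homPart_mem_gradedLT k p
    have h2 := hlead k _ h1
    rw [LinearEquiv.apply_symm_apply, ← homPart_linearCombination d' _ hg, hp, map_zero,
      sub_zero] at h2
    obtain ⟨x, hx, hxy⟩ := exists_preimage_of_leading Ψ hΨ g hg hlead hsurj k _ (hΨ _) h2
    refine ⟨c'.symm (homPart d' k p) - x, ?_, ?_, ?_⟩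
    · rw [LinearMap.mem_ker, map_sub, hxy, sub_self]
    · rw [map_sub]
      exact sub_mem h1 (gradedLT_mono (Nat.le_succ k) hx)
    · rw [map_sub, map_sub, homPart_eq_zero hx, sub_zero, LinearEquiv.apply_symm_apply,
        homPart_homPart_self]

end LeadingForms

/-! ### Generation of finitely generated weight modules by free ones -/

section Generation

set_option linter.unusedSectionVars false

attribute [local instance 100] LieRing.ofAssociativeRing

/-- The one-dimensional module of a Lie algebra given by a character `χ`. -/
def CharMod {b : Type u} [LieRing b] [LieAlgebra ℂ b] (χ : Module.Dual ℂ b)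
    (_ : ∀ x y : b, χ ⁅x, y⁆ = 0) : Type u := ULift.{u} ℂ

namespace CharMod

variable {b : Type u} [LieRing b] [LieAlgebra ℂ b] {χ : Module.Dual ℂ b}
  {hχ : ∀ x y : b, χ ⁅x, y⁆ = 0}

instance : AddCommGroup (CharMod χ hχ) := inferInstanceAs (AddCommGroup (ULift.{u} ℂ))

instance : Module ℂ (CharMod χ hχ) := inferInstanceAs (Module ℂ (ULift.{u} ℂ))

instance : LieRingModule b (CharMod χ hχ) where
  bracket x w := χ x • w
  add_lie x y w := by
    rw [map_add, add_smul]
  lie_add x w w' := smul_add (χ x) w w'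
  leibniz_lie x y w := by
    change χ x • χ y • w = χ ⁅x, y⁆ • w + χ y • χ x • w
    rw [hχ, zero_smul, zero_add, smul_comm]

theorem lie_def (x : b) (w : CharMod χ hχ) : ⁅x, w⁆ = χ x • w := rfl

instance : LieModule ℂ b (CharMod χ hχ) where
  smul_lie c x w := by rw [lie_def, lie_def, map_smul, smul_assoc]
  lie_smul c x w := smul_comm _ _ _

/-- The coordinate on the one-dimensional module. -/
def down : CharMod χ hχ ≃ₗ[ℂ] ℂ := ULift.moduleEquiv

variable (χ hχ) in
/-- The basis vector of the one-dimensional module. -/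
def gen : CharMod χ hχ := down.symm 1

theorem down_smul_gen (w : CharMod χ hχ) : down w • gen χ hχ = w := by
  refine down.injective ?_
  rw [map_smul, gen, LinearEquiv.apply_symm_apply, smul_eq_mul, mul_one]

end CharMod

variable {a : Type u} [LieRing a] [LieAlgebra ℂ a] {b : LieSubalgebra ℂ a}

namespace PBW

variable {I : Type*} [Fintype I] [LinearOrder I] {E : ((I → ℂ) × b) ≃ₗ[ℂ] a}
  {hE : ∀ y : b, E (0, y) = y} {χ : Module.Dual ℂ b} {hχ : ∀ x y : b, χ ⁅x, y⁆ = 0}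
  {Z : Type*} [AddCommGroup Z] [Module ℂ Z] [Module (UEnv a) Z] [IsScalarTower ℂ (UEnv a) Z]

/-- The homomorphism from the module induced from a character which sends the generator to `w`. -/
def charDesc (w : Z) (hw : ∀ y : b, UniversalEnvelopingAlgebra.ι ℂ (y : a) • w = χ y • w) :
    PBWModule E hE (CharMod χ hχ) →ₗ[UEnv a] Z :=
  desc (LinearMap.toSpanSingleton ℂ Z w ∘ₗ CharMod.down.toLinearMap) (fun y z => by
    simp only [LinearMap.comp_apply, LinearEquiv.coe_coe, LinearMap.toSpanSingleton_apply,
      CharMod.lie_def, map_smul]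
    refine Eq.trans ?_ (smul_algebra_smul_comm _ _ _).symm
    rw [hw]
    exact smul_comm _ _ _)

variable (w : Z) (hw : ∀ y : b, UniversalEnvelopingAlgebra.ι ℂ (y : a) • w = χ y • w)

theorem charDesc_single (T : Multiset I) (z : CharMod χ hχ) :
    charDesc (hE := hE) w hw (Finsupp.single T z) = mon (vec E) T • CharMod.down z • w :=
  desc_single _ _ T z

theorem charDesc_gen : charDesc (hE := hE) w hw (incl E hE _ (CharMod.gen χ hχ)) = w := by
  rw [charDesc, desc_incl]
  simp [CharMod.gen]

variable (E hE χ hχ) in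
theorem gen_smul (y : b) : UniversalEnvelopingAlgebra.ι ℂ (y : a) • incl E hE _ (CharMod.gen χ hχ) =
    χ y • incl E hE _ (CharMod.gen χ hχ) := by
  rw [← incl_lie, CharMod.lie_def, map_smul]

theorem span_gen : Submodule.span (UEnv a) {incl E hE _ (CharMod.gen χ hχ)} = ⊤ := by
  rw [eq_top_iff, ← span_range_incl, Submodule.span_le]
  rintro _ ⟨w, rfl⟩
  rw [← CharMod.down_smul_gen w, map_smul]
  rw [← algebraMap_smul (UEnv a)]
  exact Submodule.smul_mem _ _ (Submodule.mem_span_singleton_self _)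

theorem charHom_ext {f f' : PBWModule E hE (CharMod χ hχ) →ₗ[UEnv a] Z}
    (h : f (incl E hE _ (CharMod.gen χ hχ)) = f' (incl E hE _ (CharMod.gen χ hχ))) : f = f' := by
  refine LinearMap.ext_on span_gen ?_
  rintro _ rfl
  exact h

end PBW

theorem IsDiag.pi {T J : Type*} [AddCommGroup T] [Module ℂ T] [Finite J] {Y : J → Type*}
    [∀ j, AddCommGroup (Y j)] [∀ j, Module ℂ (Y j)] {ρ : ∀ j, T → Module.End ℂ (Y j)}
    (h : ∀ j, IsDiag (ρ j)) {σ : T → Module.End ℂ (∀ j, Y j)} (hσ : ∀ x y j, σ x y j = ρ j x (y j)) :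
    IsDiag σ := by
  classical
  have := Fintype.ofFinite J
  refine isDiag_of_mem fun y => ?_
  rw [← LinearMap.sum_single_apply Y y]
  refine Submodule.sum_mem _ fun j _ => ?_
  refine (h j).induction (p := fun z => LinearMap.single ℂ Y j z ∈ ⨆ χ, wt σ χ)
    (fun χ z hz => ?_) (fun z z' hz hz' => by rw [map_add]; exact add_mem hz hz') (y j)
  refine Submodule.mem_iSup_of_mem χ fun x => ?_
  funext i
  rw [hσ]
  by_cases hi : i = j
  · subst hi
    simp [hz x]
  · simp [Pi.single_eq_of_ne hi]

variable {t : LieSubalgebra ℂ a} {m : ℕ} (E : ((Fin m → ℂ) × t) ≃ₗ[ℂ] a)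
  (hE : ∀ y : t, E (0, y) = y) (ht : IsToral t)

theorem IsToral.char (ht : IsToral t) (χ : Module.Dual ℂ t) (x y : t) : χ ⁅x, y⁆ = 0 := by
  rw [ht.lie_eq_zero, map_zero]

/-- The direct sum of the universal modules generated by weight vectors of weights `χ s`. -/
abbrev FreeWt {r : ℕ} (χ : Fin r → Module.Dual ℂ t) : Type u :=
  ∀ s, PBWModule E hE (CharMod (χ s) (ht.char (χ s)))

variable {E hE ht}

theorem isDiag_freeWt {r : ℕ} (χ : Fin r → Module.Dual ℂ t) :
    IsDiag (actU t (FreeWt E hE ht χ)) := by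
  refine IsDiag.pi (ρ := fun s => actU t (PBWModule E hE (CharMod (χ s) (ht.char (χ s)))))
    (fun s => ?_) fun _ _ _ => rfl
  refine ht.isDiag_of_span ?_ PBW.span_gen
  rintro _ rfl
  exact ⟨χ s, PBW.gen_smul E hE (χ s) _⟩

/-- The homomorphism which sends the generators to given weight vectors. -/
def freeDesc {r : ℕ} {χ : Fin r → Module.Dual ℂ t} {Z : Type*} [AddCommGroup Z] [Module ℂ Z]
    [Module (UEnv a) Z] [IsScalarTower ℂ (UEnv a) Z] (w : Fin r → Z)
    (hw : ∀ s, w s ∈ wt (actU t Z) (χ s)) : FreeWt E hE ht χ →ₗ[UEnv a] Z :=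
  ∑ s, PBW.charDesc (w s) (hw s) ∘ₗ LinearMap.proj s

theorem freeDesc_apply {r : ℕ} {χ : Fin r → Module.Dual ℂ t} {Z : Type*} [AddCommGroup Z]
    [Module ℂ Z] [Module (UEnv a) Z] [IsScalarTower ℂ (UEnv a) Z] (w : Fin r → Z)
    (hw : ∀ s, w s ∈ wt (actU t Z) (χ s)) (x : FreeWt E hE ht χ) :
    freeDesc w hw x = ∑ s, PBW.charDesc (w s) (hw s) (x s) := by
  simp [freeDesc]

theorem mem_range_freeDesc {r : ℕ} {χ : Fin r → Module.Dual ℂ t} {Z : Type*} [AddCommGroup Z]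
    [Module ℂ Z] [Module (UEnv a) Z] [IsScalarTower ℂ (UEnv a) Z] (w : Fin r → Z)
    (hw : ∀ s, w s ∈ wt (actU t Z) (χ s)) (s : Fin r) :
    w s ∈ LinearMap.range (freeDesc (E := E) (hE := hE) (ht := ht) w hw) := by
  refine ⟨Pi.single s (PBW.incl E hE _ (CharMod.gen _ _)), ?_⟩
  rw [freeDesc_apply, Finset.sum_eq_single s, Pi.single_eq_same]
  · exact PBW.charDesc_gen (w s) (hw s)
  · intro i _ hi
    rw [Pi.single_eq_of_ne hi, map_zero]
  · simp

open MvPolynomial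

section Symbol

variable {W : Type u} [AddCommGroup W] [Module ℂ W] (δ : W ≃ₗ[ℂ] ℂ)

/-- The identification with a polynomial ring of the space underlying the module induced from a
character. -/
def symbol : (Multiset (Fin m) →₀ W) ≃ₗ[ℂ] MvPolynomial (Fin m) ℂ :=
  ((Finsupp.mapRange.linearEquiv δ).trans
    (Finsupp.domLCongr Multiset.toFinsupp.toEquiv)).trans (basisMonomials (Fin m) ℂ).repr.symm

theorem symbol_single (T : Multiset (Fin m)) (w : W) :
    symbol δ (Finsupp.single T w) = monomial (Multiset.toFinsupp T) (δ w) := by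
  rw [symbol, LinearEquiv.trans_apply, LinearEquiv.symm_apply_eq, LinearEquiv.trans_apply,
    Finsupp.mapRange.linearEquiv_apply, Finsupp.mapRange_single, Finsupp.domLCongr_single]
  rfl

theorem degree_toFinsupp (T : Multiset (Fin m)) :
    (Multiset.toFinsupp T).degree = Multiset.card T := by
  rw [← Multiset.toFinsupp_toMultiset T, Finsupp.card_toMultiset, Multiset.toFinsupp_toMultiset]
  rfl

theorem coeff_symbol (x : Multiset (Fin m) →₀ W) (T : Multiset (Fin m)) :
    coeff (Multiset.toFinsupp T) (symbol δ x) = δ (x T) := by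
  classical
  refine Finsupp.induction_linear (motive := fun x => coeff (Multiset.toFinsupp T) (symbol δ x) =
    δ (x T)) x (by simp) (fun x y hx hy => by rw [map_add, coeff_add, hx, hy, Finsupp.add_apply,
      map_add]) fun U w => ?_
  rw [symbol_single, coeff_monomial, Finsupp.single_apply]
  by_cases h : U = T
  · rw [if_pos h, if_pos (by rw [h])]
  · rw [if_neg h, if_neg (fun h1 => h (Multiset.toFinsupp.injective h1)), map_zero]

theorem mem_degLT_iff {n : ℕ} (x : Multiset (Fin m) →₀ W) :
    x ∈ PBW.degLT (Fin m) W n ↔ ∀ l, n ≤ l → homogeneousComponent l (symbol δ x) = 0 := by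
  constructor
  · intro hx l hl
    refine PBW.degLT_induction (p := fun x => homogeneousComponent l (symbol δ x) = 0)
      (fun T w hT => ?_) (by simp) (fun x y hx hy => by rw [map_add, map_add, hx, hy, add_zero]) hx
    rw [symbol_single, homogeneousComponent_of_mem (isHomogeneous_monomial _ (degree_toFinsupp T)),
      if_neg (by omega)]
  · intro h
    rw [PBW.degLT, Finsupp.mem_supported]
    intro T hT
    by_contra hTn
    have h1 := congrArg (coeff (Multiset.toFinsupp T)) (h (Multiset.card T) (not_lt.1 hTn))
    rw [coeff_homogeneousComponent, if_pos (degree_toFinsupp T), coeff_zero, coeff_symbol,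
      map_eq_zero_iff δ δ.injective] at h1
    exact Finsupp.mem_support_iff.1 hT h1

theorem symbol_top [LieRingModule t W] [LieModule ℂ t W] (x : Multiset (Fin m) →₀ W) (z : a) :
    symbol δ (PBW.top E x z) = ∑ i, (E.symm z).1 i • (X i * symbol δ x) := by
  refine Finsupp.induction_linear (motive := fun x => symbol δ (PBW.top E x z) =
    ∑ i, (E.symm z).1 i • (X i * symbol δ x)) x (by simp) (fun x y hx hy => ?_) fun T w => ?_
  · rw [map_add, LinearMap.add_apply, map_add, hx, hy, ← Finset.sum_add_distrib]
    exact Finset.sum_congr rfl fun i _ => by rw [map_add, mul_add, smul_add]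
  · rw [PBW.top_single, map_sum]
    refine Finset.sum_congr rfl fun i _ => ?_
    rw [map_smul, symbol_single, symbol_single, X, monomial_mul, one_mul, ← Multiset.singleton_add,
      map_add, Multiset.toFinsupp_singleton]

end Symbol

variable {r : ℕ} {χ : Fin r → Module.Dual ℂ t} {d : Fin r → ℕ}

variable (E hE ht χ) in
/-- The identification of the underlying space of a free weight module with a free module over a
polynomial ring. -/
def freeSymbol : FreeWt E hE ht χ ≃ₗ[ℂ] (Fin r → MvPolynomial (Fin m) ℂ) :=
  LinearEquiv.piCongrRight fun _ => show PBWModule E hE (CharMod _ _) ≃ₗ[ℂ] _ from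
    symbol CharMod.down

theorem freeSymbol_apply (x : FreeWt E hE ht χ) (s : Fin r) :
    freeSymbol E hE ht χ x s = symbol CharMod.down (x s) := rfl

theorem mem_gradedLT_iff {k : ℕ} {g : Fin r → MvPolynomial (Fin m) ℂ} : g ∈ gradedLT m d k ↔
    ∀ s, ∀ l, k - d s ≤ l → homogeneousComponent l (g s) = 0 := by
  rw [mem_gradedLT]
  constructor
  · intro h s l hl
    have := congrFun (h (l + d s) (by omega)) s
    rwa [homPart_apply, if_pos (by omega), Nat.add_sub_cancel] at this
  · intro h l hl
    funext s
    rw [homPart_apply]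
    split_ifs
    · exact h s _ (by omega)
    · rfl

theorem freeSymbol_mem_iff {k : ℕ} {x : FreeWt E hE ht χ} :
    freeSymbol E hE ht χ x ∈ gradedLT m d k ↔
      ∀ s, x s ∈ PBW.degLT (Fin m) (CharMod (χ s) (ht.char (χ s))) (k - d s) := by
  rw [mem_gradedLT_iff]
  exact forall_congr' fun s => (mem_degLT_iff CharMod.down _).symm

/-- In terms of symbols, `a` acts by multiplication up to terms of lower degree. -/
theorem freeSymbol_ι_smul {k : ℕ} {x : FreeWt E hE ht χ}
    (hx : freeSymbol E hE ht χ x ∈ gradedLT m d k) (z : a) :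
    freeSymbol E hE ht χ (UniversalEnvelopingAlgebra.ι ℂ z • x) -
      ∑ i, (E.symm z).1 i • (X i : MvPolynomial (Fin m) ℂ) • freeSymbol E hE ht χ x ∈
        gradedLT m d k := by
  rw [mem_gradedLT_iff]
  intro s
  have h1 := PBW.act_sub_top_mem E (freeSymbol_mem_iff.1 hx s) z
  intro l hl
  refine Eq.trans (congrArg _ ?_) ((mem_degLT_iff CharMod.down _).1 h1 l hl)
  rw [Pi.sub_apply, Finset.sum_apply]
  exact (congrArg₂ (· - ·) (congrArg (symbol CharMod.down) (PBW.ι_smul z (x s)))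
    (symbol_top CharMod.down _ z).symm).trans (map_sub (symbol CharMod.down) _ _).symm

theorem freeSymbol_vec_smul {k : ℕ} {x : FreeWt E hE ht χ}
    (hx : freeSymbol E hE ht χ x ∈ gradedLT m d k) (i : Fin m) :
    freeSymbol E hE ht χ (UniversalEnvelopingAlgebra.ι ℂ (PBW.vec E i) • x) -
      (X i : MvPolynomial (Fin m) ℂ) • freeSymbol E hE ht χ x ∈ gradedLT m d k := by
  have h1 := freeSymbol_ι_smul hx (PBW.vec E i)
  rw [Finset.sum_eq_single i] at h1
  · simpa [PBW.vec] using h1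
  · intro j _ hj
    simp [PBW.vec, hj]
  · simp

theorem freeSymbol_t_smul {k : ℕ} {x : FreeWt E hE ht χ}
    (hx : freeSymbol E hE ht χ x ∈ gradedLT m d k) (y : t) :
    freeSymbol E hE ht χ (UniversalEnvelopingAlgebra.ι ℂ (y : a) • x) ∈ gradedLT m d k := by
  have h1 := freeSymbol_ι_smul hx (y : a)
  rw [← hE y, LinearEquiv.symm_apply_apply] at h1
  rw [← hE y]
  simpa using h1

/-- The symbol of `e^T • v` is the product of that of `v` with a monomial. -/
theorem freeSymbol_mon_smul {e : ℕ} {v : FreeWt E hE ht χ}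
    (hv : freeSymbol E hE ht χ v ∈ gradedLT m d (e + 1)) (T : Multiset (Fin m)) :
    freeSymbol E hE ht χ (PBW.mon (PBW.vec E) T • v) ∈ gradedLT m d (Multiset.card T + e + 1) ∧
    freeSymbol E hE ht χ (PBW.mon (PBW.vec E) T • v) -
      monomial (Multiset.toFinsupp T) (1 : ℂ) • homPart d e (freeSymbol E hE ht χ v) ∈
        gradedLT m d (Multiset.card T + e) := by
  induction T using PBW.multiset_induction with
  | h0 =>
    rw [PBW.mon_zero, one_smul, Multiset.card_zero, zero_add, map_zero]
    refine ⟨hv, mem_gradedLT_of_homPart (sub_mem hv ?_) ?_⟩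
    · change (1 : MvPolynomial (Fin m) ℂ) • _ ∈ _
      rw [one_smul]
      exact homPart_mem_gradedLT e _
    · change homPart d e (_ - (1 : MvPolynomial (Fin m) ℂ) • _) = 0
      rw [one_smul, map_sub, homPart_homPart_self, sub_self]
  | hc i T hi ih =>
    obtain ⟨h1, h2⟩ := ih
    rw [PBW.mon_cons _ hi, mul_smul, Multiset.card_cons]
    have h3 := freeSymbol_vec_smul h1 i
    have h4 : Multiset.card T + 1 + e = Multiset.card T + e + 1 := by omega
    rw [h4]
    constructor
    · have := add_mem (gradedLT_mono (Nat.le_succ _) h3) (X_smul_mem_gradedLT h1 i)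
      rwa [sub_add_cancel] at this
    · have := add_mem h3 (X_smul_mem_gradedLT h2 i)
      rw [smul_sub, sub_add_sub_cancel,
        ← mul_smul (X i : MvPolynomial (Fin m) ℂ)] at this
      rwa [← Multiset.singleton_add, map_add, Multiset.toFinsupp_singleton, ← one_mul (1 : ℂ),
        ← monomial_mul]

/-- Subspaces stable under `a` satisfy the condition of `leadMod`. -/
theorem leadMod_condition (d : Fin r → ℕ) (K : Submodule (UEnv a) (FreeWt E hE ht χ)) (i : Fin m)
    (k : ℕ) (x : FreeWt E hE ht χ) (hx : x ∈ K.restrictScalars ℂ)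
    (h : freeSymbol E hE ht χ x ∈ gradedLT m d k) :
    ∃ y ∈ K.restrictScalars ℂ, freeSymbol E hE ht χ y -
      (X i : MvPolynomial (Fin m) ℂ) • freeSymbol E hE ht χ x ∈ gradedLT m d k :=
  ⟨_, K.smul_mem _ hx, freeSymbol_vec_smul h i⟩

theorem exists_sum_weight (K : Submodule (UEnv a) (FreeWt E hE ht χ)) (k : ℕ)
    (x : FreeWt E hE ht χ) (hx : x ∈ K.restrictScalars ℂ)
    (h : freeSymbol E hE ht χ x ∈ gradedLT m d k) :
    ∃ (n : ℕ) (w : Fin n → FreeWt E hE ht χ),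
      (∀ s, (∃ μ, w s ∈ wt (actU t (FreeWt E hE ht χ)) μ) ∧ w s ∈ K.restrictScalars ℂ ∧
        freeSymbol E hE ht χ (w s) ∈ gradedLT m d k) ∧ ∑ s, w s = x := by
  refine (isDiag_freeWt χ).induction_mem
    (K.restrictScalars ℂ ⊓ (gradedLT m d k).comap (freeSymbol E hE ht χ).toLinearMap) ?_
    (p := fun x => ∃ (n : ℕ) (w : Fin n → FreeWt E hE ht χ),
      (∀ s, (∃ μ, w s ∈ wt (actU t (FreeWt E hE ht χ)) μ) ∧ w s ∈ K.restrictScalars ℂ ∧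
        freeSymbol E hE ht χ (w s) ∈ gradedLT m d k) ∧ ∑ s, w s = x) ?_ ?_ ?_ x ⟨hx, h⟩
  · rintro y x ⟨hx, h⟩
    exact ⟨K.smul_mem _ hx, freeSymbol_t_smul h y⟩
  · exact ⟨0, Fin.elim0, fun s => s.elim0, by simp⟩
  · rintro μ y hy ⟨hyK, hyk⟩
    exact ⟨1, fun _ => y, fun _ => ⟨⟨μ, hy⟩, hyK, hyk⟩, by simp⟩
  · rintro _ _ ⟨k, v, hv, rfl⟩ ⟨k', v', hv', rfl⟩
    refine ⟨k + k', Fin.append v v', fun s => ?_, ?_⟩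
    · refine Fin.addCases (fun s => ?_) (fun s => ?_) s
      · rw [Fin.append_left]; exact hv s
      · rw [Fin.append_right]; exact hv' s
    · rw [Fin.sum_univ_add]
      simp only [Fin.append_left, Fin.append_right]

/-- The leading part of the homomorphism which sends the generators to given weight vectors. -/
theorem freeSymbol_freeDesc {r' : ℕ} {χ' : Fin r' → Module.Dual ℂ t} (d' : Fin r' → ℕ)
    (w : Fin r' → FreeWt E hE ht χ) (hw : ∀ s, w s ∈ wt (actU t (FreeWt E hE ht χ)) (χ' s))
    (hd : ∀ s, freeSymbol E hE ht χ (w s) ∈ gradedLT m d (d' s + 1)) (k : ℕ)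
    (x : FreeWt E hE ht χ') (hx : freeSymbol E hE ht χ' x ∈ gradedLT m d' (k + 1)) :
    freeSymbol E hE ht χ (freeDesc w hw x) - ∑ s, freeSymbol E hE ht χ' x s •
      homPart d (d' s) (freeSymbol E hE ht χ (w s)) ∈ gradedLT m d k := by
  rw [freeDesc_apply, map_sum, ← Finset.sum_sub_distrib]
  refine Submodule.sum_mem _ fun s _ => ?_
  rw [freeSymbol_apply]
  refine PBW.degLT_induction (p := fun y => freeSymbol E hE ht χ (PBW.charDesc (w s) (hw s)
    (show PBWModule E hE (CharMod (χ' s) (ht.char _)) from y)) - symbol CharMod.down y •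
      homPart d (d' s) (freeSymbol E hE ht χ (w s)) ∈ gradedLT m d k) (fun T z hT => ?_) ?_ ?_
      (freeSymbol_mem_iff.1 hx s)
  · have h1 := (freeSymbol_mon_smul (hd s) T).2
    have h2 : PBW.charDesc (w s) (hw s) (show PBWModule E hE (CharMod (χ' s) (ht.char _)) from
        Finsupp.single T z) = CharMod.down z • PBW.mon (PBW.vec E) T • w s := by
      refine (PBW.charDesc_single (w s) (hw s) T z).trans ?_
      rw [smul_algebra_smul_comm]
    rw [h2, map_smul, symbol_single]
    have h3 : monomial (Multiset.toFinsupp T) (CharMod.down z) =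
        CharMod.down z • monomial (Multiset.toFinsupp T) (1 : ℂ) := by
      rw [smul_monomial, smul_eq_mul, mul_one]
    rw [h3, smul_assoc, ← smul_sub]
    exact Submodule.smul_mem _ _ (gradedLT_mono (by omega) h1)
  · have : PBW.charDesc (w s) (hw s) (0 : PBWModule E hE (CharMod (χ' s) (ht.char _))) = 0 :=
      map_zero _
    rw [map_zero, zero_smul, sub_zero]
    change freeSymbol E hE ht χ (PBW.charDesc (w s) (hw s) (0 : PBWModule E hE _)) ∈ _
    rw [this, map_zero]
    exact zero_mem _
  · intro y y' hy hy'
    have : PBW.charDesc (w s) (hw s) ((show PBWModule E hE (CharMod (χ' s) (ht.char _)) from y) +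
        (show PBWModule E hE (CharMod (χ' s) (ht.char _)) from y')) = _ := map_add _ _ _
    change freeSymbol E hE ht χ (PBW.charDesc (w s) (hw s) (_ + _)) - _ ∈ _
    rw [this, map_add, map_add, add_smul, add_sub_add_comm]
    exact add_mem hy hy'

variable {Q : ModuleCat.{u} (UEnv a) → Prop}

/-- A property of modules which holds for the free weight modules and passes from two terms of a
short exact sequence to the quotient holds for the submodules of free weight modules. The proof
is by induction on the projective dimension of the module of leading forms. -/
theorem submodule_of_freeWt
    (hfree : ∀ (r : ℕ) (χ : Fin r → Module.Dual ℂ t), Q (ModuleCat.of _ (FreeWt E hE ht χ)))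
    (hquot : ∀ (A B C : ModuleCat.{u} (UEnv a)) (f : A →ₗ[UEnv a] B) (g : B →ₗ[UEnv a] C),
      Function.Injective f → Function.Exact f g → Function.Surjective g → Q A → Q B → Q C)
    (q : ℕ) : ∀ (r : ℕ) (χ : Fin r → Module.Dual ℂ t) (d : Fin r → ℕ)
      (K : Submodule (UEnv a) (FreeWt E hE ht χ)),
      PdLE (MvPolynomial (Fin m) ℂ) (augIdeal m) q
        (leadMod (freeSymbol E hE ht χ) d (K.restrictScalars ℂ) (leadMod_condition d K)) →
      Q (ModuleCat.of _ K) := by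
  -- both cases of the induction present `K` by the generators of its module of leading forms
  have hstep : ∀ (r : ℕ) (χ : Fin r → Module.Dual ℂ t) (d : Fin r → ℕ)
      (K : Submodule (UEnv a) (FreeWt E hE ht χ)), ∃ (r' : ℕ) (χ' : Fin r' → Module.Dual ℂ t)
      (d' : Fin r' → ℕ) (Ψ : FreeWt E hE ht χ' →ₗ[UEnv a] K)
      (g : Fin r' → leadMod (freeSymbol E hE ht χ) d (K.restrictScalars ℂ) (leadMod_condition d K)),
      Function.Surjective Ψ ∧
      (∀ b : Fin r' → ℂ, ∑ s, algebraMap ℂ (MvPolynomial (Fin m) ℂ) (b s) • g s ∈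
        augIdeal m • (⊤ : Submodule (MvPolynomial (Fin m) ℂ) (leadMod (freeSymbol E hE ht χ) d
          (K.restrictScalars ℂ) (leadMod_condition d K))) → b = 0) ∧
      Function.Surjective (Fintype.linearCombination (MvPolynomial (Fin m) ℂ) g) ∧
      leadMod (freeSymbol E hE ht χ') d' ((LinearMap.ker Ψ).restrictScalars ℂ)
        (leadMod_condition d' (LinearMap.ker Ψ)) =
        LinearMap.ker (Fintype.linearCombination (MvPolynomial (Fin m) ℂ) g) := by
    intro r χ d K
    obtain ⟨r', d', w, g, hw, hind, hsurj⟩ := exists_leading_family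
      (hK := leadMod_condition d K) (fun v => ∃ μ, v ∈ wt (actU t (FreeWt E hE ht χ)) μ)
      (exists_sum_weight (d := d) K)
    choose χ' hχ' using fun s => (hw s).1
    have hg : ∀ s, homPart d (d' s) (g s : Fin r → MvPolynomial (Fin m) ℂ) = g s := fun s => by
      rw [(hw s).2.2.2, homPart_homPart_self]
    have hΨ : ∀ x, freeDesc (E := E) (hE := hE) (ht := ht) w hχ' x ∈ K := fun x => by
      rw [freeDesc_apply]
      refine Submodule.sum_mem _ fun s _ => ?_
      have h1 : LinearMap.range (PBW.charDesc (E := E) (hE := hE)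
          (hχ := ht.char (χ' s)) (w s) (hχ' s)) ≤ K := by
        rw [LinearMap.range_eq_map, ← PBW.span_gen, Submodule.map_span, Submodule.span_le,
          Set.image_singleton, Set.singleton_subset_iff]
        have h2 := (hw s).2.1
        rwa [← PBW.charDesc_gen (E := E) (hE := hE) (hχ := ht.char (χ' s)) (w s) (hχ' s)] at h2
      exact h1 ⟨_, rfl⟩
    have hlead : ∀ k (x : FreeWt E hE ht χ'), freeSymbol E hE ht χ' x ∈ gradedLT m d' (k + 1) →
        freeSymbol E hE ht χ (freeDesc w hχ' x) - ∑ s, freeSymbol E hE ht χ' x s •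
          (g s : Fin r → MvPolynomial (Fin m) ℂ) ∈ gradedLT m d k := by
      intro k x hx
      simp only [(hw _).2.2.2]
      exact freeSymbol_freeDesc d' w hχ' (fun s => (hw s).2.2.1) k x hx
    refine ⟨r', χ', d', (freeDesc w hχ').codRestrict K hΨ, g, ?_, hind, hsurj, ?_⟩
    · rintro ⟨y, hy⟩
      obtain ⟨k, hk⟩ := exists_mem_gradedLT (d := d) (freeSymbol E hE ht χ y)
      obtain ⟨x, -, hx⟩ := exists_preimage_of_leading (hK := leadMod_condition d K)
        ((freeDesc w hχ').restrictScalars ℂ) hΨ g hg hlead hsurj k y hy hk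
      exact ⟨x, Subtype.ext hx⟩
    · have h1 : LinearMap.ker ((freeDesc w hχ').codRestrict K hΨ) =
          LinearMap.ker (freeDesc w hχ') := LinearMap.ker_codRestrict _ _ _
      have h2 := leadMod_ker (hK := leadMod_condition d K) ((freeDesc w hχ').restrictScalars ℂ) hΨ g
        hg hlead hsurj (leadMod_condition d' (LinearMap.ker (freeDesc w hχ')))
      rw [← h2]
      ext p
      rw [mem_leadMod, h1]
      rfl
  induction q with
  | zero =>
    intro r χ d K hK
    obtain ⟨r', χ', d', Ψ, g, hΨ, hind, hsurj, hker⟩ := hstep r χ d K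
    have h1 : ∀ p, p ∈ LinearMap.ker (Fintype.linearCombination (MvPolynomial (Fin m) ℂ) g) →
        p = 0 := fun p hp => hK _ g hind p hp
    have h2 : ∀ k, ∀ x ∈ LinearMap.ker Ψ, freeSymbol E hE ht χ' x ∈ gradedLT m d' k → x = 0 := by
      intro k
      induction k with
      | zero =>
        intro x _ hx
        exact (map_eq_zero_iff _ (freeSymbol E hE ht χ').injective).1 (gradedLT_zero hx)
      | succ k ih =>
        intro x hx hxk
        refine ih x hx (mem_gradedLT_of_homPart hxk (h1 _ ?_))
        rw [← hker]
        exact homPart_mem_leadMod hx hxk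
    refine hquot (ModuleCat.of _ (FreeWt E hE ht (Fin.elim0 : Fin 0 → Module.Dual ℂ t)))
      (ModuleCat.of _ (FreeWt E hE ht χ')) (ModuleCat.of _ K) 0 Ψ
      (fun _ _ _ => funext fun s => s.elim0) (fun x => ?_) hΨ (hfree _ _) (hfree _ _)
    constructor
    · intro hx
      obtain ⟨k, hk⟩ := exists_mem_gradedLT (d := d') (freeSymbol E hE ht χ' x)
      exact ⟨0, (h2 k x hx hk).symm⟩
    · rintro ⟨y, rfl⟩
      exact map_zero Ψ
  | succ q ih =>
    intro r χ d K hK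
    obtain ⟨r', χ', d', Ψ, g, hΨ, hind, hsurj, hker⟩ := hstep r χ d K
    have h1 := hK _ _ hsurj
    rw [← hker] at h1
    exact hquot (ModuleCat.of _ (LinearMap.ker Ψ)) (ModuleCat.of _ (FreeWt E hE ht χ'))
      (ModuleCat.of _ K) (LinearMap.ker Ψ).subtype Ψ Subtype.val_injective
      (LinearMap.exact_subtype_ker_map Ψ) hΨ (ih r' χ' d' _ h1) (hfree _ _)

/-- A property of modules which holds for the free weight modules and passes from two terms of a
short exact sequence to the quotient holds for all finitely generated weight modules. -/
theorem generation
    (hfree : ∀ (r : ℕ) (χ : Fin r → Module.Dual ℂ t), Q (ModuleCat.of _ (FreeWt E hE ht χ)))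
    (hquot : ∀ (A B C : ModuleCat.{u} (UEnv a)) (f : A →ₗ[UEnv a] B) (g : B →ₗ[UEnv a] C),
      Function.Injective f → Function.Exact f g → Function.Surjective g → Q A → Q B → Q C)
    (X : ModuleCat.{u} (UEnv a)) (hX : IsDiag (actU t X)) (hfin : Module.Finite (UEnv a) X) :
    Q X := by
  obtain ⟨r, χ, w, hw, hspan⟩ : ∃ (r : ℕ) (χ : Fin r → Module.Dual ℂ t) (w : Fin r → X),
      (∀ s, w s ∈ wt (actU t X) (χ s)) ∧ Submodule.span (UEnv a) (Set.range w) = ⊤ := by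
    classical
    obtain ⟨G, hG⟩ := hfin.fg_top
    choose S f hf hsum using fun y : X => hX.exists_sum y
    let J := (y : G) × S y.1
    let e := Fintype.equivFin J
    refine ⟨_, fun s => (e.symm s).2.1, fun s => f (e.symm s).1 (e.symm s).2,
      fun s => hf _ _, ?_⟩
    rw [eq_top_iff, ← hG, Submodule.span_le]
    intro y hy
    rw [← hsum y]
    refine Submodule.sum_mem _ fun μ hμ => Submodule.subset_span ?_
    refine ⟨e ⟨⟨y, hy⟩, ⟨μ, hμ⟩⟩, ?_⟩
    change f (e.symm (e _)).1 (e.symm (e _)).2 = _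
    rw [Equiv.symm_apply_apply]
  let Ψ := freeDesc (E := E) (hE := hE) (ht := ht) w hw
  have hΨ : Function.Surjective Ψ := by
    rw [← LinearMap.range_eq_top, eq_top_iff, ← hspan, Submodule.span_le]
    rintro _ ⟨s, rfl⟩
    exact mem_range_freeDesc w hw s
  exact hquot (ModuleCat.of _ (LinearMap.ker Ψ)) (ModuleCat.of _ (FreeWt E hE ht χ)) X
    (LinearMap.ker Ψ).subtype Ψ Subtype.val_injective (LinearMap.exact_subtype_ker_map Ψ) hΨ
    (submodule_of_freeWt hfree hquot m r χ 0 _ (pdLE_mvPolynomial m _)) (hfree r χ)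

end Generation

/-! ### Extensions of modules induced from characters -/

section CharExt

set_option linter.unusedSectionVars false

attribute [local instance 100] LieRing.ofAssociativeRing

variable {a : Type u} [LieRing a] [LieAlgebra ℂ a] {t : LieSubalgebra ℂ a}

instance (L M : Type u) [LieRing L] [LieAlgebra ℂ L] [AddCommGroup M] [Module ℂ M]
    [LieRingModule L M] [LieModule ℂ L M] : IsScalarTower ℂ (UEnv L) (EnvModule L M) where
  smul_assoc c v x := by
    change (UniversalEnvelopingAlgebra.lift ℂ (LieModule.toEnd ℂ L M)) (c • v) _ =
      c • (UniversalEnvelopingAlgebra.lift ℂ (LieModule.toEnd ℂ L M)) v _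
    rw [map_smul]
    rfl

theorem EnvModule.ι_smul {L M : Type u} [LieRing L] [LieAlgebra ℂ L] [AddCommGroup M] [Module ℂ M]
    [LieRingModule L M] [LieModule ℂ L M] (x : L) (y : EnvModule L M) :
    UniversalEnvelopingAlgebra.ι ℂ x • y = (⁅x, (show M from y)⁆ : M) := by
  change (UniversalEnvelopingAlgebra.lift ℂ (LieModule.toEnd ℂ L M))
    (UniversalEnvelopingAlgebra.ι ℂ x) _ = _
  rw [UniversalEnvelopingAlgebra.lift_ι_apply]
  rfl

theorem IsDiag.isPairModule_of_equiv (ht : ∀ x y : t, ⁅x, y⁆ = 0) {Y : Type u} [AddCommGroup Y]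
    [Module ℂ Y] [Module (UEnv a) Y] [IsScalarTower ℂ (UEnv a) Y] (h : IsDiag (actU t Y))
    {X : ModuleCat.{u} (UEnv a)} (e : Y ≃ₗ[UEnv a] X) : IsPairModule t X := by
  let f : Y →ₗ[ℂ] X :=
    { toFun := e
      map_add' := map_add e
      map_smul' := fun c y => by
        rw [← algebraMap_smul (UEnv a) c y, map_smul]
        rfl }
  exact (isPairModule_iff ht _).2 (h.of_surjective f (fun _ _ => map_smul e _ _) e.surjective)

theorem IsDiag.isPairModule (ht : ∀ x y : t, ⁅x, y⁆ = 0) {Y : Type u} [AddCommGroup Y]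
    [Module ℂ Y] [Module (UEnv a) Y] [IsScalarTower ℂ (UEnv a) Y] (h : IsDiag (actU t Y)) :
    IsPairModule t (ModuleCat.of (UEnv a) Y) :=
  h.isPairModule_of_equiv ht (X := ModuleCat.of (UEnv a) Y) (LinearEquiv.refl (UEnv a) Y)

theorem PairCat.surjective_of_epi {Y Z : PairCat t} (e : Y ⟶ Z) [Epi e] :
    Function.Surjective e.hom.hom := by
  have h := (IsPairModule t).preservesEpimorphisms_ι_of_isNormalMonoCategory
  have : Epi ((IsPairModule t).ι.map e) := inferInstance
  exact (ModuleCat.epi_iff_surjective _).1 this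

theorem PairCat.isDiag (ht : ∀ x y : t, ⁅x, y⁆ = 0) (Y : PairCat t) : IsDiag (actU t Y.obj) :=
  (isPairModule_iff ht _).1 Y.property

section Projective

variable {I : Type} [Fintype I] [LinearOrder I] {E : ((I → ℂ) × t) ≃ₗ[ℂ] a}
  {hE : ∀ y : t, E (0, y) = y} {χ : Module.Dual ℂ t} {hχ : ∀ x y : t, χ ⁅x, y⁆ = 0}

/-- The module induced from a character of `t` is projective. -/
theorem projective_charMod (ht : ∀ x y : t, ⁅x, y⁆ = 0)
    (hP : IsPairModule t (ModuleCat.of (UEnv a) (PBWModule E hE (CharMod χ hχ)))) :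
    Projective (⟨_, hP⟩ : PairCat t) where
  factors {Y Z} f e _ := by
    obtain ⟨y, hy⟩ := PairCat.surjective_of_epi e
      (f.hom.hom (PBW.incl E hE _ (CharMod.gen χ hχ)))
    obtain ⟨z, hz, hzy⟩ := (PairCat.isDiag ht Y).exists_lift (χ := χ) (y := y)
      (ρ' := actU t Z.obj) (e.hom.hom.restrictScalars ℂ) (map_actU e.hom.hom) (by
        rw [LinearMap.restrictScalars_apply, hy, mem_wt_actU]
        intro x
        rw [← map_smul, PBW.gen_smul]
        exact map_smul (f.hom.hom.restrictScalars ℂ) _ _)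
    refine ⟨ObjectProperty.homMk (ModuleCat.ofHom (PBW.charDesc z hz)), ?_⟩
    apply ObjectProperty.hom_ext
    apply ModuleCat.hom_ext
    refine PBW.charHom_ext ?_
    refine Eq.trans ?_ (hzy.trans hy)
    exact congrArg e.hom.hom (PBW.charDesc_gen z hz)

/-- Evaluation at the generator, a linear map from the homomorphisms out of the module induced from
a character to the weight vectors. -/
def charEval (hP : IsPairModule t (ModuleCat.of (UEnv a) (PBWModule E hE (CharMod χ hχ))))
    (Y : PairCat t) : ((⟨_, hP⟩ : PairCat t) ⟶ Y) →ₗ[ℂ] wt (actU t Y.obj) χ where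
  toFun f := ⟨f.hom.hom (PBW.incl E hE _ (CharMod.gen χ hχ)), fun x => by
    rw [actU_apply, ← map_smul, PBW.gen_smul]
    exact map_smul (f.hom.hom.restrictScalars ℂ) _ _⟩
  map_add' _ _ := rfl
  map_smul' _ _ := rfl

theorem charEval_bijective
    (hP : IsPairModule t (ModuleCat.of (UEnv a) (PBWModule E hE (CharMod χ hχ))))
    (Y : PairCat t) : Function.Bijective (charEval hP Y) := by
  constructor
  · intro f g h
    apply ObjectProperty.hom_ext
    apply ModuleCat.hom_ext
    exact PBW.charHom_ext (congrArg Subtype.val h)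
  · rintro ⟨y, hy⟩
    exact ⟨ObjectProperty.homMk (ModuleCat.ofHom (PBW.charDesc y hy)),
      Subtype.ext (PBW.charDesc_gen y hy)⟩

/-- Homomorphisms out of the module induced from a character are weight vectors. -/
def charHomEquiv (hP : IsPairModule t (ModuleCat.of (UEnv a) (PBWModule E hE (CharMod χ hχ))))
    (Y : PairCat t) : ((⟨_, hP⟩ : PairCat t) ⟶ Y) ≃ₗ[ℂ] wt (actU t Y.obj) χ :=
  LinearEquiv.ofBijective _ (charEval_bijective hP Y)

theorem epWellDefined_charMod (ht : ∀ x y : t, ⁅x, y⁆ = 0)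
    (hP : IsPairModule t (ModuleCat.of (UEnv a) (PBWModule E hE (CharMod χ hχ))))
    (Y : PairCat t) [Module.Finite ℂ (wt (actU t Y.obj) χ)] :
    EPWellDefined t ⟨_, hP⟩ Y where
  finite i := by
    have := projective_charMod ht hP
    rcases i with _ | i
    · exact Module.Finite.equiv ((Abelian.Ext.linearEquiv₀ (R := ℂ)).trans (charHomEquiv hP Y)).symm
    · have := Abelian.Ext.subsingleton_of_projective (⟨_, hP⟩ : PairCat t) Y i
      infer_instance
  vanish := by
    have := projective_charMod ht hP
    refine ⟨1, fun i hi => ?_⟩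
    obtain ⟨i, rfl⟩ : ∃ j, i = j + 1 := ⟨i - 1, by omega⟩
    exact Abelian.Ext.subsingleton_of_projective (⟨_, hP⟩ : PairCat t) Y i

/-- The module induced from a character of `t` is projective, so only the homomorphisms contribute to
its Euler–Poincaré pairings, and these are weight vectors. -/
theorem ep_charMod (ht : ∀ x y : t, ⁅x, y⁆ = 0)
    (hP : IsPairModule t (ModuleCat.of (UEnv a) (PBWModule E hE (CharMod χ hχ))))
    (Y : PairCat t) : EP t ⟨_, hP⟩ Y = Module.finrank ℂ (wt (actU t Y.obj) χ) := by
  have := projective_charMod ht hP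
  rw [EPWellDefined.ep_eq_sum (N := 1), Finset.sum_range_one, pow_zero, one_mul,
    ((Abelian.Ext.linearEquiv₀ (R := ℂ)).trans (charHomEquiv hP Y)).finrank_eq]
  intro i hi
  obtain ⟨i, rfl⟩ : ∃ j, i = j + 1 := ⟨i - 1, by omega⟩
  exact Abelian.Ext.subsingleton_of_projective (⟨_, hP⟩ : PairCat t) Y i

end Projective

section OneDimensional

variable {s : Type u} [LieRing s] [LieAlgebra ℂ s] (χ : Module.Dual ℂ s)
  (hχ : ∀ x y : s, χ ⁅x, y⁆ = 0)

/-- The coordinate on a one-dimensional module over the enveloping algebra. -/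
def envDown : EnvModule s (CharMod χ hχ) ≃ₗ[ℂ] ℂ := CharMod.down (χ := χ) (hχ := hχ)

theorem ι_smul_envModule (x : s) (z : EnvModule s (CharMod χ hχ)) :
    UniversalEnvelopingAlgebra.ι ℂ x • z = χ x • z := EnvModule.ι_smul x z

theorem isSimpleModule_charMod : IsSimpleModule (UEnv s) (EnvModule s (CharMod χ hχ)) := by
  rw [isSimpleModule_iff_toSpanSingleton_surjective]
  refine ⟨⟨⟨(envDown χ hχ).symm 1, 0, fun h => ?_⟩⟩, fun z hz z' => ?_⟩
  · rw [LinearEquiv.symm_apply_eq, map_zero] at h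
    exact one_ne_zero h
  · refine ⟨algebraMap ℂ (UEnv s) (envDown χ hχ z' / envDown χ hχ z), ?_⟩
    rw [LinearMap.toSpanSingleton_apply, algebraMap_smul]
    refine (envDown χ hχ).injective ?_
    rw [map_smul]
    exact div_mul_cancel₀ _ fun h => hz ((map_eq_zero_iff _ (envDown χ hχ).injective).1 h)

variable {χ} {X : Type u} [AddCommGroup X] [Module ℂ X] [Module (UEnv s) X]
  [IsScalarTower ℂ (UEnv s) X]

/-- The homomorphism from a one-dimensional module given by a weight vector. -/
def charModHom (y : wt (selfAct s X) χ) : EnvModule s (CharMod χ hχ) →ₗ[UEnv s] X :=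
  { LinearMap.toSpanSingleton ℂ X y.1 ∘ₗ (envDown χ hχ).toLinearMap with
    map_smul' := UEnv.map_smul_of_ι (LinearMap.toSpanSingleton ℂ X y.1 ∘ₗ
      (envDown χ hχ).toLinearMap) (fun x z => by
        rw [ι_smul_envModule, map_smul]
        simp only [LinearMap.comp_apply, LinearEquiv.coe_coe, LinearMap.toSpanSingleton_apply]
        refine Eq.trans ?_ (smul_algebra_smul_comm _ _ _).symm
        rw [show UniversalEnvelopingAlgebra.ι ℂ x • y.1 = χ x • y.1 from y.2 x]
        exact smul_comm _ _ _) }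

theorem charModHom_apply (y : wt (selfAct s X) χ) (z : EnvModule s (CharMod χ hχ)) :
    charModHom hχ y z = envDown χ hχ z • y.1 := rfl

theorem finite_wt_of_finite_hom (R : ModuleCat.{u} (UEnv s))
    (hR : Module.Finite ℂ (envObj s (CharMod χ hχ) ⟶ R)) :
    Module.Finite ℂ (wt (selfAct s R) χ) := by
  let F : wt (selfAct s R) χ →ₗ[ℂ] (envObj s (CharMod χ hχ) ⟶ R) :=
    { toFun := fun y => ModuleCat.ofHom (charModHom hχ y)
      map_add' := fun y y' => by
        refine ModuleCat.hom_ext (LinearMap.ext fun z => ?_)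
        exact smul_add (envDown χ hχ z) y.1 y'.1
      map_smul' := fun c y => by
        refine ModuleCat.hom_ext (LinearMap.ext fun z => ?_)
        exact smul_comm (envDown χ hχ z) c y.1 }
  have hF : Function.Injective F := by
    intro y y' h
    have h1 : charModHom hχ y ((envDown χ hχ).symm 1) = charModHom hχ y' ((envDown χ hχ).symm 1) :=
      LinearMap.congr_fun (congrArg ModuleCat.Hom.hom h) ((envDown χ hχ).symm 1)
    rw [charModHom_apply, charModHom_apply, LinearEquiv.apply_symm_apply, one_smul, one_smul] at h1
    exact Subtype.ext h1
  exact Module.Finite.of_injective F hF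

end OneDimensional

/-- The weight spaces of an admissible module are finite-dimensional. -/
theorem IsAdmissible.finite_wt (ht : ∀ x y : t, ⁅x, y⁆ = 0) {X : ModuleCat.{u} (UEnv a)}
    (hX : IsAdmissible t X) (χ : Module.Dual ℂ t) : Module.Finite ℂ (wt (actU t X) χ) := by
  have hχ : ∀ x y : t, χ ⁅x, y⁆ = 0 := fun x y => by rw [ht, map_zero]
  have := finite_wt_of_finite_hom hχ (resObj t X) (hX _ (isSimpleModule_charMod χ hχ))
  let e : wt (actU t X) χ →ₗ[ℂ] wt (selfAct t (resObj t X)) χ :=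
    { toFun := fun y => ⟨y.1, (resObj_mem_wt X χ y.1).2 y.2⟩
      map_add' := fun _ _ => rfl
      map_smul' := fun c y => Subtype.ext (resObj_smul X c y.1).symm }
  have he : ∀ y, (e y).1 = y.1 := fun _ => rfl
  refine Module.Finite.of_injective e fun y y' h => Subtype.ext ?_
  rw [← he y, h, he]

end CharExt

/-! ### Modules induced from characters of larger subalgebras -/

section Extend

set_option linter.unusedSectionVars false

attribute [local instance 100] LieRing.ofAssociativeRing

variable {a : Type u} [LieRing a] [LieAlgebra ℂ a]

theorem CharMod.down_smul_gen' {b b' : Type u} [LieRing b] [LieAlgebra ℂ b] [LieRing b']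
    [LieAlgebra ℂ b'] {ψ : Module.Dual ℂ b} {ψ' : Module.Dual ℂ b'}
    {hψ : ∀ x y : b, ψ ⁅x, y⁆ = 0} {hψ' : ∀ x y : b', ψ' ⁅x, y⁆ = 0} (z : CharMod ψ hψ) :
    CharMod.down z • CharMod.gen ψ' hψ' = (CharMod.down.trans CharMod.down.symm) z := by
  refine CharMod.down.injective ?_
  rw [map_smul, CharMod.gen, LinearEquiv.apply_symm_apply, LinearEquiv.trans_apply,
    LinearEquiv.apply_symm_apply, smul_eq_mul, mul_one]

/-- Splitting off the last variable: multiplication by it is injective, with cokernel the space of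
multisets in the other variables. -/
theorem exact_of_single {I : Type} {A B C : Type*} [AddCommGroup A] [Module ℂ A] [AddCommGroup B]
    [Module ℂ B] [AddCommGroup C] [Module ℂ C] (κ : A ≃ₗ[ℂ] B) (μ : B ≃ₗ[ℂ] C)
    (f : (Multiset (WithTop I) →₀ A) →ₗ[ℂ] (Multiset (WithTop I) →₀ B))
    (g : (Multiset (WithTop I) →₀ B) →ₗ[ℂ] (Multiset I →₀ C))
    (hf : ∀ T z, f (Finsupp.single T z) = Finsupp.single (T + {⊤}) (κ z))
    (hg : ∀ (T : Multiset I) z, g (Finsupp.single (T.map (↑)) z) = Finsupp.single T (μ z))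
    (hg0 : ∀ (T : Multiset (WithTop I)) z, g (Finsupp.single (T + {⊤}) z) = 0) :
    Function.Injective f ∧ Function.Exact f g := by
  constructor
  · have h1 : ∀ x T, f x (T + {⊤}) = κ (x T) := by
      intro x T
      refine Finsupp.induction_linear (motive := fun x => f x (T + {⊤}) = κ (x T)) x (by simp)
        (fun x y hx hy => by
          rw [map_add f, Finsupp.add_apply, hx, hy, Finsupp.add_apply, map_add]) fun U z => ?_
      classical
      rw [hf, Finsupp.single_apply, Finsupp.single_apply]
      by_cases h : U = T
      · rw [if_pos h, if_pos (by rw [h])]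
      · rw [if_neg h, if_neg (fun h1 => h (add_right_cancel h1)), map_zero]
    intro x y hxy
    exact Finsupp.ext fun T => κ.injective (by rw [← h1, hxy, h1])
  · let σ : (Multiset I →₀ C) →ₗ[ℂ] (Multiset (WithTop I) →₀ B) :=
      Finsupp.lsum ℂ fun T => Finsupp.lsingle (T.map (↑)) ∘ₗ μ.symm.toLinearMap
    have h1 : ∀ x, ∃ z, f z = x - σ (g x) := by
      intro x
      refine Finsupp.induction_linear (motive := fun x => ∃ z, f z = x - σ (g x)) x
        ⟨0, by simp⟩ ?_ ?_
      · rintro x y ⟨z, hz⟩ ⟨w, hw⟩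
        refine ⟨z + w, ?_⟩
        rw [map_add, hz, hw, map_add, map_add, sub_add_sub_comm]
      · intro T z
        by_cases hT : ⊤ ∈ T
        · obtain ⟨U, rfl⟩ := Multiset.exists_cons_of_mem hT
          refine ⟨Finsupp.single U (κ.symm z), ?_⟩
          rw [hf, ← Multiset.singleton_add, add_comm {⊤} U, hg0, LinearEquiv.apply_symm_apply, map_zero,
            sub_zero]
        · obtain ⟨U, rfl⟩ : ∃ U : Multiset I, U.map (↑) = T := by
            lift T to Multiset I using fun x hx => fun h => hT (h ▸ hx)
            exact ⟨T, rfl⟩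
          refine ⟨0, ?_⟩
          rw [hg, map_zero, Finsupp.lsum_single]
          simp
    intro x
    constructor
    · intro hx
      obtain ⟨z, hz⟩ := h1 x
      exact ⟨z, by rw [hz, hx, map_zero, sub_zero]⟩
    · rintro ⟨z, rfl⟩
      exact Finsupp.induction_linear (motive := fun z => g (f z) = 0) z (by simp)
        (fun x y hx hy => by rw [map_add, map_add, hx, hy, add_zero]) fun T z => by rw [hf, hg0]

namespace PBW

variable {I : Type} [Fintype I] [LinearOrder I] {b b' : LieSubalgebra ℂ a}
  (E : ((I → ℂ) × b) ≃ₗ[ℂ] a)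

theorem mon_map {J : Type} [Fintype J] [LinearOrder J] (φ : I → J) (hφ : Monotone φ) (e : J → a)
    (T : Multiset I) : mon e (T.map φ) = mon (e ∘ φ) T := by
  induction T using multiset_induction with
  | h0 => rw [Multiset.map_zero, mon_zero, mon_zero]
  | hc i T hi ih =>
    rw [Multiset.map_cons, mon_cons _ hi, mon_cons, ih]
    · rfl
    · intro j hj
      obtain ⟨k, hk, rfl⟩ := Multiset.mem_map.1 hj
      exact hφ (hi k hk)

/-- The linear map by which a basis vector `e` of `b / b'` is added to a basis of a complement of
`b`, in the last place. -/
def extendMap (hb : b' ≤ b) (e : b) : ((WithTop I → ℂ) × b') →ₗ[ℂ] a where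
  toFun p := E (fun i => p.1 i, p.1 ⊤ • e + LieSubalgebra.inclusion hb p.2)
  map_add' p q := by
    rw [← map_add]
    congr 1
    refine Prod.ext rfl ?_
    change (p.1 ⊤ + q.1 ⊤) • e + LieSubalgebra.inclusion hb (p.2 + q.2) = _
    rw [add_smul, map_add, add_add_add_comm]
    rfl
  map_smul' c p := by
    rw [RingHom.id_apply, ← map_smul]
    congr 1
    refine Prod.ext rfl ?_
    change (c * p.1 ⊤) • e + LieSubalgebra.inclusion hb (c • p.2) = _
    rw [mul_smul, map_smul, ← smul_add]
    rfl

theorem extendMap_apply (hb : b' ≤ b) (e : b) (f : WithTop I → ℂ) (y : b') :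
    extendMap E hb e (f, y) = E (fun i => f i, f ⊤ • e + LieSubalgebra.inclusion hb y) := rfl

theorem extendMap_bijective (hb : b' ≤ b) (e : b) (he : (e : a) ∉ b')
    (hbe : ∀ y : b, ∃ (c : ℂ) (y' : b'), (y : a) = c • (e : a) + y') :
    Function.Bijective (extendMap E hb e) := by
  constructor
  · rw [← LinearMap.ker_eq_bot, LinearMap.ker_eq_bot']
    rintro ⟨f, y⟩ h
    rw [extendMap_apply, map_eq_zero_iff _ E.injective, Prod.mk_eq_zero] at h
    have h1 : f ⊤ • (e : a) + y = 0 := congrArg Subtype.val h.2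
    have h2 : f ⊤ = 0 := by
      by_contra h0
      refine he ?_
      have h3 : (e : a) = (f ⊤)⁻¹ • (-(y : a)) := by
        rw [← eq_neg_of_add_eq_zero_left h1, smul_smul, inv_mul_cancel₀ h0, one_smul]
      rw [h3]
      exact b'.smul_mem _ (b'.neg_mem y.2)
    refine Prod.ext (funext fun i => ?_) (Subtype.ext ?_)
    · rcases i with _ | i
      · exact h2
      · exact congrFun h.1 i
    · rwa [h2, zero_smul, zero_add] at h1
  · intro z
    obtain ⟨⟨f, y⟩, rfl⟩ := E.surjective z
    obtain ⟨c, y', hy⟩ := hbe y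
    refine ⟨(fun i => WithTop.recTopCoe c f i, y'), ?_⟩
    rw [extendMap_apply]
    congr 1
    exact Prod.ext rfl (Subtype.ext hy.symm)

/-- The decomposition of `a` with respect to `b'` obtained from that with respect to `b`. -/
def extend (hb : b' ≤ b) (e : b) (he : (e : a) ∉ b')
    (hbe : ∀ y : b, ∃ (c : ℂ) (y' : b'), (y : a) = c • (e : a) + y') :
    ((WithTop I → ℂ) × b') ≃ₗ[ℂ] a :=
  LinearEquiv.ofBijective _ (extendMap_bijective E hb e he hbe)

variable (hb : b' ≤ b) (e : b) (he : (e : a) ∉ b')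
    (hbe : ∀ y : b, ∃ (c : ℂ) (y' : b'), (y : a) = c • (e : a) + y')

theorem extend_zero (hE : ∀ y : b, E (0, y) = y) (y : b') : extend E hb e he hbe (0, y) = y := by
  change E ((fun i => 0), (0 : ℂ) • e + LieSubalgebra.inclusion hb y) = y
  rw [zero_smul, zero_add]
  exact hE _

theorem vec_extend_top (hE : ∀ y : b, E (0, y) = y) : vec (extend E hb e he hbe) ⊤ = e := by
  change E ((fun i => (Pi.single ⊤ 1 : WithTop I → ℂ) i), (Pi.single ⊤ 1 : WithTop I → ℂ) ⊤ • e +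
    LieSubalgebra.inclusion hb 0) = e
  rw [Pi.single_eq_same, one_smul, map_zero, add_zero, ← hE e]
  congr 2

theorem vec_extend_coe (i : I) : vec (extend E hb e he hbe) i = vec E i := by
  change E ((fun j => (Pi.single (i : WithTop I) 1 : WithTop I → ℂ) j),
    (Pi.single (i : WithTop I) 1 : WithTop I → ℂ) ⊤ • e + LieSubalgebra.inclusion hb 0) = _
  rw [Pi.single_eq_of_ne WithTop.top_ne_coe, zero_smul, map_zero, add_zero, vec]
  congr 2
  funext j
  by_cases h : j = i
  · subst h; rw [Pi.single_eq_same, Pi.single_eq_same]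
  · rw [Pi.single_eq_of_ne h, Pi.single_eq_of_ne (fun h1 => h (WithTop.coe_injective h1))]

variable {E} {hE : ∀ y : b, E (0, y) = y} {F : Module.Dual ℂ a}

section Sequence

variable {χ : Module.Dual ℂ b} {hχ : ∀ x y : b, χ ⁅x, y⁆ = 0} {χ' : Module.Dual ℂ b'}
  {hχ' : ∀ x y : b', χ' ⁅x, y⁆ = 0} {χ'' : Module.Dual ℂ b'} {hχ'' : ∀ x y : b', χ'' ⁅x, y⁆ = 0}

variable (E hE) in
/-- If `b = b' ⊕ ℂ e`, the module induced from a character `χ` of `b` with `χ e = 0` is the cokernel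
of an injective map, `x ↦ x e`, between modules induced from characters of `b'`. -/
theorem exists_exact_charMod (hres : ∀ y : b', χ (LieSubalgebra.inclusion hb y) = χ' y)
    (hχe : χ e = 0)
    (hwt : ∀ y : b', UniversalEnvelopingAlgebra.ι ℂ (y : a) •
      (UniversalEnvelopingAlgebra.ι ℂ (e : a) • incl (extend E hb e he hbe)
        (extend_zero E hb e he hbe hE) _ (CharMod.gen χ' hχ')) =
      χ'' y • (UniversalEnvelopingAlgebra.ι ℂ (e : a) • incl (extend E hb e he hbe)
        (extend_zero E hb e he hbe hE) _ (CharMod.gen χ' hχ'))) :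
    ∃ (f : PBWModule (extend E hb e he hbe) (extend_zero E hb e he hbe hE) (CharMod χ'' hχ'')
        →ₗ[UEnv a] PBWModule (extend E hb e he hbe) (extend_zero E hb e he hbe hE)
          (CharMod χ' hχ'))
      (g : PBWModule (extend E hb e he hbe) (extend_zero E hb e he hbe hE) (CharMod χ' hχ')
        →ₗ[UEnv a] PBWModule E hE (CharMod χ hχ)),
      Function.Injective f ∧ Function.Exact f g ∧ Function.Surjective g := by
  let E' := extend E hb e he hbe
  let hE' := extend_zero E hb e he hbe hE
  let gen' : PBWModule E' hE' (CharMod χ' hχ') := incl E' hE' _ (CharMod.gen χ' hχ')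
  let gen₀ : PBWModule E hE (CharMod χ hχ) := incl E hE _ (CharMod.gen χ hχ)
  have hw : ∀ y : b', UniversalEnvelopingAlgebra.ι ℂ (y : a) • gen₀ = χ' y • gen₀ := fun y => by
    rw [← hres y]
    exact gen_smul E hE χ hχ (LieSubalgebra.inclusion hb y)
  let f : PBWModule E' hE' (CharMod χ'' hχ'') →ₗ[UEnv a] PBWModule E' hE' (CharMod χ' hχ') :=
    charDesc _ hwt
  let g : PBWModule E' hE' (CharMod χ' hχ') →ₗ[UEnv a] PBWModule E hE (CharMod χ hχ) :=
    charDesc gen₀ hw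
  have hmon : ∀ T : Multiset (WithTop I), mon (vec E') (T + {⊤}) =
      mon (vec E') T * UniversalEnvelopingAlgebra.ι ℂ (e : a) := fun T => by
    rw [mon_add _ _ _ (fun i _ j hj => by rw [Multiset.mem_singleton.1 hj]; exact le_top),
      ← Multiset.cons_zero, mon_cons _ (by simp), mon_zero, mul_one, vec_extend_top E hb e he hbe hE]
  have hgen' : ∀ (T : Multiset (WithTop I)) (c : ℂ), c • mon (vec E') T • gen' =
      (show PBWModule E' hE' (CharMod χ' hχ') from Finsupp.single T (c • CharMod.gen χ' hχ')) := by
    intro T c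
    rw [show mon (vec E') T • gen' = _ from mon_smul_single (hE := hE') T (CharMod.gen χ' hχ')]
    exact Finsupp.smul_single c T _
  have hgen₀ : ∀ (T : Multiset I) (c : ℂ), c • mon (vec E) T • gen₀ =
      (show PBWModule E hE (CharMod χ hχ) from Finsupp.single T (c • CharMod.gen χ hχ)) := by
    intro T c
    rw [show mon (vec E) T • gen₀ = _ from mon_smul_single (hE := hE) T (CharMod.gen χ hχ)]
    exact Finsupp.smul_single c T _
  have hf : ∀ T z, f (Finsupp.single T z) =
      Finsupp.single (T + {⊤}) (CharMod.down z • CharMod.gen χ' hχ') := fun T z => by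
    refine (charDesc_single _ hwt T z).trans ((Eq.trans ?_ (hgen' _ _)))
    rw [smul_algebra_smul_comm, hmon, mul_smul]
  have hg : ∀ (T : Multiset I) z, g (Finsupp.single (T.map (↑)) z) =
      Finsupp.single T (CharMod.down z • CharMod.gen χ hχ) := fun T z => by
    refine (charDesc_single _ hw _ z).trans ((Eq.trans ?_ (hgen₀ _ _)))
    rw [smul_algebra_smul_comm, mon_map _ WithTop.coe_mono]
    congr 3
    funext i
    exact vec_extend_coe E hb e he hbe i
  have hg0 : ∀ (T : Multiset (WithTop I)) z, g (Finsupp.single (T + {⊤}) z) = 0 := fun T z => by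
    refine (charDesc_single _ hw _ z).trans ?_
    have h1 : UniversalEnvelopingAlgebra.ι ℂ (e : a) • gen₀ = 0 :=
      (gen_smul E hE χ hχ e).trans (by rw [hχe, zero_smul])
    rw [hmon, mul_smul, smul_algebra_smul_comm (CharMod.down z), h1, smul_zero, smul_zero]
  obtain ⟨h1, h2⟩ := exact_of_single (CharMod.down.trans CharMod.down.symm)
    (CharMod.down.trans CharMod.down.symm)
    (show (Multiset (WithTop I) →₀ CharMod χ'' hχ'') →ₗ[ℂ] (Multiset (WithTop I) →₀ CharMod χ' hχ')
      from f.restrictScalars ℂ)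
    (show (Multiset (WithTop I) →₀ CharMod χ' hχ') →ₗ[ℂ] (Multiset I →₀ CharMod χ hχ)
      from g.restrictScalars ℂ)
    (fun T z => (hf T z).trans (congrArg _ (CharMod.down_smul_gen' z)))
    (fun T z => (hg T z).trans (congrArg _ (CharMod.down_smul_gen' z))) hg0
  refine ⟨f, g, h1, h2, ?_⟩
  · rw [← LinearMap.range_eq_top, eq_top_iff, ← span_gen, Submodule.span_le,
      Set.singleton_subset_iff]
    exact ⟨_, charDesc_gen gen₀ hw⟩

end Sequence

end PBW

/-- A flag of subspaces of `a`, each of which is an ideal of codimension one in the next and is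
complemented by a weight vector; the list consists of the weights of these vectors. -/
inductive WeightFlag (t : LieSubalgebra ℂ a) : Submodule ℂ a → List (Module.Dual ℂ t) → Prop
  | nil : WeightFlag t ⊥ []
  | cons {n n' : Submodule ℂ a} {L : List (Module.Dual ℂ t)} {α : Module.Dual ℂ t} {e : a} :
      WeightFlag t n L → e ∈ wt (fun x : t => (LieAlgebra.ad ℂ a (x : a) : Module.End ℂ a)) α →
      e ∉ n → (∀ x ∈ n, ⁅x, e⁆ ∈ n) → n' = n ⊔ Submodule.span ℂ {e} → WeightFlag t n' (α :: L)

variable {t : LieSubalgebra ℂ a} {n : Submodule ℂ a} {L : List (Module.Dual ℂ t)}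

theorem WeightFlag.lie_mem_left (h : WeightFlag t n L) (x : t) :
    ∀ y ∈ n, ⁅(x : a), y⁆ ∈ n := by
  induction h with
  | nil => rintro _ rfl; rw [lie_zero]; exact zero_mem _
  | @cons n n' L α e h he hen hne hn' ih =>
    intro y hy
    rw [hn'] at hy ⊢
    obtain ⟨y', hy', z, hz, rfl⟩ := Submodule.mem_sup.1 hy
    obtain ⟨c, rfl⟩ := Submodule.mem_span_singleton.1 hz
    rw [lie_add, lie_smul, show ⁅(x : a), e⁆ = α x • e from he x]
    exact add_mem (Submodule.mem_sup_left (ih y' hy')) (Submodule.mem_sup_right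
      (Submodule.smul_mem _ _ (Submodule.smul_mem _ _ (Submodule.mem_span_singleton_self e))))

theorem WeightFlag.lie_mem (h : WeightFlag t n L) : ∀ x ∈ n, ∀ y ∈ n, ⁅x, y⁆ ∈ n := by
  induction h with
  | nil => rintro _ rfl y _; rw [zero_lie]; exact zero_mem _
  | @cons n n' L α e h he hen hne hn' ih =>
    intro x hx y hy
    rw [hn'] at hx hy ⊢
    obtain ⟨x', hx', z, hz, rfl⟩ := Submodule.mem_sup.1 hx
    obtain ⟨c, rfl⟩ := Submodule.mem_span_singleton.1 hz
    obtain ⟨y', hy', z, hz', rfl⟩ := Submodule.mem_sup.1 hy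
    obtain ⟨d, rfl⟩ := Submodule.mem_span_singleton.1 hz'
    refine Submodule.mem_sup_left ?_
    rw [lie_add, add_lie, add_lie, lie_smul, smul_lie, smul_lie, lie_smul, lie_self, smul_zero,
      smul_zero, add_zero, ← lie_skew e y']
    exact add_mem (add_mem (ih x' hx' y' hy') (n.smul_mem c (n.neg_mem (hne y' hy'))))
      (n.smul_mem d (hne x' hx'))

theorem WeightFlag.lie_mem_sup (ht : IsToral t) (h : WeightFlag t n L) :
    ∀ x ∈ t.toSubmodule ⊔ n, ∀ y ∈ t.toSubmodule ⊔ n, ⁅x, y⁆ ∈ n := by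
  intro x hx y hy
  obtain ⟨x', hx', z, hz, rfl⟩ := Submodule.mem_sup.1 hx
  obtain ⟨y', hy', w, hw, rfl⟩ := Submodule.mem_sup.1 hy
  have h1 : ⁅x', y'⁆ = 0 := congrArg Subtype.val (ht.lie_eq_zero ⟨x', hx'⟩ ⟨y', hy'⟩)
  rw [lie_add, add_lie, add_lie, h1, zero_add, ← lie_skew z y']
  exact add_mem (n.neg_mem (h.lie_mem_left ⟨y', hy'⟩ z hz))
    (add_mem (h.lie_mem_left ⟨x', hx'⟩ w hw) (h.lie_mem z hz w hw))

/-- The subalgebra `t + n`. -/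
def WeightFlag.subalgebra (ht : IsToral t) (h : WeightFlag t n L) : LieSubalgebra ℂ a :=
  { t.toSubmodule ⊔ n with
    lie_mem' := fun {x y} hx hy => Submodule.mem_sup_right (h.lie_mem_sup ht x hx y hy) }

/-- The alternating sum of the values of `f` at `μ + ∑ α` over the sublists of `L`. -/
def altSum (f : Module.Dual ℂ t → ℤ) : List (Module.Dual ℂ t) → Module.Dual ℂ t → ℤ
  | [], μ => f μ
  | α :: L, μ => altSum f L μ - altSum f L (μ + α)

section

variable {I : Type} [Fintype I] [LinearOrder I] {b : LieSubalgebra ℂ a}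
  {E : ((I → ℂ) × b) ≃ₗ[ℂ] a} {hE : ∀ y : b, E (0, y) = y} {χ : Module.Dual ℂ b}
  {hχ : ∀ x y : b, χ ⁅x, y⁆ = 0}

theorem isDiag_charMod (ht : IsToral t) (htb : t ≤ b) :
    IsDiag (actU t (PBWModule E hE (CharMod χ hχ))) := by
  refine ht.isDiag_of_span ?_ PBW.span_gen
  rintro _ rfl
  exact ⟨χ ∘ₗ (LieSubalgebra.inclusion htb : t →ₗ[ℂ] b), fun x =>
    PBW.gen_smul E hE χ hχ (LieSubalgebra.inclusion htb x)⟩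

theorem isPairModule_charMod (ht : IsToral t) (htb : t ≤ b) :
    IsPairModule t (ModuleCat.of (UEnv a) (PBWModule E hE (CharMod χ hχ))) :=
  (isDiag_charMod ht htb).isPairModule ht.lie_eq_zero

end

/-- Extension of a weight by zero. -/
theorem exists_extend_dual (hd : Disjoint t.toSubmodule n) (α : Module.Dual ℂ t) :
    ∃ F : Module.Dual ℂ a, (∀ x : t, F x = α x) ∧ ∀ x ∈ n, F x = 0 := by
  obtain ⟨g, hg⟩ := LinearMap.exists_leftInverse_of_injective
    (n.mkQ ∘ₗ t.toSubmodule.subtype) (by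
      rw [LinearMap.ker_eq_bot']
      intro x hx
      exact Subtype.ext (Submodule.disjoint_def.1 hd x x.2
        ((Submodule.Quotient.mk_eq_zero n).1 hx))) 
  refine ⟨α ∘ₗ g ∘ₗ n.mkQ, fun x => congrArg α (LinearMap.congr_fun hg x), fun x hx => ?_⟩
  rw [LinearMap.comp_apply, LinearMap.comp_apply, Submodule.mkQ_apply,
    (Submodule.Quotient.mk_eq_zero n).2 hx, map_zero, map_zero]

/-- The Euler–Poincaré pairing of the module induced from a character of `t + n` which vanishes
on `n` is an alternating sum of dimensions of weight spaces. -/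
theorem WeightFlag.ep_charMod (ht : IsToral t) (h : WeightFlag t n L) :
    ∀ (_ : Disjoint t.toSubmodule n) (b : LieSubalgebra ℂ a) (_ : b.toSubmodule = t.toSubmodule ⊔ n)
      {I : Type} [Fintype I] [LinearOrder I] (E : ((I → ℂ) × b) ≃ₗ[ℂ] a)
      (hE : ∀ y : b, E (0, y) = y) (F : Module.Dual ℂ a) (_ : ∀ x ∈ n, F x = 0)
      (hχ : ∀ x y : b, (F ∘ₗ b.toSubmodule.subtype) ⁅x, y⁆ = 0)
      (hP : IsPairModule t (ModuleCat.of (UEnv a) (PBWModule E hE (CharMod _ hχ))))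
      (Y : PairCat t) (_ : ∀ μ, Module.Finite ℂ (wt (actU t Y.obj) μ)),
      EPWellDefined t ⟨_, hP⟩ Y ∧ EP t ⟨_, hP⟩ Y =
        altSum (fun μ => (Module.finrank ℂ (wt (actU t Y.obj) μ) : ℤ)) L
          (F ∘ₗ t.toSubmodule.subtype) := by
  induction h with
  | nil =>
    intro _ b hb I _ _ E hE F hF hχ hP Y hY
    rw [sup_bot_eq] at hb
    obtain rfl : b = t := LieSubalgebra.toSubmodule_injective hb
    exact ⟨epWellDefined_charMod ht.lie_eq_zero hP Y, ep_charMod ht.lie_eq_zero hP Y⟩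
  | @cons n n' L α e h he hen hne hn' ih =>
    intro hd b hb I _ _ E hE F hF hχ hP Y hY
    have hnn' : n ≤ n' := hn' ▸ le_sup_left
    have hen' : e ∈ n' := hn' ▸ Submodule.mem_sup_right (Submodule.mem_span_singleton_self e)
    have hd' : Disjoint t.toSubmodule n := hd.mono_right hnn'
    let b' := h.subalgebra ht
    have hb'mem : ∀ x, x ∈ b' ↔ x ∈ t.toSubmodule ⊔ n := fun _ => Iff.rfl
    have hbmem : ∀ x, x ∈ b ↔ x ∈ t.toSubmodule ⊔ n' := fun x => by rw [← hb]; rfl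
    have hb'b : b' ≤ b := fun x hx => (hbmem x).2 (sup_le_sup_left hnn' _ hx)
    have heb : e ∈ b := (hbmem e).2 (Submodule.mem_sup_right hen')
    have heb' : e ∉ b' := by
      intro heb'
      obtain ⟨x, hx, y, hy, hxy⟩ := Submodule.mem_sup.1 ((hb'mem e).1 heb')
      have hx0 : x = 0 := Submodule.disjoint_def.1 hd x hx (by
        rw [eq_sub_of_add_eq hxy]; exact sub_mem hen' (hnn' hy))
      rw [hx0, zero_add] at hxy
      exact hen (hxy ▸ hy)
    have hbe : ∀ y : b, ∃ (c : ℂ) (y' : b'), (y : a) = c • e + y' := by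
      intro y
      obtain ⟨x, hx, z, hz, hxz⟩ := Submodule.mem_sup.1 ((hbmem y).1 y.2)
      rw [hn'] at hz
      obtain ⟨z', hz', w, hw, rfl⟩ := Submodule.mem_sup.1 hz
      obtain ⟨c, rfl⟩ := Submodule.mem_span_singleton.1 hw
      refine ⟨c, ⟨x + z', (hb'mem _).2 (add_mem (Submodule.mem_sup_left hx)
        (Submodule.mem_sup_right hz'))⟩, ?_⟩
      rw [← hxz, ← add_assoc, add_comm]
    obtain ⟨G, hGt, hGn⟩ := exists_extend_dual hd' α
    have hχ' : ∀ x y : b', (F ∘ₗ b'.toSubmodule.subtype) ⁅x, y⁆ = 0 := fun x y =>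
      hF _ (hnn' (h.lie_mem_sup ht x x.2 y y.2))
    have hχ'' : ∀ x y : b', ((F + G) ∘ₗ b'.toSubmodule.subtype) ⁅x, y⁆ = 0 := fun x y => by
      have h1 := h.lie_mem_sup ht x x.2 y y.2
      change F ⁅(x : a), (y : a)⁆ + G ⁅(x : a), (y : a)⁆ = 0
      rw [hF _ (hnn' h1), hGn _ h1, add_zero]
    let E' := PBW.extend E hb'b ⟨e, heb⟩ heb' hbe
    let hE' : ∀ y : b', E' (0, y) = y := PBW.extend_zero E hb'b ⟨e, heb⟩ heb' hbe hE
    have htb' : t ≤ b' := fun x hx => (hb'mem x).2 (Submodule.mem_sup_left hx)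
    obtain ⟨f, g, hf, hfg, hg⟩ := PBW.exists_exact_charMod (χ := F ∘ₗ b.toSubmodule.subtype)
      (hχ := hχ) (hχ' := hχ') (hχ'' := hχ'') E hb'b ⟨e, heb⟩ heb' hbe hE (fun _ => rfl)
      (hF e hen') (fun y => by
        obtain ⟨x, hx, z, hz, hxz⟩ := Submodule.mem_sup.1 ((hb'mem y).1 y.2)
        have h1 : ⁅(y : a), e⁆ = α ⟨x, hx⟩ • e + ⁅z, e⁆ := by
          rw [← hxz, add_lie]
          congr 1
          exact he ⟨x, hx⟩
        have h2 : (⟨⁅z, e⁆, (hb'mem _).2 (Submodule.mem_sup_right (hne z hz))⟩ : b') = _ := rfl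
        have h3 := PBW.gen_smul E' hE' (F ∘ₗ b'.toSubmodule.subtype) hχ' y
        have h4 := PBW.gen_smul E' hE' (F ∘ₗ b'.toSubmodule.subtype) hχ'
          ⟨⁅z, e⁆, (hb'mem _).2 (Submodule.mem_sup_right (hne z hz))⟩
        have h5 : (F ∘ₗ b'.toSubmodule.subtype)
            ⟨⁅z, e⁆, (hb'mem _).2 (Submodule.mem_sup_right (hne z hz))⟩ = 0 :=
          hF _ (hnn' (hne z hz))
        rw [h5, zero_smul] at h4
        have h6 := LieHom.map_lie (UniversalEnvelopingAlgebra.ι ℂ) (y : a) e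
        rw [h1, map_add, map_smul, LieRing.of_associative_ring_bracket,
          eq_sub_iff_add_eq] at h6
        have h7 : ((F + G) ∘ₗ b'.toSubmodule.subtype) y =
            (F ∘ₗ b'.toSubmodule.subtype) y + α ⟨x, hx⟩ := by
          change F y + G y = F y + α ⟨x, hx⟩
          rw [← hxz, map_add G, hGn z hz, add_zero, ← hGt ⟨x, hx⟩]
        rw [← mul_smul, ← h6, add_smul, add_smul, h4, add_zero, mul_smul, h3, h7, add_smul,
          smul_assoc, smul_algebra_smul_comm, add_comm])
    have hP' : IsPairModule t (ModuleCat.of (UEnv a) (PBWModule E' hE' (CharMod _ hχ'))) :=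
      isPairModule_charMod ht htb'
    have hP'' : IsPairModule t (ModuleCat.of (UEnv a) (PBWModule E' hE' (CharMod _ hχ''))) :=
      isPairModule_charMod ht htb'
    obtain ⟨w', e'⟩ := ih hd' b' rfl E' hE' F (fun x hx => hF x (hnn' hx)) hχ' hP' Y hY
    obtain ⟨w'', e''⟩ := ih hd' b' rfl E' hE' (F + G)
      (fun x hx => by rw [LinearMap.add_apply, hF x (hnn' hx), hGn x hx, add_zero]) hχ'' hP'' Y hY
    have hS := pairComplex_shortExact hP'' hP' hP f g hfg hf hg
    have w : EPWellDefined t ⟨_, hP⟩ Y := PairCat.epWellDefined_X₃ hS Y w'' w'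
    refine ⟨w, ?_⟩
    have h8 := PairCat.ep_X₂ hS Y w'' w' w
    have h9 : (F + G) ∘ₗ t.toSubmodule.subtype = F ∘ₗ t.toSubmodule.subtype + α :=
      LinearMap.ext fun x => congrArg (F x + ·) (hGt x)
    rw [h9] at e''
    rw [altSum, ← e', ← e'']
    exact eq_sub_of_add_eq' h8.symm

end Extend

/-! ### Flags in solvable subalgebras stable under a torus -/

section Flags

set_option linter.unusedSectionVars false

attribute [local instance 100] LieRing.ofAssociativeRing

variable {a : Type u} [LieRing a] [LieAlgebra ℂ a] [FiniteDimensional ℂ a] {t : LieSubalgebra ℂ a}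

/-- A proper stable subspace `D` of a stable subspace `k` is contained in a stable subspace of
codimension one in `k`, complemented by a weight vector. -/
theorem IsToral.exists_hyperplane (ht : IsToral t) (D k : Submodule ℂ a)
    (hD : ∀ (x : t), ∀ y ∈ D, ⁅(x : a), y⁆ ∈ D) (hk : ∀ (x : t), ∀ y ∈ k, ⁅(x : a), y⁆ ∈ k)
    (hlt : D < k) :
    ∃ (N : Submodule ℂ a) (α : Module.Dual ℂ t) (e : a), D ≤ N ∧
      (∀ (x : t), ∀ y ∈ N, ⁅(x : a), y⁆ ∈ N) ∧ e ∉ N ∧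
      e ∈ wt (fun x : t => (LieAlgebra.ad ℂ a (x : a) : Module.End ℂ a)) α ∧
      k = N ⊔ Submodule.span ℂ {e} := by
  have hw : ∀ N : Submodule ℂ a, ¬ k ≤ N → ∃ (α : Module.Dual ℂ t) (e : a), e ∉ N ∧ e ∈ k ∧
      e ∈ wt (fun x : t => (LieAlgebra.ad ℂ a (x : a) : Module.End ℂ a)) α := by
    intro N hN
    by_contra! h
    refine hN fun y hy => ht.isDiag.induction_mem k hk (p := fun y => y ∈ N) (zero_mem _)
      (fun χ y hyχ hyk => ?_) (fun _ _ => add_mem) y hy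
    by_contra hyN
    exact h χ y hyN hyk hyχ
  obtain ⟨α, e, heD, hek, he⟩ := hw D hlt.not_ge
  obtain ⟨N, hN⟩ : ∃ N, Maximal (fun N : Submodule ℂ a => D ≤ N ∧ N ≤ k ∧ e ∉ N ∧
      ∀ (x : t), ∀ y ∈ N, ⁅(x : a), y⁆ ∈ N) N :=
    exists_maximal_of_wellFoundedGT _ ⟨D, le_rfl, hlt.le, heD, hD⟩
  obtain ⟨⟨hDN, hNk, heN, hNt⟩, hmax⟩ := hN
  refine ⟨N, α, e, hDN, hNt, heN, he, le_antisymm ?_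
    (sup_le hNk ((Submodule.span_singleton_le_iff_mem _ _).2 hek))⟩
  by_contra hkN
  obtain ⟨β, e', heN', hek', he'⟩ := hw _ hkN
  -- the subspace `N + ℂ e'` is stable, and so contains `e` by maximality
  have h1 : e ∈ N ⊔ Submodule.span ℂ {e'} := by
    by_contra h1
    refine heN' (Submodule.mem_sup_left (hmax ⟨hDN.trans le_sup_left, sup_le hNk
      ((Submodule.span_singleton_le_iff_mem _ _).2 hek'), h1, fun x y hy => ?_⟩ le_sup_left
      (Submodule.mem_sup_right (Submodule.mem_span_singleton_self e'))))
    obtain ⟨z, hz, w, hw', rfl⟩ := Submodule.mem_sup.1 hy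
    obtain ⟨c, rfl⟩ := Submodule.mem_span_singleton.1 hw'
    rw [lie_add, lie_smul, show ⁅(x : a), e'⁆ = β x • e' from he' x]
    exact add_mem (Submodule.mem_sup_left (hNt x z hz)) (Submodule.mem_sup_right
      (Submodule.smul_mem _ _ (Submodule.smul_mem _ _ (Submodule.mem_span_singleton_self e'))))
  obtain ⟨z, hz, w, hw', hzw⟩ := Submodule.mem_sup.1 h1
  obtain ⟨c, rfl⟩ := Submodule.mem_span_singleton.1 hw'
  have hc : c ≠ 0 := by
    rintro rfl
    rw [zero_smul, add_zero] at hzw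
    exact heN (hzw ▸ hz)
  refine heN' (((N ⊔ Submodule.span ℂ {e}).smul_mem_iff hc).1 ?_)
  rw [eq_sub_of_add_eq' hzw]
  exact sub_mem (Submodule.mem_sup_right (Submodule.mem_span_singleton_self e))
    (Submodule.mem_sup_left hz)

/-- A solvable subalgebra `k` that is stable under the torus `t` has a flag of `t`-stable subalgebras of
codimension one, by induction: `[k, k]` is contained in a `t`-stable hyperplane of `k`. -/
theorem IsToral.exists_weightFlag (ht : IsToral t) (k : LieSubalgebra ℂ a)
    (hs : LieAlgebra.IsSolvable k) (hk : ∀ (x : t), ∀ y ∈ k, ⁅(x : a), y⁆ ∈ k) :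
    ∃ L, WeightFlag t k.toSubmodule L := by
  induction hd : Module.finrank ℂ k using Nat.strong_induction_on generalizing k with
  | _ d ih =>
    subst hd
    by_cases hk0 : k = ⊥
    · subst hk0
      exact ⟨[], by simpa using WeightFlag.nil⟩
    have : Nontrivial k := by
      rw [← LieSubalgebra.toSubmodule_inj] at hk0
      exact (Submodule.nontrivial_iff_ne_bot (p := k.toSubmodule)).2 hk0
    have hlt := (LieAlgebra.derivedSeries_lt_top_of_solvable ℂ k)
    let D : Submodule ℂ a := Submodule.span ℂ {z | ∃ x ∈ k, ∃ y ∈ k, ⁅x, y⁆ = z}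
    have hDk : D ≤ k.toSubmodule := Submodule.span_le.2 (by
      rintro _ ⟨x, hx, y, hy, rfl⟩
      exact k.lie_mem hx hy)
    have hDlt : D < k.toSubmodule := by
      refine lt_of_le_of_ne hDk fun hD => hlt.ne ?_
      rw [← LieSubmodule.toSubmodule_inj]
      refine (LieAlgebra.coe_derivedSeries_one_eq (R := ℂ) (L := k)).trans
        (eq_top_iff.2 fun x _ => ?_)
      have h1 : Submodule.map k.toSubmodule.subtype
          (Submodule.span ℂ {⁅x, y⁆ | (x : k) (y : k)}) = D := by
        rw [Submodule.map_span]
        congr 1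
        ext z
        constructor
        · rintro ⟨_, ⟨x, y, rfl⟩, rfl⟩
          exact ⟨x, x.2, y, y.2, rfl⟩
        · rintro ⟨x, hx, y, hy, rfl⟩
          exact ⟨_, ⟨⟨x, hx⟩, ⟨y, hy⟩, rfl⟩, rfl⟩
      have h2 : (x : a) ∈ D := hD ▸ x.2
      rw [← h1] at h2
      obtain ⟨x', hx', h3⟩ := h2
      rwa [← Subtype.ext (p := fun z => z ∈ k) h3]
    have hDt : ∀ (x : t), ∀ y ∈ D, ⁅(x : a), y⁆ ∈ D := by
      intro x y hy
      refine Submodule.span_induction (p := fun y _ => ⁅(x : a), y⁆ ∈ D) ?_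
        (by rw [lie_zero]; exact zero_mem _) (fun _ _ _ _ h1 h2 => by
          rw [lie_add]; exact add_mem h1 h2) (fun c _ _ h1 => by
          rw [lie_smul]; exact D.smul_mem c h1) hy
      rintro _ ⟨y, hy, z, hz, rfl⟩
      rw [leibniz_lie]
      exact add_mem (Submodule.subset_span ⟨_, hk x y hy, z, hz, rfl⟩)
        (Submodule.subset_span ⟨y, hy, _, hk x z hz, rfl⟩)
    obtain ⟨N, α, e, hDN, hNt, heN, he, hkN⟩ := ht.exists_hyperplane D _ hDt hk hDlt
    have hNk : N ≤ k.toSubmodule := hkN ▸ le_sup_left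
    have hek : e ∈ k := by
      have : e ∈ k.toSubmodule := hkN ▸ Submodule.mem_sup_right (Submodule.mem_span_singleton_self e)
      exact this
    let k' : LieSubalgebra ℂ a :=
      { N with
        lie_mem' := fun {x y} hx hy =>
          hDN (Submodule.subset_span ⟨x, hNk hx, y, hNk hy, rfl⟩) }
    have hk'k : k' ≤ k := hNk
    have hs' : LieAlgebra.IsSolvable k' :=
      (LieSubalgebra.inclusion_injective hk'k).lieAlgebra_isSolvable
    have hlt' : Module.finrank ℂ k' < Module.finrank ℂ k :=
      Submodule.finrank_lt_finrank_of_lt (s := N) (t := k.toSubmodule)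
        (lt_of_le_of_ne hNk fun h => heN (h ▸ hek))
    obtain ⟨L, hL⟩ := ih _ hlt' k' hs' hNt rfl
    exact ⟨α :: L, hL.cons he heN
      (fun x hx => hDN (Submodule.subset_span ⟨x, hNk hx, e, hek, rfl⟩)) hkN⟩

/-- A basis of weight vectors adapted to a flag. -/
theorem WeightFlag.exists_basis {n : Submodule ℂ a} {L : List (Module.Dual ℂ t)}
    (h : WeightFlag t n L) :
    ∃ v : Fin L.length → a, LinearIndependent ℂ v ∧ Submodule.span ℂ (Set.range v) = n ∧
      ∀ i, v i ∈ wt (fun x : t => (LieAlgebra.ad ℂ a (x : a) : Module.End ℂ a)) (L.get i) := by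
  induction h with
  | nil =>
    have : IsEmpty (Fin ([] : List (Module.Dual ℂ t)).length) := Fin.isEmpty
    exact ⟨Fin.elim0, linearIndependent_empty_type, by simp, fun i => i.elim0⟩
  | @cons n n' L α e h he hen hne hn' ih =>
    obtain ⟨v, hv, hvn, hvw⟩ := ih
    refine ⟨Fin.cons (n := L.length) (α := fun _ => a) e v, ?_, ?_, fun i => ?_⟩
    · exact (linearIndependent_finCons).2 ⟨hv, by rwa [hvn]⟩
    · refine Eq.trans (congrArg _ (Fin.range_cons (n := L.length) e v)) ?_
      rw [Submodule.span_insert, hvn, hn', sup_comm]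
    · induction i using Fin.cases with
      | zero => exact he
      | succ i => exact hvw i

end Flags

/-- The alternating sum over the subsets of the set of positions in the list. -/
theorem altSum_eq_sum {a : Type u} [LieRing a] [LieAlgebra ℂ a] {t : LieSubalgebra ℂ a}
    (f : Module.Dual ℂ t → ℤ) (L : List (Module.Dual ℂ t)) (μ : Module.Dual ℂ t) :
    altSum f L μ =
      ∑ S : Finset (Fin L.length), (-1) ^ S.card * f (μ + ∑ i ∈ S, L.get i) := by
  induction L generalizing μ with
  | nil =>
    have : (Finset.univ : Finset (Finset (Fin ([] : List (Module.Dual ℂ t)).length))) = {∅} := rfl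
    rw [this, Finset.sum_singleton]
    simp [altSum]
  | cons α L ih =>
    rw [altSum, ih, ih]
    have h1 : ∀ F : Finset (Fin (L.length + 1)) → ℤ, ∑ S, F S =
        ∑ S : Finset (Fin L.length), F (S.map (Fin.succEmb _)) +
          ∑ S : Finset (Fin L.length), F (insert 0 (S.map (Fin.succEmb _))) := by
      intro F
      rw [← Finset.powerset_univ, Fin.univ_succ, Finset.cons_eq_insert,
        Finset.sum_powerset_insert (by simp)]
      have h2 : ∀ G : Finset (Fin (L.length + 1)) → ℤ,
          ∑ S ∈ (Finset.univ.map (Fin.succEmb L.length)).powerset, G S =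
            ∑ S : Finset (Fin L.length), G (S.map (Fin.succEmb _)) := fun G => by
        refine (Finset.sum_bij (fun S _ => S.map (Fin.succEmb _)) (fun S _ => ?_)
          (fun S _ S' _ h => Finset.map_injective _ h) (fun S hS => ?_) fun _ _ => rfl).symm
        · exact Finset.mem_powerset.2 (Finset.map_subset_map.2 (Finset.subset_univ S))
        · obtain ⟨U, -, rfl⟩ := Finset.subset_map_iff.1 (Finset.mem_powerset.1 hS)
          exact ⟨U, Finset.mem_univ U, rfl⟩
      exact congrArg₂ (· + ·) (h2 _) (h2 _)
    refine Eq.trans ?_ (h1 _).symm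
    rw [sub_eq_add_neg, ← Finset.sum_neg_distrib]
    congr 1
    · refine Finset.sum_congr rfl fun S _ => ?_
      rw [Finset.card_map, Finset.sum_map]
      rfl
    · refine Finset.sum_congr rfl fun S _ => ?_
      rw [Finset.card_insert_of_notMem (by simp), Finset.sum_insert (by simp), Finset.card_map,
        Finset.sum_map, pow_succ, mul_neg_one, neg_mul, add_assoc]
      rfl

/-! ### Weights of the cohomology of an ideal -/

section WeightSequences

variable {T : Type*} [AddCommGroup T] [Module ℂ T] {A B C : Type*} [AddCommGroup A] [Module ℂ A]
  [AddCommGroup B] [Module ℂ B] [AddCommGroup C] [Module ℂ C] {ρA : T → Module.End ℂ A}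
  {ρB : T → Module.End ℂ B} {ρC : T → Module.End ℂ C}

/-- Passing to the vectors of a given weight is exact on diagonalizable modules. -/
theorem finrank_wt_add (hB : IsDiag ρB) (f : A →ₗ[ℂ] B) (g : B →ₗ[ℂ] C)
    (hf : ∀ x y, f (ρA x y) = ρB x (f y)) (hg : ∀ x y, g (ρB x y) = ρC x (g y))
    (hfi : Function.Injective f) (hfg : Function.Exact f g) (hgs : Function.Surjective g)
    (χ : Module.Dual ℂ T) (hfin : Module.Finite ℂ (wt ρB χ)) :
    Module.Finite ℂ (wt ρA χ) ∧ Module.Finite ℂ (wt ρC χ) ∧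
      Module.finrank ℂ (wt ρB χ) = Module.finrank ℂ (wt ρA χ) + Module.finrank ℂ (wt ρC χ) := by
  let f' : wt ρA χ →ₗ[ℂ] wt ρB χ := f.restrict fun y hy => map_mem_wt f hf hy
  let g' : wt ρB χ →ₗ[ℂ] wt ρC χ := g.restrict fun y hy => map_mem_wt g hg hy
  have hf' : Function.Injective f' := fun x y h => Subtype.ext (hfi (congrArg Subtype.val h))
  have hg' : Function.Surjective g' := by
    rintro ⟨z, hz⟩
    obtain ⟨y, rfl⟩ := hgs z
    obtain ⟨w, hw, hwy⟩ := hB.exists_lift g hg hz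
    exact ⟨⟨w, hw⟩, Subtype.ext hwy⟩
  have hfg' : LinearMap.range f' = LinearMap.ker g' := by
    ext y
    rw [LinearMap.mem_ker, LinearMap.mem_range]
    constructor
    · rintro ⟨x, rfl⟩
      exact Subtype.ext (hfg.apply_apply_eq_zero x)
    · intro hy
      obtain ⟨x, hx⟩ := (hfg y).1 (congrArg Subtype.val hy)
      exact ⟨⟨x, mem_wt_of_injective f hf hfi (hx ▸ y.2)⟩, Subtype.ext hx⟩
  refine ⟨Module.Finite.of_injective f' hf', Module.Finite.of_surjective g' hg', ?_⟩
  rw [← LinearMap.finrank_range_add_finrank_ker g', ← hfg', LinearMap.finrank_range_of_inj hf',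
    LinearMap.range_eq_top.2 hg', finrank_top, add_comm]

end WeightSequences

section CohomologyWeights

set_option linter.unusedSectionVars false

variable {P : Type u} [LieRing P] [LieAlgebra ℂ P] {I : LieIdeal ℂ P}
  {M : Type u} [AddCommGroup M] [Module ℂ M] [LieRingModule P M] [LieModule ℂ P M]
  {T : Type*} [AddCommGroup T] [Module ℂ T] (φ : T → P) {m : ℕ} (v : Module.Basis (Fin m) ℂ I)
  (α : Fin m → Module.Dual ℂ T)

/-- The family of operators on a Lie module given by a family of elements of the Lie algebra. -/
def actVia (N : Type*) [AddCommGroup N] [Module ℂ N] [LieRingModule P N] [LieModule ℂ P N]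
    (x : T) : Module.End ℂ N := LieModule.toEnd ℂ P N (φ x)

theorem actVia_apply (N : Type*) [AddCommGroup N] [Module ℂ N] [LieRingModule P N]
    [LieModule ℂ P N] (x : T) (y : N) : actVia φ N x y = ⁅φ x, y⁆ := rfl

/-- The values of a cochain at the increasing sequences of basis vectors. -/
def cochainEquiv (n : ℕ) :
    CECochain I M n ≃ₗ[ℂ] (Set.powersetCard (Fin m) n → M) :=
  exteriorPower.alternatingMapLinearEquiv.trans ((v.exteriorPower n).constr ℂ).symm

theorem cochainEquiv_apply {n : ℕ} (f : CECochain I M n) (S : Set.powersetCard (Fin m) n) :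
    cochainEquiv v n f S = f (v ∘ (Set.powersetCard.ofFinEmbEquiv.symm S)) := by
  change (exteriorPower.alternatingMapLinearEquiv f) (v.exteriorPower n S) = _
  rw [exteriorPower.basis_apply]
  exact exteriorPower.alternatingMapLinearEquiv_apply_ιMulti f _

/-- The sum of the weights in a subset of the basis. -/
def weightSum {n : ℕ} (S : Set.powersetCard (Fin m) n) : Module.Dual ℂ T := ∑ i ∈ S.1, α i

theorem sum_ofFinEmbEquiv {n : ℕ} (S : Set.powersetCard (Fin m) n) :
    ∑ k, α (Set.powersetCard.ofFinEmbEquiv.symm S k) = weightSum α S := by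
  rw [weightSum]
  conv_rhs => rw [← Finset.image_orderEmbOfFin_univ S.1 S.2]
  rw [Finset.sum_image (fun _ _ _ _ h => (Finset.orderEmbOfFin S.1 S.2).injective h)]
  rfl

variable {φ v α} (hv : ∀ x i, ⁅φ x, v i⁆ = α i x • v i)
include hv

/-- In coordinates, the action on cochains is that on `M` shifted by sums of weights of `I`. -/
theorem cochainEquiv_lie {n : ℕ} (x : T) (f : CECochain I M n) (S : Set.powersetCard (Fin m) n) :
    cochainEquiv v n ⁅φ x, f⁆ S =
      ⁅φ x, cochainEquiv v n f S⁆ - weightSum α S x • cochainEquiv v n f S := by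
  rw [cochainEquiv_apply, cochainEquiv_apply, CECochain.lie_apply]
  congr 1
  rw [← sum_ofFinEmbEquiv, LinearMap.sum_apply, Finset.sum_smul]
  refine Finset.sum_congr rfl fun k _ => ?_
  rw [Function.comp_apply, hv, AlternatingMap.map_update_smul]
  congr 2
  exact Function.update_eq_self _ _

theorem mem_wt_cochain {n : ℕ} {f : CECochain I M n} {χ : Module.Dual ℂ T} :
    f ∈ wt (actVia φ (CECochain I M n)) χ ↔
      ∀ S, cochainEquiv v n f S ∈ wt (actVia φ M) (χ + weightSum α S) := by
  have h1 : f ∈ wt (actVia φ (CECochain I M n)) χ ↔ ∀ x S,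
      ⁅φ x, cochainEquiv v n f S⁆ - weightSum α S x • cochainEquiv v n f S =
        χ x • cochainEquiv v n f S := by
    refine forall_congr' fun x => ?_
    rw [actVia_apply, ← (cochainEquiv v n).injective.eq_iff, funext_iff, map_smul]
    exact forall_congr' fun S => by rw [cochainEquiv_lie hv]; rfl
  rw [h1, forall_comm]
  refine forall_congr' fun S => forall_congr' fun x => ?_
  rw [actVia_apply, LinearMap.add_apply, add_smul, sub_eq_iff_eq_add]

theorem isDiag_cochain (hM : IsDiag (actVia φ M)) (n : ℕ) :
    IsDiag (actVia φ (CECochain I M n)) := by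
  let ρ : Set.powersetCard (Fin m) n → T → Module.End ℂ M := fun S x =>
    actVia φ M x - weightSum α S x • LinearMap.id
  have h1 : ∀ S, IsDiag (ρ S) := fun S => isDiag_of_mem fun y =>
    hM.induction (p := fun y => y ∈ ⨆ χ, wt (ρ S) χ)
      (fun χ y hy => Submodule.mem_iSup_of_mem (χ - weightSum α S) fun x => by
        change actVia φ M x y - weightSum α S x • y = _
        rw [hy x, LinearMap.sub_apply, sub_smul]) (fun _ _ => add_mem) y
  refine (IsDiag.pi h1 (σ := fun x => LinearMap.pi fun S => ρ S x ∘ₗ LinearMap.proj S)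
    fun x y S => rfl).of_injective (cochainEquiv v n).toLinearMap (fun x f => ?_)
    (cochainEquiv v n).injective
  exact funext fun S => cochainEquiv_lie hv x f S

theorem finrank_wt_cochain (n : ℕ) (χ : Module.Dual ℂ T)
    (hfin : ∀ χ, Module.Finite ℂ (wt (actVia φ M) χ)) :
    Module.Finite ℂ (wt (actVia φ (CECochain I M n)) χ) ∧
      Module.finrank ℂ (wt (actVia φ (CECochain I M n)) χ) =
        ∑ S : Set.powersetCard (Fin m) n,
          Module.finrank ℂ (wt (actVia φ M) (χ + weightSum α S)) := by
  let f : wt (actVia φ (CECochain I M n)) χ →ₗ[ℂ]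
      ∀ S : Set.powersetCard (Fin m) n, wt (actVia φ M) (χ + weightSum α S) :=
    LinearMap.pi fun S => (LinearMap.proj S ∘ₗ (cochainEquiv v n).toLinearMap).restrict
      fun y hy => (mem_wt_cochain hv).1 hy S
  have hf : Function.Bijective f := by
    constructor
    · intro x y hxy
      refine Subtype.ext ((cochainEquiv v n).injective (funext fun S => ?_))
      exact congrArg Subtype.val (congrFun hxy S)
    · intro y
      have h1 : ∀ S, cochainEquiv v n ((cochainEquiv v n).symm fun S => (y S : M)) S = y S :=
        fun S => by rw [LinearEquiv.apply_symm_apply]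
      exact ⟨⟨(cochainEquiv v n).symm fun S => y S, (mem_wt_cochain hv).2 fun S => by
        rw [h1]; exact (y S).2⟩, funext fun S => Subtype.ext (h1 S)⟩
  let e := LinearEquiv.ofBijective f hf
  exact ⟨Module.Finite.equiv e.symm, by rw [e.finrank_eq, Module.finrank_pi_fintype]⟩

omit hv

theorem subsingleton_cochain (v : Module.Basis (Fin m) ℂ I) {n : ℕ} (hn : m < n) :
    Subsingleton (CECochain I M n) := by
  have : IsEmpty (Set.powersetCard (Fin m) n) := ⟨fun S => by
    have := S.1.card_le_univ
    rw [S.2, Fintype.card_fin] at this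
    omega⟩
  exact (cochainEquiv v n).injective.subsingleton

theorem ceCoboundaries_le (n : ℕ) : ceCoboundaries I M n ≤ ceCocycles I M n := by
  cases n with
  | zero => exact bot_le
  | succ n =>
    intro f hf
    obtain ⟨g, rfl⟩ := (LieModuleHom.mem_range _ _).1 hf
    exact LieModuleHom.mem_ker.2 (CECochain.d_comp_d g)

/-- The inclusion of the coboundaries in the cocycles. -/
def coboundaryIncl (n : ℕ) : ceCoboundaries I M n →ₗ[ℂ] ceCocycles I M n :=
  Submodule.inclusion (ceCoboundaries_le (I := I) (M := M) n)

theorem coboundaryIncl_lie (n : ℕ) (x : P) (f : ceCoboundaries I M n) :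
    coboundaryIncl n ⁅x, f⁆ = ⁅x, coboundaryIncl n f⁆ := rfl

theorem coboundaryIncl_injective (n : ℕ) :
    Function.Injective (coboundaryIncl (I := I) (M := M) n) :=
  Submodule.inclusion_injective _

/-- The class of a cocycle. -/
def cohomologyMk (n : ℕ) : ceCocycles I M n →ₗ[ℂ] LieCohomology I M n :=
  (LieSubmodule.Quotient.mk' _ : ceCocycles I M n →ₗ⁅ℂ,P⁆ LieCohomology I M n)

theorem cohomologyMk_lie (n : ℕ) (x : P) (f : ceCocycles I M n) :
    cohomologyMk n ⁅x, f⁆ = ⁅x, cohomologyMk n f⁆ := LieModuleHom.map_lie _ _ _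

theorem cohomologyMk_surjective (n : ℕ) :
    Function.Surjective (cohomologyMk (I := I) (M := M) n) :=
  LieSubmodule.Quotient.surjective_mk' _

theorem exact_coboundaryIncl (n : ℕ) :
    Function.Exact (coboundaryIncl (I := I) (M := M) n) (cohomologyMk n) := by
  intro f
  refine (LieSubmodule.Quotient.mk_eq_zero (N :=
    (ceCoboundaries I M n).comap (ceCocycles I M n).incl)).trans ⟨fun h => ?_, ?_⟩
  · exact ⟨⟨f, h⟩, rfl⟩
  · rintro ⟨g, rfl⟩
    exact g.2

/-- The differential, as a map onto the coboundaries. -/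
def coboundaryMap (n : ℕ) : CECochain I M n →ₗ[ℂ] ceCoboundaries I M (n + 1) :=
  (CECochain.d I M n).codRestrict (ceCoboundaries I M (n + 1)).toSubmodule fun f =>
    (LieModuleHom.mem_range _ _).2 ⟨f, rfl⟩

theorem coboundaryMap_lie (n : ℕ) (x : P) (f : CECochain I M n) :
    coboundaryMap n ⁅x, f⁆ = ⁅x, coboundaryMap n f⁆ := Subtype.ext (CECochain.d_lie x f)

theorem coboundaryMap_surjective (n : ℕ) :
    Function.Surjective (coboundaryMap (I := I) (M := M) n) := by
  rintro ⟨f, hf⟩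
  obtain ⟨g, hg⟩ := (LieModuleHom.mem_range _ _).1 hf
  exact ⟨g, Subtype.ext hg⟩

theorem exact_coboundaryMap (n : ℕ) :
    Function.Exact (ceCocycles I M n).toSubmodule.subtype (coboundaryMap n) := by
  intro f
  constructor
  · intro h
    exact ⟨⟨f, LieModuleHom.mem_ker.2 (congrArg Subtype.val h)⟩, rfl⟩
  · rintro ⟨g, rfl⟩
    exact Subtype.ext (LieModuleHom.mem_ker.1 g.2)

include hv

theorem isDiag_cocycles (hM : IsDiag (actVia φ M)) (n : ℕ) :
    IsDiag (actVia φ (ceCocycles I M n)) :=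
  (isDiag_cochain hv hM n).of_injective (ceCocycles I M n).toSubmodule.subtype
    (fun _ _ => rfl) Subtype.val_injective

theorem isDiag_lieCohomology (hM : IsDiag (actVia φ M)) (n : ℕ) :
    IsDiag (actVia φ (LieCohomology I M n)) :=
  (isDiag_cocycles hv hM n).of_surjective (cohomologyMk n)
    (fun x f => cohomologyMk_lie n (φ x) f) (cohomologyMk_surjective n)

omit hv in
theorem subsingleton_lieCohomology (v : Module.Basis (Fin m) ℂ I) {n : ℕ} (hn : m < n) :
    Subsingleton (LieCohomology I M n) := by
  have := subsingleton_cochain (M := M) v hn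
  have : Subsingleton (ceCocycles I M n) := Subtype.val_injective.subsingleton
  exact (cohomologyMk_surjective n).subsingleton

theorem finrank_wt_cocycles (hM : IsDiag (actVia φ M))
    (hfin : ∀ χ, Module.Finite ℂ (wt (actVia φ M) χ)) (χ : Module.Dual ℂ T) (n : ℕ) :
    Module.Finite ℂ (wt (actVia φ (ceCocycles I M n)) χ) ∧
    Module.finrank ℂ (wt (actVia φ (CECochain I M n)) χ) =
      Module.finrank ℂ (wt (actVia φ (ceCocycles I M n)) χ) +
        Module.finrank ℂ (wt (actVia φ (ceCoboundaries I M (n + 1))) χ) := by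
  have h := finrank_wt_add (isDiag_cochain hv hM n)
    (ρA := actVia φ (ceCocycles I M n)) (ρC := actVia φ (ceCoboundaries I M (n + 1)))
    (ceCocycles I M n).toSubmodule.subtype
    (coboundaryMap n) (fun _ _ => rfl) (fun x f => coboundaryMap_lie n (φ x) f)
    Subtype.val_injective (exact_coboundaryMap n) (coboundaryMap_surjective n) χ
    (finrank_wt_cochain hv n χ hfin).1
  exact ⟨h.1, h.2.2⟩

theorem finrank_wt_lieCohomology (hM : IsDiag (actVia φ M))
    (hfin : ∀ χ, Module.Finite ℂ (wt (actVia φ M) χ)) (χ : Module.Dual ℂ T) (n : ℕ) :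
    Module.Finite ℂ (wt (actVia φ (LieCohomology I M n)) χ) ∧
    Module.finrank ℂ (wt (actVia φ (ceCocycles I M n)) χ) =
      Module.finrank ℂ (wt (actVia φ (ceCoboundaries I M n)) χ) +
        Module.finrank ℂ (wt (actVia φ (LieCohomology I M n)) χ) := by
  have h := finrank_wt_add (isDiag_cocycles hv hM n) (ρA := actVia φ (ceCoboundaries I M n))
    (ρC := actVia φ (LieCohomology I M n)) (coboundaryIncl n) (cohomologyMk n)
    (fun x f => coboundaryIncl_lie n (φ x) f) (fun x f => cohomologyMk_lie n (φ x) f)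
    (coboundaryIncl_injective n) (exact_coboundaryIncl n) (cohomologyMk_surjective n) χ
    (finrank_wt_cocycles hv hM hfin χ n).1
  exact h.2

/-- The Euler characteristic of the cohomology of an ideal in a given weight. -/
theorem sum_finrank_wt_lieCohomology (hM : IsDiag (actVia φ M))
    (hfin : ∀ χ, Module.Finite ℂ (wt (actVia φ M) χ)) (χ : Module.Dual ℂ T) :
    ∑ n ∈ Finset.range (m + 1),
        (-1) ^ n * (Module.finrank ℂ (wt (actVia φ (LieCohomology I M n)) χ) : ℤ) =
      ∑ S : Finset (Fin m),
        (-1) ^ S.card * (Module.finrank ℂ (wt (actVia φ M) (χ + ∑ i ∈ S, α i)) : ℤ) := by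
  have h1 : ∀ N, ∑ n ∈ Finset.range N,
        (-1) ^ n * (Module.finrank ℂ (wt (actVia φ (LieCohomology I M n)) χ) : ℤ) =
      ∑ n ∈ Finset.range N,
        (-1) ^ n * (Module.finrank ℂ (wt (actVia φ (CECochain I M n)) χ) : ℤ) +
      (-1) ^ N * (Module.finrank ℂ (wt (actVia φ (ceCoboundaries I M N)) χ) : ℤ) := by
    intro N
    induction N with
    | zero =>
      have : Subsingleton (ceCoboundaries I M 0) :=
        inferInstanceAs (Subsingleton (⊥ : LieSubmodule ℂ P (CECochain I M 0)))
      rw [Module.finrank_zero_of_subsingleton (M := wt (actVia φ (ceCoboundaries I M 0)) χ)]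
      simp
    | succ N ih =>
      rw [Finset.sum_range_succ, Finset.sum_range_succ, ih,
        (finrank_wt_cocycles hv hM hfin χ N).2, (finrank_wt_lieCohomology hv hM hfin χ N).2]
      push_cast
      ring
  have h2 := subsingleton_cochain (M := M) v (Nat.lt_succ_self m)
  have h3 : Subsingleton (ceCoboundaries I M (m + 1)) := Subtype.val_injective.subsingleton
  rw [h1, Module.finrank_zero_of_subsingleton (M := wt (actVia φ (ceCoboundaries I M (m + 1))) χ),
    Nat.cast_zero, mul_zero, add_zero, ← Finset.sum_fiberwise_of_maps_to (s := Finset.univ)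
    (t := Finset.range (m + 1)) (g := fun S : Finset (Fin m) => S.card) (fun S _ =>
      Finset.mem_range_succ_iff.2 (S.card_le_univ.trans_eq (Fintype.card_fin m)))]
  refine Finset.sum_congr rfl fun n _ => ?_
  rw [(finrank_wt_cochain hv n χ hfin).2, Nat.cast_sum, Finset.mul_sum]
  have h4 := Finset.sum_subtype
    (F := inferInstanceAs (Fintype (Set.powersetCard (Fin m) n)))
    (p := fun S : Finset (Fin m) => S ∈ Set.powersetCard (Fin m) n)
    (Finset.univ.filter fun S : Finset (Fin m) => S.card = n)
    (fun S => ⟨fun h => (Finset.mem_filter.1 h).2, fun h => Finset.mem_filter.2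
      ⟨Finset.mem_univ _, h⟩⟩) (fun S => (-1 : ℤ) ^ S.card *
      (Module.finrank ℂ (wt (actVia φ M) (χ + ∑ i ∈ S, α i)) : ℤ))
  refine Eq.trans ?_ h4.symm
  refine Finset.sum_congr rfl fun S _ => ?_
  rw [S.2]
  rfl

end CohomologyWeights

/-! ### Cartan subalgebras of reductive Lie algebras are toral -/

section CentralExtension

variable {g s : Type*} [LieRing g] [LieAlgebra ℂ g] [LieRing s] [LieAlgebra ℂ s]
  [FiniteDimensional ℂ s] [LieAlgebra.IsKilling ℂ s] (π : g →ₗ⁅ℂ⁆ s)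

/-- Central extensions of Lie algebras with nondegenerate Killing form split off the kernel: the
derived algebra meets it trivially. -/
theorem eq_zero_of_mem_derived_of_central (hπ : Function.Surjective π)
    (hc : ∀ z, π z = 0 → ∀ y : g, ⁅z, y⁆ = 0) {z : g}
    (hz : z ∈ Submodule.span ℂ {z | ∃ x y : g, ⁅x, y⁆ = z}) (hz0 : π z = 0) : z = 0 := by
  obtain ⟨σ, hσ⟩ := LinearMap.exists_rightInverse_of_surjective (π : g →ₗ[ℂ] s)
    (LinearMap.range_eq_top.2 hπ)
  have hσ' : ∀ x, π (σ x) = x := fun x => LinearMap.congr_fun hσ x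
  have hl : ∀ x x' y : g, π x = π x' → ⁅x, y⁆ = ⁅x', y⁆ := fun x x' y h => by
    rw [← sub_eq_zero, ← sub_lie]
    exact hc _ (by rw [map_sub, h, sub_self]) y
  have hr : ∀ x y y' : g, π y = π y' → ⁅x, y⁆ = ⁅x, y'⁆ := fun x y y' h => by
    rw [← lie_skew, hl y y' x h, lie_skew]
  rw [← Module.forall_dual_apply_eq_zero_iff ℂ]
  intro F
  -- a linear form `F` restricts to the derived algebra as the pullback of `κ(w, -)`
  let ω : s →ₗ[ℂ] Module.Dual ℂ s := LinearMap.mk₂ ℂ (fun x y => F ⁅σ x, σ y⁆)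
    (by simp) (by simp) (by simp) (by simp)
  have hω : ∀ x y, ω (π x) (π y) = F ⁅x, y⁆ := fun x y => by
    change F ⁅σ (π x), σ (π y)⁆ = _
    rw [hl _ x _ (hσ' _), hr x _ y (hσ' _)]
  let e : s ≃ₗ[ℂ] Module.Dual ℂ s := LinearEquiv.ofInjectiveOfFinrankEq (killingForm ℂ s)
    (LinearMap.ker_eq_bot.1 (LieAlgebra.IsKilling.ker_killingForm_eq_bot ℂ s))
    Subspace.dual_finrank_eq.symm
  let D : s →ₗ[ℂ] s := e.symm.toLinearMap ∘ₗ ω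
  have hD : ∀ x y, killingForm ℂ s (D x) y = ω x y := fun x y =>
    LinearMap.congr_fun (e.apply_symm_apply (ω x)) y
  have hκ : ∀ x y z : s, killingForm ℂ s ⁅x, y⁆ z = killingForm ℂ s x ⁅y, z⁆ :=
    LieModule.traceForm_apply_lie_apply ℂ s s
  have hsk : ∀ x y z : s, killingForm ℂ s ⁅x, y⁆ z = -killingForm ℂ s y ⁅x, z⁆ :=
    LieModule.traceForm_apply_lie_apply' ℂ s s
  let D' : LieDerivation ℂ s s :=
    { D with
      leibniz' := fun x y => by
        refine e.injective (LinearMap.ext fun z => ?_)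
        obtain ⟨x, rfl⟩ := hπ x
        obtain ⟨y, rfl⟩ := hπ y
        obtain ⟨z, rfl⟩ := hπ z
        change killingForm ℂ s (D ⁅π x, π y⁆) (π z) =
          killingForm ℂ s (⁅π x, D (π y)⁆ - ⁅π y, D (π x)⁆) (π z)
        rw [map_sub, LinearMap.sub_apply, hsk, hsk, hD, hD, hD, ← LieHom.map_lie,
          ← LieHom.map_lie, ← LieHom.map_lie, hω, hω, hω, lie_lie, map_sub]
        ring }
  obtain ⟨w, hw⟩ := LieDerivation.IsKilling.exists_eq_ad D'
  have hFw : ∀ u ∈ Submodule.span ℂ {z | ∃ x y : g, ⁅x, y⁆ = z},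
      F u = killingForm ℂ s w (π u) := by
    intro u hu
    refine Submodule.span_induction (p := fun u _ => F u = killingForm ℂ s w (π u)) ?_
      (by simp) (fun _ _ _ _ h1 h2 => by simp [h1, h2]) (fun c _ _ h1 => by simp [h1]) hu
    rintro _ ⟨x, y, rfl⟩
    have h1 : D (π x) = ⁅w, π x⁆ := by
      refine Eq.trans (LieDerivation.congr_fun hw (π x)).symm ?_
      rw [LieDerivation.ad_apply_apply]
    rw [← hω, ← hD, h1, hκ, LieHom.map_lie]
  rw [hFw z hz, hz0, map_zero]

/-- A Cartan subalgebra of a central extension of a Lie algebra with nondegenerate Killing form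
is toral. -/
theorem isToral_of_central {g : Type u} [LieRing g] [LieAlgebra ℂ g] (π : g →ₗ⁅ℂ⁆ s)
    (hπ : Function.Surjective π)
    (hc : ∀ z, π z = 0 → ∀ y : g, ⁅z, y⁆ = 0) (h : LieSubalgebra ℂ g) [h.IsCartanSubalgebra] :
    IsToral h := by
  have hder : ∀ x y : g, ⁅x, y⁆ ∈ Submodule.span ℂ {z | ∃ x y : g, ⁅x, y⁆ = z} := fun x y =>
    Submodule.subset_span ⟨x, y, rfl⟩
  have hker : ∀ z, π z = 0 → z ∈ h := fun z hz => by
    rw [← LieSubalgebra.IsCartanSubalgebra.self_normalizing (H := h),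
      LieSubalgebra.mem_normalizer_iff]
    intro y _
    rw [hc z hz y]
    exact zero_mem _
  let H : LieSubalgebra ℂ s := h.map π
  have hH : ∀ x : h, π x ∈ H := fun x => ⟨x, x.2, rfl⟩
  have hHmem : ∀ x, π x ∈ H → x ∈ h := by
    rintro x ⟨y, hy, hxy⟩
    rw [← sub_add_cancel x y]
    refine add_mem (hker _ ?_) hy
    rw [map_sub]
    exact sub_eq_zero.2 hxy.symm
  let π' : h →ₗ⁅ℂ⁆ H :=
    { (π : g →ₗ[ℂ] s).restrict (p := h.toSubmodule) (q := H.toSubmodule) (fun x hx => hH ⟨x, hx⟩)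
      with map_lie' := fun {x y} => Subtype.ext (LieHom.map_lie π (x : g) (y : g)) }
  have hπ' : Function.Surjective π' := by
    rintro ⟨_, x, hx, rfl⟩
    exact ⟨⟨x, hx⟩, rfl⟩
  have hcartan : H.IsCartanSubalgebra :=
    { nilpotent := hπ'.lieAlgebra_isNilpotent
      self_normalizing := by
        refine le_antisymm (fun x hx => ?_) H.le_normalizer
        obtain ⟨x, rfl⟩ := hπ x
        rw [LieSubalgebra.mem_normalizer_iff] at hx
        refine hH ⟨x, ?_⟩
        rw [← LieSubalgebra.IsCartanSubalgebra.self_normalizing (H := h),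
          LieSubalgebra.mem_normalizer_iff]
        intro y hy
        refine hHmem _ ?_
        rw [LieHom.map_lie]
        exact hx _ (hH ⟨y, hy⟩) }
  have hab : ∀ x y : h, ⁅(x : g), (y : g)⁆ = 0 := fun x y => by
    refine eq_zero_of_mem_derived_of_central π hπ hc (hder _ _) ?_
    rw [LieHom.map_lie]
    exact congrArg Subtype.val (trivial_lie_zero H H ⟨π x, hH x⟩ ⟨π y, hH y⟩)
  refine ⟨fun x y => Subtype.ext (hab x y), isDiag_of_mem fun y => ?_⟩
  have hlift : ∀ χ : Module.Dual ℂ h, ∀ y : g, (∀ x : h, ⁅π x, π y⁆ = χ x • π y) →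
      y ∈ ⨆ χ, wt (fun x : h => (LieAlgebra.ad ℂ g (x : g) : Module.End ℂ g)) χ := by
    intro χ y hy
    -- a weight vector of nonzero weight is replaced by one in the derived algebra
    have h1 : ∀ y ∈ Submodule.span ℂ {z | ∃ x y : g, ⁅x, y⁆ = z},
        (∀ x : h, ⁅π x, π y⁆ = χ x • π y) →
        y ∈ wt (fun x : h => (LieAlgebra.ad ℂ g (x : g) : Module.End ℂ g)) χ := by
      intro y hyd hy x
      rw [← sub_eq_zero]
      refine eq_zero_of_mem_derived_of_central π hπ hc
        (sub_mem (hder _ _) (Submodule.smul_mem _ _ hyd)) ?_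
      rw [map_sub, map_smul, ← hy x, LieAlgebra.ad_apply, LieHom.map_lie, sub_self]
    have h2 : ∀ z, π z = 0 →
        z ∈ ⨆ χ, wt (fun x : h => (LieAlgebra.ad ℂ g (x : g) : Module.End ℂ g)) χ :=
      fun z hz => Submodule.mem_iSup_of_mem 0 fun x => by
        rw [LieAlgebra.ad_apply, ← lie_skew, hc z hz, neg_zero, LinearMap.zero_apply, zero_smul]
    by_cases hχ : ∃ x, χ x ≠ 0
    · obtain ⟨x, hx⟩ := hχ
      have h3 : π ((χ x)⁻¹ • ⁅(x : g), y⁆) = π y := by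
        rw [map_smul, LieHom.map_lie, hy, smul_smul, inv_mul_cancel₀ hx, one_smul]
      rw [← sub_add_cancel y ((χ x)⁻¹ • ⁅(x : g), y⁆)]
      refine add_mem (h2 _ (by rw [map_sub, h3, sub_self])) (Submodule.mem_iSup_of_mem χ
        (h1 _ (Submodule.smul_mem _ _ (hder _ _)) fun x => ?_))
      rw [h3, hy]
    · push Not at hχ
      refine Submodule.mem_iSup_of_mem 0 fun x => ?_
      rw [LinearMap.zero_apply, zero_smul]
      refine eq_zero_of_mem_derived_of_central π hπ hc (hder _ _) ?_
      rw [LieAlgebra.ad_apply, LieHom.map_lie, hy, hχ, zero_smul]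
  have hy : π y ∈ ⨆ χ : LieModule.Weight ℂ H s, LieModule.genWeightSpace s χ := by
    rw [LieModule.iSup_genWeightSpace_eq_top']
    trivial
  rw [← LieSubmodule.mem_toSubmodule, LieSubmodule.iSup_toSubmodule] at hy
  suffices h4 : ∀ v : s, v ∈ ⨆ χ : LieModule.Weight ℂ H s,
      (LieModule.genWeightSpace s χ).toSubmodule → ∀ y, π y = v →
      y ∈ ⨆ χ, wt (fun x : h => (LieAlgebra.ad ℂ g (x : g) : Module.End ℂ g)) χ from
    h4 _ hy y rfl
  intro v hv
  refine Submodule.iSup_induction _ (motive := fun v => ∀ y, π y = v →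
      y ∈ ⨆ χ, wt (fun x : h => (LieAlgebra.ad ℂ g (x : g) : Module.End ℂ g)) χ) hv ?_ ?_ ?_
  · rintro α v hv y rfl
    refine hlift (α.toLinear ℂ H s ∘ₗ (π' : h →ₗ[ℂ] H)) y fun x => ?_
    exact LieAlgebra.IsKilling.lie_eq_smul_of_mem_rootSpace hv (π' x)
  · intro y hy
    exact hlift 0 y fun x => by rw [hy, lie_zero, smul_zero]
  · intro v w hv hw y hy
    obtain ⟨v, rfl⟩ := hπ v
    rw [← sub_add_cancel y v]
    exact add_mem (hw _ (by rw [map_sub, hy, add_sub_cancel_left])) (hv v rfl)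

end CentralExtension

section Reductive

variable {g : Type u} [LieRing g] [LieAlgebra ℂ g] [FiniteDimensional ℂ g]
  [LieAlgebra.HasCentralRadical ℂ g]

instance hasTrivialRadical_quotient_center :
    LieAlgebra.HasTrivialRadical ℂ (g ⧸ LieAlgebra.center ℂ g) := by
  rw [LieAlgebra.hasTrivialRadical_iff_no_abelian_ideals]
  intro I hI
  let π : g →ₗ⁅ℂ⁆ g ⧸ LieAlgebra.center ℂ g :=
    { (LieAlgebra.center ℂ g).toSubmodule.mkQ with map_lie' := fun {x y} => rfl }
  have hπ : Function.Surjective π := Submodule.mkQ_surjective _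
  let J : LieIdeal ℂ g := I.comap π
  have hJ : ∀ x y : J, ⁅(x : g), (y : g)⁆ ∈ LieAlgebra.center ℂ g := fun x y => by
    have h1 : π ⁅(x : g), (y : g)⁆ = 0 := by
      rw [LieHom.map_lie]
      exact congrArg Subtype.val (hI.trivial ⟨π x, x.2⟩ ⟨π y, y.2⟩)
    exact (Submodule.Quotient.mk_eq_zero _).1 h1
  have hs : LieAlgebra.IsSolvable J := by
    refine LieAlgebra.IsSolvable.mk (R := ℂ) (k := 2) ?_
    rw [LieIdeal.derivedSeries_eq_bot_iff, LieAlgebra.derivedSeriesOfIdeal_succ, eq_bot_iff]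
    have h1 : LieAlgebra.derivedSeriesOfIdeal ℂ g 1 J ≤ LieAlgebra.center ℂ g := by
      rw [LieAlgebra.derivedSeriesOfIdeal_succ, LieAlgebra.derivedSeriesOfIdeal_zero,
        LieSubmodule.lie_le_iff]
      exact fun x hx y hy => hJ ⟨x, hx⟩ ⟨y, hy⟩
    rw [LieSubmodule.lie_le_iff]
    intro x _ y hy
    exact (LieModule.mem_maxTrivSubmodule ℂ g g y).1 (h1 hy) x
  have h2 : J ≤ LieAlgebra.center ℂ g := by
    rw [← LieAlgebra.HasCentralRadical.radical_eq_center]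
    exact (LieAlgebra.LieIdeal.solvable_iff_le_radical ℂ g J).1 hs
  rw [eq_bot_iff]
  intro x hx
  obtain ⟨x, rfl⟩ := hπ x
  exact (Submodule.Quotient.mk_eq_zero _).2 (h2 hx)

/-- A Cartan subalgebra of a reductive Lie algebra is toral. -/
theorem isToral_of_isCartanSubalgebra (h : LieSubalgebra ℂ g) [h.IsCartanSubalgebra] :
    IsToral h := by
  let π : g →ₗ⁅ℂ⁆ g ⧸ LieAlgebra.center ℂ g :=
    { (LieAlgebra.center ℂ g).toSubmodule.mkQ with map_lie' := fun {x y} => rfl }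
  refine isToral_of_central π (Submodule.mkQ_surjective _) (fun z hz y => ?_) h
  have h1 : z ∈ LieAlgebra.center ℂ g := (Submodule.Quotient.mk_eq_zero _).1 hz
  rw [← lie_skew, (LieModule.mem_maxTrivSubmodule ℂ g g z).1 h1 y, neg_zero]

end Reductive

/-! ### Parabolic induction -/

section ParabolicInduction

set_option linter.unusedSectionVars false

attribute [local instance 100] LieRing.ofAssociativeRing

section UPull

variable {L₁ L₂ : Type u} [LieRing L₁] [LieAlgebra ℂ L₁] [LieRing L₂] [LieAlgebra ℂ L₂]

/-- The `U(L₂)`-module `X`, regarded as a Lie module over `L₁` through a homomorphism of Lie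
algebras `φ : L₁ → L₂`. -/
def UPull (_ : L₁ →ₗ⁅ℂ⁆ L₂) (X : Type u) : Type u := X

variable (φ : L₁ →ₗ⁅ℂ⁆ L₂) (X : Type u) [AddCommGroup X] [Module ℂ X] [Module (UEnv L₂) X]
  [IsScalarTower ℂ (UEnv L₂) X]

instance : AddCommGroup (UPull φ X) := inferInstanceAs (AddCommGroup X)

instance : Module ℂ (UPull φ X) := inferInstanceAs (Module ℂ X)

/-- The identification of the underlying spaces. -/
def UPull.of : X ≃ₗ[ℂ] UPull φ X := LinearEquiv.refl ℂ X

instance : LieRingModule L₁ (UPull φ X) where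
  bracket y x := UPull.of φ X (UniversalEnvelopingAlgebra.ι ℂ (φ y) • (UPull.of φ X).symm x)
  add_lie y z x := by simp only [map_add, add_smul]
  lie_add y x x' := by simp only [map_add, smul_add]
  leibniz_lie y z x := by
    simp only [LinearEquiv.symm_apply_apply, LieHom.map_lie, ← map_add,
      LieRing.of_associative_ring_bracket, sub_smul, mul_smul, sub_add_cancel]

variable {φ X}

theorem UPull.lie_of (y : L₁) (x : X) :
    ⁅y, UPull.of φ X x⁆ = UPull.of φ X (UniversalEnvelopingAlgebra.ι ℂ (φ y) • x) := rfl

instance : LieModule ℂ L₁ (UPull φ X) where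
  smul_lie c y x := by
    obtain ⟨x, rfl⟩ := (UPull.of φ X).surjective x
    rw [UPull.lie_of, UPull.lie_of, map_smul φ c y,
      map_smul (UniversalEnvelopingAlgebra.ι ℂ) c (φ y), smul_assoc]
    exact map_smul (UPull.of φ X) _ _
  lie_smul c y x := by
    obtain ⟨x, rfl⟩ := (UPull.of φ X).surjective x
    rw [← map_smul, UPull.lie_of, UPull.lie_of, smul_algebra_smul_comm, map_smul]

end UPull

section Functor

variable {g l : Type u} [LieRing g] [LieAlgebra ℂ g] [LieRing l] [LieAlgebra ℂ l]
  {p : LieSubalgebra ℂ g} {I : Type} [Fintype I] [LinearOrder I] (E : ((I → ℂ) × p) ≃ₗ[ℂ] g)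
  (hE : ∀ y : p, E (0, y) = y) (φ : p →ₗ⁅ℂ⁆ l)

/-- The module induced from a `U(l)`-module, regarded as a module over `p` through `φ : p → l`. -/
abbrev IndMod (X : Type u) [AddCommGroup X] : Type u :=
  PBWModule E hE (UPull φ X)

variable {X Y Z : Type u} [AddCommGroup X] [Module ℂ X] [Module (UEnv l) X]
  [IsScalarTower ℂ (UEnv l) X] [AddCommGroup Y] [Module ℂ Y] [Module (UEnv l) Y]
  [IsScalarTower ℂ (UEnv l) Y] [AddCommGroup Z] [Module ℂ Z] [Module (UEnv l) Z]
  [IsScalarTower ℂ (UEnv l) Z]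

/-- The generating subspace of the induced module. -/
def indIncl (X : Type u) [AddCommGroup X] [Module ℂ X] : X →ₗ[ℂ] IndMod E hE φ X :=
  PBW.incl E hE (UPull φ X) ∘ₗ (UPull.of φ X).toLinearMap

variable {E hE φ}

theorem ι_smul_indIncl (y : p) (x : X) :
    UniversalEnvelopingAlgebra.ι ℂ (y : g) • indIncl E hE φ X x =
      indIncl E hE φ X (UniversalEnvelopingAlgebra.ι ℂ (φ y) • x) :=
  (PBW.incl_lie y (UPull.of φ X x)).symm

theorem span_range_indIncl : Submodule.span (UEnv g) (Set.range (indIncl E hE φ X)) = ⊤ := by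
  rw [← PBW.span_range_incl (E := E) (hE := hE)]
  rfl

/-- Functoriality of induction. -/
def indMap (f : X →ₗ[UEnv l] Y) : IndMod E hE φ X →ₗ[UEnv g] IndMod E hE φ Y :=
  PBW.desc (indIncl E hE φ Y ∘ₗ f.restrictScalars ℂ ∘ₗ (UPull.of φ X).symm.toLinearMap)
    (fun y w => by
      obtain ⟨x, rfl⟩ := (UPull.of φ X).surjective w
      simp only [UPull.lie_of, LinearMap.comp_apply, LinearEquiv.coe_coe,
        LinearEquiv.symm_apply_apply, ι_smul_indIncl, LinearMap.restrictScalars_apply, map_smul])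

theorem indMap_indIncl (f : X →ₗ[UEnv l] Y) (x : X) :
    indMap (E := E) (hE := hE) (φ := φ) f (indIncl E hE φ X x) = indIncl E hE φ Y (f x) :=
  PBW.desc_incl _ _ _

variable (E hE φ X) in
/-- The coordinates of an element of the induced module. -/
def indCoeff : IndMod E hE φ X ≃ₗ[ℂ] (Multiset I →₀ X) :=
  Finsupp.mapRange.linearEquiv (UPull.of φ X).symm

theorem indCoeff_symm_single (T : Multiset I) (x : X) :
    (indCoeff E hE φ X).symm (Finsupp.single T x) = PBW.mon (PBW.vec E) T • indIncl E hE φ X x :=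
  (Finsupp.mapRange_single (f := (UPull.of φ X)) (hf := map_zero _)).trans
    (PBW.mon_smul_single T (UPull.of φ X x)).symm

theorem indMap_indCoeff_symm (f : X →ₗ[UEnv l] Y) (x : Multiset I →₀ X) :
    indMap (E := E) (hE := hE) (φ := φ) f ((indCoeff E hE φ X).symm x) =
      (indCoeff E hE φ Y).symm (Finsupp.mapRange f (map_zero f) x) := by
  induction x using Finsupp.induction_linear with
  | zero => rw [Finsupp.mapRange_zero, map_zero, map_zero, map_zero]
  | add x y hx hy => rw [Finsupp.mapRange_add (map_add f), map_add, map_add, map_add, hx, hy]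
  | single T x =>
    rw [Finsupp.mapRange_single, indCoeff_symm_single, indCoeff_symm_single, map_smul,
      indMap_indIncl]

/-- Induction is exact. -/
theorem indMap_injective {f : X →ₗ[UEnv l] Y} (hf : Function.Injective f) :
    Function.Injective (indMap (E := E) (hE := hE) (φ := φ) f) := fun x y h => by
  obtain ⟨x, rfl⟩ := (indCoeff E hE φ X).symm.surjective x
  obtain ⟨y, rfl⟩ := (indCoeff E hE φ X).symm.surjective y
  rw [indMap_indCoeff_symm, indMap_indCoeff_symm] at h
  exact congrArg _ (Finsupp.mapRange_injective f (map_zero f) hf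
    ((indCoeff E hE φ Y).symm.injective h))

theorem indMap_surjective {f : X →ₗ[UEnv l] Y} (hf : Function.Surjective f) :
    Function.Surjective (indMap (E := E) (hE := hE) (φ := φ) f) := fun y => by
  obtain ⟨y, rfl⟩ := (indCoeff E hE φ Y).symm.surjective y
  obtain ⟨x, rfl⟩ := Finsupp.mapRange_surjective (α := Multiset I) f (map_zero f) hf y
  exact ⟨_, indMap_indCoeff_symm f x⟩

theorem indMap_exact {f : X →ₗ[UEnv l] Y} {h : Y →ₗ[UEnv l] Z} (hfh : Function.Exact f h) :
    Function.Exact (indMap (E := E) (hE := hE) (φ := φ) f)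
      (indMap (E := E) (hE := hE) (φ := φ) h) := by
  classical
  intro y
  constructor
  · intro hy
    obtain ⟨y, rfl⟩ := (indCoeff E hE φ Y).symm.surjective y
    rw [indMap_indCoeff_symm, LinearEquiv.map_eq_zero_iff] at hy
    have h1 : ∀ T, ∃ x, f x = y T := fun T =>
      (hfh _).1 (DFunLike.congr_fun hy T)
    choose s hs using h1
    refine ⟨(indCoeff E hE φ X).symm (Finsupp.onFinset y.support
      (fun T => if y T = 0 then 0 else s T) fun T hT => ?_), ?_⟩
    · rw [Finsupp.mem_support_iff]
      intro h0
      exact hT (if_pos h0)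
    · rw [indMap_indCoeff_symm]
      congr 1
      ext T
      rw [Finsupp.mapRange_apply, Finsupp.onFinset_apply]
      split_ifs with h0
      · rw [map_zero, h0]
      · exact hs T
  · rintro ⟨x, rfl⟩
    obtain ⟨x, rfl⟩ := (indCoeff E hE φ X).symm.surjective x
    rw [indMap_indCoeff_symm, indMap_indCoeff_symm, LinearEquiv.map_eq_zero_iff]
    ext T
    rw [Finsupp.mapRange_apply, Finsupp.mapRange_apply]
    exact hfh.apply_apply_eq_zero _

theorem isDiag_indMod {t : LieSubalgebra ℂ g} {t' : LieSubalgebra ℂ l} (ht : IsToral t)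
    (e : t →ₗ[ℂ] t') (htp : t ≤ p)
    (he : ∀ x : t, φ (LieSubalgebra.inclusion htp x) = (e x : l)) (hX : IsDiag (actU t' X)) :
    IsDiag (actU t (IndMod E hE φ X)) := by
  refine ht.isDiag_of_span (s := {y | ∃ χ, ∃ x ∈ wt (actU t' X) χ, indIncl E hE φ X x = y}) ?_ ?_
  · rintro _ ⟨χ, x, hx, rfl⟩
    refine ⟨χ ∘ₗ e, fun z => ?_⟩
    refine (ι_smul_indIncl (LieSubalgebra.inclusion htp z) x).trans ?_
    rw [he, show UniversalEnvelopingAlgebra.ι ℂ (e z : l) • x = χ (e z) • x from hx (e z), map_smul]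
    rfl
  · rw [eq_top_iff, ← span_range_indIncl (E := E) (hE := hE) (φ := φ), Submodule.span_le]
    rintro _ ⟨x, rfl⟩
    refine hX.induction (p := fun x => indIncl E hE φ X x ∈ Submodule.span (UEnv g)
      {y | ∃ χ, ∃ x ∈ wt (actU t' X) χ, indIncl E hE φ X x = y})
      (fun χ x hx => Submodule.subset_span ⟨χ, x, hx, rfl⟩)
      (fun x y hx hy => by rw [map_add]; exact add_mem hx hy) x

end Functor

section Tensor

variable {g : Type u} [LieRing g] [LieAlgebra ℂ g] {p : LieSubalgebra ℂ g} {I : Type} [Fintype I]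
  [LinearOrder I] {E : ((I → ℂ) × p) ≃ₗ[ℂ] g} {hE : ∀ y : p, E (0, y) = y}
  {l : LieSubalgebra ℂ g} (hl : IsLevi p l) {V : Type u} [AddCommGroup V] [Module ℂ V]
  [LieRingModule l V] [LieModule ℂ l V]

theorem incl_smul_indIncl (b : UEnv p) (w : EnvModule p (PullModule hl.proj V)) :
    UEnv.incl p b • indIncl E hE hl.proj (EnvModule l V) w =
      indIncl E hE hl.proj (EnvModule l V) (b • w : EnvModule p (PullModule hl.proj V)) := by
  refine UEnv.mem_subalgebra
    { carrier := {b | ∀ w : EnvModule p (PullModule hl.proj V),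
        UEnv.incl p b • indIncl E hE hl.proj (EnvModule l V) w =
        indIncl E hE hl.proj (EnvModule l V) (b • w : EnvModule p (PullModule hl.proj V))}
      mul_mem' := fun {v v'} hv hv' w => by rw [map_mul, mul_smul, hv', hv, mul_smul]
      add_mem' := fun {v v'} hv hv' w => by
        rw [map_add, add_smul, hv', hv, add_smul]
        exact (map_add (indIncl E hE hl.proj (EnvModule l V)) _ _).symm
      algebraMap_mem' := fun c w => by
        rw [AlgHom.commutes, algebraMap_smul, algebraMap_smul]
        exact (map_smul (indIncl E hE hl.proj (EnvModule l V)) c _).symm }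
    (fun y w => ?_) b w
  rw [incl_ι]
  refine (ι_smul_indIncl y _).trans ?_
  congr 1
  exact (EnvModule.ι_smul (M := V) (hl.proj y) w).trans
    (EnvModule.ι_smul (M := PullModule hl.proj V) y w).symm

/-- The parabolically induced module in its Poincaré–Birkhoff–Witt form. -/
theorem exists_equiv_parabolicInduction :
    Nonempty (IndMod E hE hl.proj (EnvModule l V) ≃ₗ[UEnv g] parabolicInduction hl V) := by
  let T := TensorProduct ℂ (UEnv g) (EnvModule p (PullModule hl.proj V))
  let R : Submodule (UEnv g) T := Submodule.span (UEnv g)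
        {t : T | ∃ (a : UEnv g) (b : UEnv p) (w : EnvModule p (PullModule hl.proj V)),
            t = (a * UEnv.incl p b) ⊗ₜ[ℂ] w - a ⊗ₜ[ℂ] (b • w)}
  let ε : UPull hl.proj (EnvModule l V) ≃ₗ[ℂ] EnvModule p (PullModule hl.proj V) :=
    (UPull.of hl.proj (EnvModule l V)).symm
  have hε : ∀ (y : p) w, ε ⁅y, w⁆ = UniversalEnvelopingAlgebra.ι ℂ y • ε w := fun y w =>
    (EnvModule.ι_smul (M := V) (hl.proj y) w).trans
      (EnvModule.ι_smul (M := PullModule hl.proj V) y w).symm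
  let j : UPull hl.proj (EnvModule l V) →ₗ[ℂ] T ⧸ R :=
    (R.mkQ.restrictScalars ℂ) ∘ₗ
      (TensorProduct.mk ℂ (UEnv g) (EnvModule p (PullModule hl.proj V)) 1) ∘ₗ ε.toLinearMap
  have hjapply : ∀ w, j w = R.mkQ (1 ⊗ₜ[ℂ] ε w) := fun _ => rfl
  have hj : ∀ (y : p) w, j ⁅y, w⁆ = UniversalEnvelopingAlgebra.ι ℂ (y : g) • j w := by
    intro y w
    rw [hjapply, hjapply, hε, ← map_smul R.mkQ, ← sub_eq_zero, ← neg_sub, neg_eq_zero, ← map_sub]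
    refine (Submodule.Quotient.mk_eq_zero R).2 (Submodule.subset_span
      ⟨1, UniversalEnvelopingAlgebra.ι ℂ y, ε w, ?_⟩)
    rw [incl_ι, one_mul, TensorProduct.smul_tmul', smul_eq_mul, mul_one]
  let r₀ : T →ₗ[UEnv g] IndMod E hE hl.proj (EnvModule l V) :=
    TensorProduct.AlgebraTensorModule.lift (LinearMap.toSpanSingleton (UEnv g)
      (EnvModule p (PullModule hl.proj V) →ₗ[ℂ] IndMod E hE hl.proj (EnvModule l V))
      (indIncl E hE hl.proj (EnvModule l V)))
  have hr₀ : ∀ a w, r₀ (a ⊗ₜ[ℂ] w) = a • indIncl E hE hl.proj (EnvModule l V) w :=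
    fun _ _ => rfl
  let r : T ⧸ R →ₗ[UEnv g] IndMod E hE hl.proj (EnvModule l V) := R.liftQ r₀ (by
    rw [Submodule.span_le]
    rintro _ ⟨a, b, w, rfl⟩
    refine LinearMap.mem_ker.2 ?_
    rw [map_sub, hr₀, hr₀, mul_smul, incl_smul_indIncl, sub_self])
  refine ⟨LinearEquiv.ofBijective (PBW.desc j hj) (PBW.desc_bijective j hj ?_ r fun w => ?_)⟩
  · rw [eq_top_iff]
    rintro x -
    obtain ⟨x, rfl⟩ := R.mkQ_surjective x
    induction x using TensorProduct.induction_on with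
    | zero => rw [map_zero]; exact zero_mem _
    | add x y hx hy => rw [map_add]; exact add_mem hx hy
    | tmul a w =>
      have h1 : (a ⊗ₜ[ℂ] w : T) = a • (1 ⊗ₜ[ℂ] w) := by
        rw [TensorProduct.smul_tmul', smul_eq_mul, mul_one]
      obtain ⟨w, rfl⟩ := ε.surjective w
      rw [h1, map_smul, ← hjapply]
      exact Submodule.smul_mem _ _ (Submodule.subset_span ⟨w, rfl⟩)
  · exact (hr₀ 1 (ε w)).trans (one_smul _ _)

end Tensor

end ParabolicInduction

/-! ### The class of modules that satisfy the Euler–Poincaré identity -/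

section WeightTransport

variable {T T' : Type*} [AddCommGroup T] [Module ℂ T] [AddCommGroup T'] [Module ℂ T']
  {Y Y' : Type*} [AddCommGroup Y] [Module ℂ Y] [AddCommGroup Y'] [Module ℂ Y']
  {ρ : T → Module.End ℂ Y} {ρ' : T' → Module.End ℂ Y'}

theorem mem_wt_congr (ε : Y ≃ₗ[ℂ] Y') (e : T ≃ₗ[ℂ] T') (h : ∀ x y, ε (ρ x y) = ρ' (e x) (ε y))
    (χ : Module.Dual ℂ T') (y : Y) :
    y ∈ wt ρ (χ ∘ₗ e.toLinearMap) ↔ ε y ∈ wt ρ' χ := by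
  rw [mem_wt, mem_wt, e.surjective.forall]
  refine forall_congr' fun x => ?_
  rw [← h, ← ε.injective.eq_iff, map_smul]
  rfl

/-- Weight spaces of isomorphic actions are isomorphic. -/
def wtEquiv (ε : Y ≃ₗ[ℂ] Y') (e : T ≃ₗ[ℂ] T') (h : ∀ x y, ε (ρ x y) = ρ' (e x) (ε y))
    (χ : Module.Dual ℂ T') : wt ρ (χ ∘ₗ e.toLinearMap) ≃ₗ[ℂ] wt ρ' χ :=
  ε.ofSubmodules _ _ (by
    ext y
    obtain ⟨y, rfl⟩ := ε.surjective y
    rw [Submodule.mem_map_equiv, LinearEquiv.symm_apply_apply, mem_wt_congr ε e h])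

theorem IsDiag.congr (hρ : IsDiag ρ) (ε : Y ≃ₗ[ℂ] Y') (e : T ≃ₗ[ℂ] T')
    (h : ∀ x y, ε (ρ x y) = ρ' (e x) (ε y)) : IsDiag ρ' := by
  refine isDiag_of_mem fun y => ?_
  obtain ⟨y, rfl⟩ := ε.surjective y
  refine hρ.induction (p := fun y => ε y ∈ ⨆ χ, wt ρ' χ) (fun χ y hy => ?_)
    (fun y z hy hz => by rw [map_add]; exact add_mem hy hz) y
  refine Submodule.mem_iSup_of_mem (χ ∘ₗ e.symm.toLinearMap) ((mem_wt_congr ε e h _ y).1 ?_)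
  rwa [LinearMap.comp_assoc, LinearEquiv.symm_comp, LinearMap.comp_id]

end WeightTransport

section

set_option linter.unusedSectionVars false

attribute [local instance 100] LieRing.ofAssociativeRing

/-- The linear isomorphism between the space underlying a Lie module and an object of the category
of modules over the enveloping algebra which is isomorphic to it. -/
def envEquiv {L N : Type u} [LieRing L] [LieAlgebra ℂ L] [AddCommGroup N] [Module ℂ N]
    [LieRingModule L N] [LieModule ℂ L N] {X : ModuleCat.{u} (UEnv L)}
    (e : EnvModule L N ≃ₗ[UEnv L] X) : N ≃ₗ[ℂ] X :=
  { e.toAddEquiv with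
    map_smul' := fun c y => by
      have h : ∀ z : EnvModule L N, algebraMap ℂ (UEnv L) c • z = c • z :=
        algebraMap_smul (UEnv L) c
      exact (congrArg e (h y)).symm.trans (map_smul e _ _) }

theorem envEquiv_lie {L N : Type u} [LieRing L] [LieAlgebra ℂ L] [AddCommGroup N] [Module ℂ N]
    [LieRingModule L N] [LieModule ℂ L N] {X : ModuleCat.{u} (UEnv L)}
    (e : EnvModule L N ≃ₗ[UEnv L] X) (x : L) (y : N) :
    envEquiv e ⁅x, y⁆ = UniversalEnvelopingAlgebra.ι ℂ x • envEquiv e y :=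
  (congrArg e (EnvModule.ι_smul (M := N) x y)).symm.trans (map_smul e _ _)

/-- A basis of a complement of the subalgebra `b`. -/
theorem exists_complement {a : Type u} [LieRing a] [LieAlgebra ℂ a] [FiniteDimensional ℂ a]
    (b : LieSubalgebra ℂ a) :
    ∃ (m : ℕ) (E : ((Fin m → ℂ) × b) ≃ₗ[ℂ] a), ∀ y : b, E (0, y) = y := by
  obtain ⟨c, hc⟩ := Submodule.exists_isCompl b.toSubmodule
  refine ⟨Module.finrank ℂ c, ((Module.finBasis ℂ c).equivFun.symm.prodCongr
    (LinearEquiv.refl ℂ b)).trans (Submodule.prodEquivOfIsCompl c b.toSubmodule hc.symm), ?_⟩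
  intro y
  change (((Module.finBasis ℂ c).equivFun.symm 0 : c) : a) + (y : a) = y
  rw [map_zero]
  exact zero_add _

section Identity

variable {g l : Type u} [LieRing g] [LieAlgebra ℂ g] [LieRing l] [LieAlgebra ℂ l]
  {p : LieSubalgebra ℂ g} {I : Type} [Fintype I] [LinearOrder I] (E : ((I → ℂ) × p) ≃ₗ[ℂ] g)
  (hE : ∀ y : p, E (0, y) = y) (φ : p →ₗ⁅ℂ⁆ l) {t : LieSubalgebra ℂ g} {t' : LieSubalgebra ℂ l}

/-- Isomorphic modules induce isomorphic modules. -/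
def indEquiv {X Y : Type u} [AddCommGroup X] [Module ℂ X] [Module (UEnv l) X]
    [IsScalarTower ℂ (UEnv l) X] [AddCommGroup Y] [Module ℂ Y] [Module (UEnv l) Y]
    [IsScalarTower ℂ (UEnv l) Y] (f : X ≃ₗ[UEnv l] Y) :
    IndMod E hE φ X ≃ₗ[UEnv g] IndMod E hE φ Y :=
  LinearEquiv.ofBijective (indMap f.toLinearMap)
    ⟨indMap_injective f.injective, indMap_surjective f.surjective⟩

/-- The Euler–Poincaré identity between the module induced from `X` and a module `Y` over `g`, and
between `X` and the modules `H i` over `l`, including the claim that all terms are well defined. -/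
def EulerIdentity (Y : PairCat t) (H : ℕ → PairCat t') (N : ℕ)
    (X : ModuleCat.{u} (UEnv l)) : Prop :=
  ∃ (hX : IsPairModule t' X) (hI : IsPairModule t (ModuleCat.of (UEnv g) (IndMod E hE φ X))),
    EPWellDefined t ⟨_, hI⟩ Y ∧ (∀ i, EPWellDefined t' ⟨X, hX⟩ (H i)) ∧
      EP t ⟨_, hI⟩ Y = ∑ i ∈ Finset.range N, (-1) ^ i * EP t' ⟨X, hX⟩ (H i)

variable {E hE φ} {Y : PairCat t} {H : ℕ → PairCat t'} {N : ℕ} {A B C : ModuleCat.{u} (UEnv l)}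

/-- The Euler–Poincaré identity passes to quotients, as induction is exact and the pairings are additive. -/
theorem EulerIdentity.of_quotient (f : A →ₗ[UEnv l] B) (k : B →ₗ[UEnv l] C)
    (hf : Function.Injective f) (hfk : Function.Exact f k) (hk : Function.Surjective k)
    (hA : EulerIdentity E hE φ Y H N A) (hB : EulerIdentity E hE φ Y H N B) :
    EulerIdentity E hE φ Y H N C := by
  obtain ⟨hA, hIA, wA, wHA, eA⟩ := hA
  obtain ⟨hB, hIB, wB, wHB, eB⟩ := hB
  have hC : IsPairModule t' C := isPairModule_of_surjective k hk hB
  have hIC : IsPairModule t (ModuleCat.of (UEnv g) (IndMod E hE φ C)) :=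
    isPairModule_of_surjective (A := ModuleCat.of (UEnv g) (IndMod E hE φ B))
      (B := ModuleCat.of (UEnv g) (IndMod E hE φ C)) (indMap k) (indMap_surjective hk) hIB
  have hS := pairComplex_shortExact hA hB hC f k hfk hf hk
  have hIS := pairComplex_shortExact hIA hIB hIC (indMap f) (indMap k) (indMap_exact hfk)
    (indMap_injective hf) (indMap_surjective hk)
  have wC : EPWellDefined t ⟨_, hIC⟩ Y := PairCat.epWellDefined_X₃ hIS Y wA wB
  have wHC : ∀ i, EPWellDefined t' ⟨C, hC⟩ (H i) := fun i =>
    PairCat.epWellDefined_X₃ hS (H i) (wHA i) (wHB i)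
  refine ⟨hC, hIC, wC, wHC, ?_⟩
  have h1 := PairCat.ep_X₂ hIS Y wA wB wC
  have h2 : ∀ i, EP t' ⟨B, hB⟩ (H i) = EP t' ⟨A, hA⟩ (H i) + EP t' ⟨C, hC⟩ (H i) := fun i =>
    PairCat.ep_X₂ hS (H i) (wHA i) (wHB i) (wHC i)
  have h3 : EP t ⟨_, hIB⟩ Y = EP t ⟨_, hIA⟩ Y + EP t ⟨_, hIC⟩ Y := h1
  rw [eA, eB] at h3
  simp only [h2, mul_add, Finset.sum_add_distrib] at h3
  exact (add_left_cancel h3).symm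

/-- The Euler–Poincaré identity passes to extensions. -/
theorem EulerIdentity.of_extension (ht : IsToral t) (ht' : IsToral t') (e : t →ₗ[ℂ] t')
    (htp : t ≤ p) (he : ∀ x : t, φ (LieSubalgebra.inclusion htp x) = (e x : l))
    (f : A →ₗ[UEnv l] B) (k : B →ₗ[UEnv l] C)
    (hf : Function.Injective f) (hfk : Function.Exact f k) (hk : Function.Surjective k)
    (hB : IsPairModule t' B)
    (hA : EulerIdentity E hE φ Y H N A) (hC : EulerIdentity E hE φ Y H N C) :
    EulerIdentity E hE φ Y H N B := by
  obtain ⟨hA, hIA, wA, wHA, eA⟩ := hA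
  obtain ⟨hC, hIC, wC, wHC, eC⟩ := hC
  have hIB : IsPairModule t (ModuleCat.of (UEnv g) (IndMod E hE φ B)) :=
    (isDiag_indMod ht e htp he ((isPairModule_iff ht'.lie_eq_zero _).1 hB)).isPairModule
      ht.lie_eq_zero
  have hS := pairComplex_shortExact hA hB hC f k hfk hf hk
  have hIS := pairComplex_shortExact hIA hIB hIC (indMap f) (indMap k) (indMap_exact hfk)
    (indMap_injective hf) (indMap_surjective hk)
  have wB : EPWellDefined t ⟨_, hIB⟩ Y := PairCat.epWellDefined_X₂ hIS Y wA wC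
  have wHB : ∀ i, EPWellDefined t' ⟨B, hB⟩ (H i) := fun i =>
    PairCat.epWellDefined_X₂ hS (H i) (wHA i) (wHC i)
  refine ⟨hB, hIB, wB, wHB, ?_⟩
  have h1 : EP t ⟨_, hIB⟩ Y = EP t ⟨_, hIA⟩ Y + EP t ⟨_, hIC⟩ Y := PairCat.ep_X₂ hIS Y wA wB wC
  have h2 : ∀ i, EP t' ⟨B, hB⟩ (H i) = EP t' ⟨A, hA⟩ (H i) + EP t' ⟨C, hC⟩ (H i) := fun i =>
    PairCat.ep_X₂ hS (H i) (wHA i) (wHB i) (wHC i)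
  rw [h1, eA, eC]
  simp only [h2, mul_add, Finset.sum_add_distrib]

/-- Finite direct sums of modules induced from characters are iterated extensions of them. -/
theorem EulerIdentity.freeWt (ht : IsToral t) (ht' : IsToral t') (e : t →ₗ[ℂ] t') (htp : t ≤ p)
    (he : ∀ x : t, φ (LieSubalgebra.inclusion htp x) = (e x : l)) {m : ℕ}
    {E' : ((Fin m → ℂ) × t') ≃ₗ[ℂ] l} {hE' : ∀ y : t', E' (0, y) = y}
    (h : ∀ χ : Module.Dual ℂ t', EulerIdentity E hE φ Y H N
      (ModuleCat.of _ (PBWModule E' hE' (CharMod χ (ht'.char χ)))))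
    (r : ℕ) (χ : Fin r → Module.Dual ℂ t') :
    EulerIdentity E hE φ Y H N (ModuleCat.of _ (FreeWt E' hE' ht' χ)) := by
  induction r with
  | zero =>
    refine EulerIdentity.of_quotient
      (A := ModuleCat.of _ (PBWModule E' hE' (CharMod 0 (ht'.char 0))))
      (B := ModuleCat.of _ (PBWModule E' hE' (CharMod 0 (ht'.char 0))))
      (C := ModuleCat.of _ (FreeWt E' hE' ht' χ)) LinearMap.id 0 (fun _ _ h => h)
      (fun x => ⟨fun _ => ⟨x, rfl⟩, fun _ => rfl⟩) (fun y => ⟨0, funext fun s => s.elim0⟩)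
      (h 0) (h 0)
  | succ r ih =>
    have hd : IsDiag (actU t' (FreeWt E' hE' ht' χ)) := isDiag_freeWt χ
    have hB := hd.isPairModule ht'.lie_eq_zero
    let f : FreeWt E' hE' ht' (Fin.tail χ) →ₗ[UEnv l] FreeWt E' hE' ht' χ :=
      LinearMap.pi fun s => Fin.cases (motive := fun s => FreeWt E' hE' ht' (Fin.tail χ) →ₗ[UEnv l]
        PBWModule E' hE' (CharMod (χ s) (ht'.char (χ s)))) 0 (fun s => LinearMap.proj s) s
    have hf : ∀ x s, f x (Fin.succ s) = x s := fun _ _ => rfl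
    have hf0 : ∀ x, f x 0 = 0 := fun _ => rfl
    refine EulerIdentity.of_extension ht ht' e htp he
      (A := ModuleCat.of _ (FreeWt E' hE' ht' (Fin.tail χ)))
      (B := ModuleCat.of _ (FreeWt E' hE' ht' χ))
      (C := ModuleCat.of _ (PBWModule E' hE' (CharMod (χ 0) (ht'.char (χ 0)))))
      f (LinearMap.proj 0) (fun x y hxy => ?_) (fun x => ⟨fun hx => ?_, ?_⟩)
      (LinearMap.proj_surjective 0) hB (ih _) (h _)
    · exact funext fun s => congrFun hxy (Fin.succ s)
    · refine ⟨fun s => x (Fin.succ s), funext fun s => ?_⟩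
      induction s using Fin.cases with
      | zero => exact hx.symm
      | succ s => rfl
    · rintro ⟨y, rfl⟩
      rfl

end Identity

end

/-! ### Parabolic induction in stages -/

section Parabolic

set_option linter.unusedSectionVars false

attribute [local instance 100] LieRing.ofAssociativeRing

variable {g : Type u} [LieRing g] [LieAlgebra ℂ g] {p l : LieSubalgebra ℂ g}

theorem IsLevi.proj_inclusion (hl : IsLevi p l) (x : l) :
    hl.proj (LieSubalgebra.inclusion hl.le x) = x :=
  hl.component_eq _ _ (by rw [sub_self]; exact zero_mem _)

/-- The nilpotent radical of the subalgebra `p`, as a subspace of `g`. -/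
def nilradSpace (p : LieSubalgebra ℂ g) : Submodule ℂ g :=
  (nilpotentRadical p).toSubmodule.map p.toSubmodule.subtype

theorem lie_mem_nilradSpace {x y : g} (hx : x ∈ p) (hy : y ∈ nilradSpace p) :
    ⁅x, y⁆ ∈ nilradSpace p := by
  obtain ⟨y, hy, rfl⟩ := hy
  exact ⟨⁅(⟨x, hx⟩ : p), y⁆, lie_mem_right ℂ p (nilpotentRadical p) _ y hy, rfl⟩

theorem IsLevi.disjoint (hl : IsLevi p l) : Disjoint l.toSubmodule (nilradSpace p) := by
  rw [Submodule.disjoint_def]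
  rintro _ hx ⟨y, hy, rfl⟩
  have h1 : y ∈ l.toSubmodule.comap p.toSubmodule.subtype := hx
  rw [Submodule.disjoint_def.1 hl.isCompl.disjoint y h1 hy]
  rfl

theorem IsLevi.sub_proj_mem (hl : IsLevi p l) (y : p) : (y : g) - (hl.proj y : g) ∈ nilradSpace p :=
  ⟨_, hl.sub_component_mem y, rfl⟩

theorem IsLevi.proj_eq (hl : IsLevi p l) (y : p) (x : l) (h : (y : g) - x ∈ nilradSpace p) :
    hl.proj y = x := by
  refine hl.component_eq _ _ ?_
  obtain ⟨z, hz, hzx⟩ := h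
  have h1 : z = y - LieSubalgebra.inclusion hl.le x := Subtype.ext hzx
  rwa [← h1]

section Induced

variable {I₁ I₂ I₃ : Type} [Fintype I₁] [LinearOrder I₁] [Fintype I₂] [LinearOrder I₂] [Fintype I₃]
  [LinearOrder I₃] {E₁ : ((I₁ → ℂ) × p) ≃ₗ[ℂ] g} {hE₁ : ∀ y : p, E₁ (0, y) = y}
  {t' : LieSubalgebra ℂ l} {E₂ : ((I₂ → ℂ) × t') ≃ₗ[ℂ] l} {hE₂ : ∀ y : t', E₂ (0, y) = y}
  {χ' : Module.Dual ℂ t'} {hχ' : ∀ x y : t', χ' ⁅x, y⁆ = 0}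

/-- A weight vector in a module over `g` defines an `l`-equivariant map from the module over the
subalgebra `l` which is induced from a character. -/
theorem exists_charDesc_subalgebra {Z : Type u} [AddCommGroup Z] [Module ℂ Z] [Module (UEnv g) Z]
    [IsScalarTower ℂ (UEnv g) Z] (z : Z)
    (hz : ∀ x : t', UniversalEnvelopingAlgebra.ι ℂ ((x : l) : g) • z = χ' x • z) :
    ∃ j : PBWModule E₂ hE₂ (CharMod χ' hχ') →ₗ[ℂ] Z,
      (∀ (y : l) w, j (UniversalEnvelopingAlgebra.ι ℂ y • w) =
        UniversalEnvelopingAlgebra.ι ℂ (y : g) • j w) ∧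
      j (PBW.incl E₂ hE₂ _ (CharMod.gen χ' hχ')) = z := by
  let ε : Z ≃ₗ[ℂ] EnvModule l (UPull l.incl Z) := UPull.of l.incl Z
  have hε : ∀ (y : l) w, UniversalEnvelopingAlgebra.ι ℂ y • ε w =
      ε (UniversalEnvelopingAlgebra.ι ℂ (y : g) • w) := fun y w =>
    EnvModule.ι_smul (M := UPull l.incl Z) y w
  let f := PBW.charDesc (E := E₂) (hE := hE₂) (χ := χ') (hχ := hχ') (ε z) (fun x => by
    rw [hε, hz, map_smul])
  refine ⟨ε.symm.toLinearMap ∘ₗ f.restrictScalars ℂ, fun y w => ?_, ?_⟩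
  · refine ε.injective ?_
    rw [← hε]
    simp only [LinearMap.comp_apply, LinearEquiv.coe_coe, LinearEquiv.apply_symm_apply,
      LinearMap.restrictScalars_apply, map_smul]
  · refine ε.injective ?_
    simp only [LinearMap.comp_apply, LinearEquiv.coe_coe, LinearEquiv.apply_symm_apply,
      LinearMap.restrictScalars_apply]
    exact PBW.charDesc_gen _ _

/-- A property of the elements of the module induced from a character holds if it holds for the
generator and is stable under the action. -/
theorem charMod_induction (N : Submodule ℂ (PBWModule E₂ hE₂ (CharMod χ' hχ')))
    (h0 : PBW.incl E₂ hE₂ _ (CharMod.gen χ' hχ') ∈ N)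
    (h : ∀ (y : l), ∀ w ∈ N, UniversalEnvelopingAlgebra.ι ℂ y • w ∈ N) (w) : w ∈ N := by
  have h1 : UEnv.submodule N h = ⊤ := by
    rw [eq_top_iff, ← PBW.span_gen, Submodule.span_le, Set.singleton_subset_iff]
    exact h0
  have h2 : w ∈ UEnv.submodule N h := h1 ▸ Submodule.mem_top
  exact h2

/-- Induction in stages: the module induced from the subalgebra `t'` of the Levi subalgebra to `l`,
and then to `g` through `p`, is the module induced from `t' + u`. -/
theorem exists_equiv_indMod_charMod (hl : IsLevi p l) {b : LieSubalgebra ℂ g}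
    (E₃ : ((I₃ → ℂ) × b) ≃ₗ[ℂ] g) (hE₃ : ∀ y : b, E₃ (0, y) = y) (hbp : b ≤ p)
    (hub : nilradSpace p ≤ b.toSubmodule) (htb : ∀ x : t', ((x : l) : g) ∈ b)
    (hb : ∀ y ∈ b, ∃ x : t', y - ((x : l) : g) ∈ nilradSpace p) {χ : Module.Dual ℂ b}
    {hχ : ∀ x y : b, χ ⁅x, y⁆ = 0} (hχu : ∀ x : b, (x : g) ∈ nilradSpace p → χ x = 0)
    (hχt : ∀ x : t', χ ⟨_, htb x⟩ = χ' x) :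
    Nonempty (IndMod E₁ hE₁ hl.proj (PBWModule E₂ hE₂ (CharMod χ' hχ')) ≃ₗ[UEnv g]
      PBWModule E₃ hE₃ (CharMod χ hχ)) := by
  obtain ⟨j, hjl, hjg⟩ := exists_charDesc_subalgebra (E₂ := E₂) (hE₂ := hE₂) (hχ' := hχ')
    (PBW.incl E₃ hE₃ _ (CharMod.gen χ hχ)) (fun x => by
      rw [← hχt x]
      exact PBW.gen_smul E₃ hE₃ χ hχ ⟨_, htb x⟩)
  -- the nilpotent radical annihilates the image of `j`
  have hju : ∀ w, ∀ x ∈ nilradSpace p, UniversalEnvelopingAlgebra.ι ℂ x • j w = 0 := by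
    let N : Submodule ℂ (PBWModule E₂ hE₂ (CharMod χ' hχ')) :=
      { carrier := {w | ∀ x ∈ nilradSpace p, UniversalEnvelopingAlgebra.ι ℂ x • j w = 0}
        add_mem' := fun {w w'} hw hw' x hx => by rw [map_add, smul_add, hw x hx, hw' x hx, add_zero]
        zero_mem' := fun x _ => by rw [map_zero, smul_zero]
        smul_mem' := fun c w hw x hx => by
          rw [map_smul, smul_algebra_smul_comm, hw x hx, smul_zero] }
    refine charMod_induction N (fun x hx => ?_) (fun y w hw x hx => ?_)
    · rw [hjg]
      refine (PBW.gen_smul E₃ hE₃ χ hχ ⟨x, hub hx⟩).trans ?_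
      rw [hχu _ hx, zero_smul]
    · have h1 := LieHom.map_lie (UniversalEnvelopingAlgebra.ι ℂ) (y : g) x
      rw [LieRing.of_associative_ring_bracket] at h1
      have h2 := hw _ (lie_mem_nilradSpace (hl.le y.2) hx)
      rw [h1, sub_smul, mul_smul, mul_smul, hw x hx, smul_zero, zero_sub, neg_eq_zero] at h2
      rw [hjl, h2]
  let j' : UPull hl.proj (PBWModule E₂ hE₂ (CharMod χ' hχ')) →ₗ[ℂ]
      PBWModule E₃ hE₃ (CharMod χ hχ) := j ∘ₗ (UPull.of hl.proj _).symm.toLinearMap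
  have hj' : ∀ w, j' (UPull.of hl.proj _ w) = j w := fun _ => rfl
  have hj'lie : ∀ (y : p) (w : UPull hl.proj (PBWModule E₂ hE₂ (CharMod χ' hχ'))),
      j' ⁅y, w⁆ = UniversalEnvelopingAlgebra.ι ℂ (y : g) • j' w := by
    intro y w
    obtain ⟨w, rfl⟩ := (UPull.of hl.proj _).surjective w
    rw [UPull.lie_of, hj', hj', hjl, ← sub_eq_zero, ← neg_sub, neg_eq_zero, ← sub_smul, ← map_sub]
    exact hju w _ (hl.sub_proj_mem y)
  let r := PBW.charDesc (E := E₃) (hE := hE₃) (χ := χ) (hχ := hχ)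
    (indIncl E₁ hE₁ hl.proj (PBWModule E₂ hE₂ (CharMod χ' hχ'))
      (PBW.incl E₂ hE₂ _ (CharMod.gen χ' hχ'))) (fun y => by
    obtain ⟨x, hx⟩ := hb y y.2
    have h1 : hl.proj ⟨y, hbp y.2⟩ = x := hl.proj_eq _ _ hx
    have h2 : χ y = χ' x := by
      rw [← hχt x, ← sub_eq_zero, ← map_sub]
      exact hχu _ hx
    refine (ι_smul_indIncl (E := E₁) (hE := hE₁) (φ := hl.proj) ⟨y, hbp y.2⟩ _).trans ?_
    rw [h1, PBW.gen_smul, map_smul, h2])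
  refine ⟨LinearEquiv.ofBijective (PBW.desc j' hj'lie)
    (PBW.desc_bijective j' hj'lie ?_ r fun w => ?_)⟩
  · rw [eq_top_iff, ← PBW.span_gen, Submodule.span_le, Set.singleton_subset_iff]
    exact Submodule.subset_span ⟨UPull.of hl.proj _ _, hjg⟩
  · obtain ⟨w, rfl⟩ := (UPull.of hl.proj _).surjective w
    rw [hj']
    let N : Submodule ℂ (PBWModule E₂ hE₂ (CharMod χ' hχ')) :=
      LinearMap.eqLocus (r.restrictScalars ℂ ∘ₗ j) (indIncl E₁ hE₁ hl.proj _)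
    refine charMod_induction N ?_ (fun y w hw => ?_) w
    · change r (j _) = _
      rw [hjg]
      exact PBW.charDesc_gen _ _
    · change r (j w) = indIncl E₁ hE₁ hl.proj _ w at hw
      change r (j (UniversalEnvelopingAlgebra.ι ℂ y • w)) = indIncl E₁ hE₁ hl.proj _ _
      rw [hjl, map_smul, hw]
      refine (ι_smul_indIncl (E := E₁) (hE := hE₁) (φ := hl.proj)
        (LieSubalgebra.inclusion hl.le y) w).trans ?_
      rw [hl.proj_inclusion]

end Induced

end Parabolic

/-! ### The Euler–Poincaré identity for parabolic induction -/

section ParabolicIdentity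

set_option linter.unusedSectionVars false

attribute [local instance 100] LieRing.ofAssociativeRing

variable {g : Type u} [LieRing g] [LieAlgebra ℂ g] {p l h : LieSubalgebra ℂ g}

/-- A subalgebra `h` of `l`, and the same subspace as a subalgebra of the Lie algebra `l`. -/
def comapEquiv (hhl : h ≤ l) : h ≃ₗ[ℂ] h.comap l.incl where
  toFun x := ⟨⟨x, hhl x.2⟩, x.2⟩
  invFun x := ⟨((x : l) : g), x.2⟩
  map_add' _ _ := rfl
  map_smul' _ _ := rfl
  left_inv _ := rfl
  right_inv _ := rfl

theorem coe_comapEquiv (hhl : h ≤ l) (x : h) :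
    (((comapEquiv hhl x : h.comap l.incl) : l) : g) = x :=
  rfl

theorem IsToral.comap (ht : IsToral h) (hhl : h ≤ l) : IsToral (h.comap l.incl) where
  lie_eq_zero x y := by
    have h1 := congrArg (fun z : h => (z : g))
      (ht.lie_eq_zero ⟨((x : l) : g), x.2⟩ ⟨((y : l) : g), y.2⟩)
    exact Subtype.ext (Subtype.ext h1)
  isDiag := by
    have h1 : IsDiag fun x : h => LieAlgebra.ad ℂ l (⟨x, hhl x.2⟩ : l) :=
      ht.isDiag.of_injective l.toSubmodule.subtype (fun _ _ => rfl) Subtype.val_injective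
    exact h1.congr (LinearEquiv.refl ℂ l) (comapEquiv hhl) fun _ _ => rfl

theorem isSolvable_nilpotentRadical (P : Type u) [LieRing P] [LieAlgebra ℂ P]
    [FiniteDimensional ℂ P] : LieAlgebra.IsSolvable (nilpotentRadical P) :=
  LieAlgebra.le_solvable_ideal_solvable (J := LieAlgebra.radical ℂ P)
    (LieSubmodule.lie_le_right _ _) inferInstance

/-- The nilpotent radical of a subalgebra that contains the toral subalgebra `h` has a basis of
weight vectors, ordered so that it refines a flag of subalgebras. -/
theorem exists_weightFlag_nilradSpace [FiniteDimensional ℂ g] (ht : IsToral h) (hhp : h ≤ p) :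
    ∃ L, WeightFlag h (nilradSpace p) L := by
  let f : nilpotentRadical p →ₗ⁅ℂ⁆ g := p.incl.comp (nilpotentRadical p).incl
  have hf : f.range.toSubmodule = nilradSpace p := by
    ext x
    constructor
    · rintro ⟨y, rfl⟩
      exact ⟨y, y.2, rfl⟩
    · rintro ⟨y, hy, rfl⟩
      exact ⟨⟨y, hy⟩, rfl⟩
  have := isSolvable_nilpotentRadical p
  have hs : LieAlgebra.IsSolvable f.range := LieHom.isSolvable_range f
  rw [← hf]
  refine ht.exists_weightFlag f.range hs fun x y hy => ?_
  have h1 : y ∈ nilradSpace p := hf ▸ hy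
  have h2 := lie_mem_nilradSpace (hhp x.2) h1
  rw [← hf] at h2
  exact h2

theorem WeightFlag.exists_nilpotentRadical_basis [FiniteDimensional ℂ g] (hhp : h ≤ p)
    {L : List (Module.Dual ℂ h)} (hL : WeightFlag h (nilradSpace p) L) :
    ∃ v : Module.Basis (Fin L.length) ℂ (nilpotentRadical p),
      ∀ (x : h) i, ⁅LieSubalgebra.inclusion hhp x, v i⁆ = L.get i x • v i := by
  obtain ⟨v, hv, hspan, hw⟩ := hL.exists_basis
  have hmem : ∀ i, v i ∈ nilradSpace p := fun i => hspan ▸ Submodule.subset_span ⟨i, rfl⟩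
  choose w hw1 hw2 using hmem
  let f : nilpotentRadical p →ₗ[ℂ] g :=
    p.toSubmodule.subtype ∘ₗ (nilpotentRadical p).toSubmodule.subtype
  have hf : Function.Injective f := Subtype.val_injective.comp Subtype.val_injective
  let u : Fin L.length → nilpotentRadical p := fun i => ⟨w i, hw1 i⟩
  have hfu : f ∘ u = v := funext hw2
  have hu : LinearIndependent ℂ u := LinearIndependent.of_comp f (hfu ▸ hv)
  have hus : ⊤ ≤ Submodule.span ℂ (Set.range u) := by
    intro x _
    have h1 : f x ∈ Submodule.span ℂ (Set.range v) := by
      rw [hspan]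
      exact ⟨x, x.2, rfl⟩
    rw [← hfu, Set.range_comp, ← Submodule.map_span] at h1
    obtain ⟨y, hy, hyx⟩ := h1
    rwa [← hf hyx]
  refine ⟨Module.Basis.mk hu hus, fun x i => ?_⟩
  rw [Module.Basis.mk_apply]
  refine hf ?_
  rw [map_smul]
  change ⁅(x : g), f (u i)⁆ = _
  have h1 : f (u i) = v i := congrFun hfu i
  rw [h1]
  exact mem_wt.1 (hw i) x

section Cohomology

variable (hl : IsLevi p l) (hhl : h ≤ l) {M : Type u} [AddCommGroup M] [Module ℂ M]
  [LieRingModule g M] [LieModule ℂ g M]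

/-- The space of the `l`-module `H^i(u, M)`, compatibly with the actions of `h`. -/
def nilpotentCohomologyEquiv (i : ℕ) :
    LieCohomology (nilpotentRadical p) M i ≃ₗ[ℂ] nilpotentCohomology hl M i :=
  envEquiv (L := l)
    (N := PullModule (LieSubalgebra.inclusion hl.le) (LieCohomology (nilpotentRadical p) M i))
    (X := nilpotentCohomology hl M i) (LinearEquiv.refl _ _)

theorem nilpotentCohomologyEquiv_act (i : ℕ) (x : h)
    (y : LieCohomology (nilpotentRadical p) M i) :
    nilpotentCohomologyEquiv hl i
        (actVia (LieSubalgebra.inclusion (hhl.trans hl.le))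
          (LieCohomology (nilpotentRadical p) M i) x y) =
      actU (h.comap l.incl) (nilpotentCohomology hl M i) (comapEquiv hhl x)
        (nilpotentCohomologyEquiv hl i y) :=
  envEquiv_lie (L := l)
    (N := PullModule (LieSubalgebra.inclusion hl.le) (LieCohomology (nilpotentRadical p) M i))
    (X := nilpotentCohomology hl M i) (LinearEquiv.refl _ _) ⟨x, hhl x.2⟩ y

variable {X : ModuleCat.{u} (UEnv g)} {L : List (Module.Dual ℂ h)}

theorem isDiag_actVia (ε : EnvModule g M ≃ₗ[UEnv g] X) (ht : IsToral h)
    (hhp : h ≤ p) (hM : IsPairModule h X) :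
    IsDiag (actVia (LieSubalgebra.inclusion hhp) M) :=
  ((isPairModule_iff ht.lie_eq_zero _).1 hM).congr (envEquiv ε).symm (LinearEquiv.refl ℂ h)
    fun x y => by
      obtain ⟨y, rfl⟩ := (envEquiv ε).surjective y
      refine (envEquiv ε).injective ?_
      rw [LinearEquiv.apply_symm_apply, LinearEquiv.symm_apply_apply]
      exact (envEquiv_lie ε (x : g) y).symm

/-- The weight spaces of a Lie module, in the two guises of the latter. -/
def wtEnvEquiv (ε : EnvModule g M ≃ₗ[UEnv g] X) (hhp : h ≤ p) (χ : Module.Dual ℂ h) :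
    wt (actVia (LieSubalgebra.inclusion hhp) M) χ ≃ₗ[ℂ] wt (actU h (X)) χ :=
  wtEquiv (envEquiv ε) (LinearEquiv.refl ℂ h) (fun x y => envEquiv_lie ε (x : g) y) χ

/-- The weight spaces of the cohomology, in the two guises of the latter. -/
def wtCohomologyEquiv (i : ℕ) (χ : Module.Dual ℂ (h.comap l.incl)) :
    wt (actVia (LieSubalgebra.inclusion (hhl.trans hl.le)) (LieCohomology (nilpotentRadical p) M i))
        (χ ∘ₗ (comapEquiv hhl).toLinearMap) ≃ₗ[ℂ]
      wt (actU (h.comap l.incl) (nilpotentCohomology hl M i)) χ :=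
  wtEquiv (nilpotentCohomologyEquiv hl i) (comapEquiv hhl) (nilpotentCohomologyEquiv_act hl hhl i) χ

theorem isPairModule_nilpotentCohomology [FiniteDimensional ℂ g]
    (ε : EnvModule g M ≃ₗ[UEnv g] X) (hhl : h ≤ l)
    (hL : WeightFlag h (nilradSpace p) L) (ht : IsToral h)
    (hM : IsPairModule h (X)) (i : ℕ) :
    IsPairModule (h.comap l.incl) (nilpotentCohomology hl M i) := by
  obtain ⟨v, hv⟩ := hL.exists_nilpotentRadical_basis (hhl.trans hl.le)
  exact (isPairModule_iff (ht.comap hhl).lie_eq_zero _).2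
    ((isDiag_lieCohomology hv (isDiag_actVia ε ht _ hM) i).congr (nilpotentCohomologyEquiv hl i)
      (comapEquiv hhl) (nilpotentCohomologyEquiv_act hl hhl i))

theorem subsingleton_nilpotentCohomology [FiniteDimensional ℂ g] (hhl : h ≤ l)
    (hL : WeightFlag h (nilradSpace p) L) {i : ℕ} (hi : L.length < i) :
    Subsingleton (nilpotentCohomology hl M i) := by
  obtain ⟨v, hv⟩ := hL.exists_nilpotentRadical_basis (hhl.trans hl.le)
  exact subsingleton_lieCohomology v hi

theorem finite_wt_nilpotentCohomology [FiniteDimensional ℂ g]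
    (ε : EnvModule g M ≃ₗ[UEnv g] X) (hhl : h ≤ l)
    (hL : WeightFlag h (nilradSpace p) L) (ht : IsToral h)
    (hM : IsPairModule h (X)) (hA : IsAdmissible h (X)) (i : ℕ)
    (χ : Module.Dual ℂ (h.comap l.incl)) :
    Module.Finite ℂ (wt (actU (h.comap l.incl) (nilpotentCohomology hl M i)) χ) := by
  obtain ⟨v, hv⟩ := hL.exists_nilpotentRadical_basis (hhl.trans hl.le)
  have hfin : ∀ χ, Module.Finite ℂ (wt (actVia (LieSubalgebra.inclusion (hhl.trans hl.le)) M) χ) :=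
    fun χ => have := hA.finite_wt ht.lie_eq_zero χ
      Module.Finite.equiv (wtEnvEquiv ε (hhl.trans hl.le) χ).symm
  have := (finrank_wt_lieCohomology hv (isDiag_actVia ε ht _ hM) hfin
    (χ ∘ₗ (comapEquiv hhl).toLinearMap) i).1
  exact Module.Finite.equiv (wtCohomologyEquiv hl hhl i χ)

/-- The Euler characteristic of the weight spaces of the cohomology of the nilpotent radical. -/
theorem sum_finrank_wt_nilpotentCohomology [FiniteDimensional ℂ g]
    (ε : EnvModule g M ≃ₗ[UEnv g] X) (ht : IsToral h)
    (hM : IsPairModule h (X)) (hA : IsAdmissible h (X))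
    (hL : WeightFlag h (nilradSpace p) L) (χ : Module.Dual ℂ (h.comap l.incl)) :
    ∑ i ∈ Finset.range (L.length + 1), (-1) ^ i *
        (Module.finrank ℂ (wt (actU (h.comap l.incl) (nilpotentCohomology hl M i)) χ) : ℤ) =
      altSum (fun μ => (Module.finrank ℂ (wt (actU h (X)) μ) : ℤ)) L
        (χ ∘ₗ (comapEquiv hhl).toLinearMap) := by
  obtain ⟨v, hv⟩ := hL.exists_nilpotentRadical_basis (hhl.trans hl.le)
  have hfin : ∀ χ, Module.Finite ℂ (wt (actVia (LieSubalgebra.inclusion (hhl.trans hl.le)) M) χ) :=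
    fun χ => have := hA.finite_wt ht.lie_eq_zero χ
      Module.Finite.equiv (wtEnvEquiv ε (hhl.trans hl.le) χ).symm
  have h1 := sum_finrank_wt_lieCohomology hv (isDiag_actVia ε ht _ hM) hfin
    (χ ∘ₗ (comapEquiv hhl).toLinearMap)
  simp only [(wtCohomologyEquiv hl hhl _ χ).finrank_eq,
    (wtEnvEquiv ε (hhl.trans hl.le) _).finrank_eq] at h1
  rw [h1, altSum_eq_sum]

end Cohomology

theorem ep_eq_zero_of_subsingleton {a : Type u} [LieRing a] [LieAlgebra ℂ a]
    {t : LieSubalgebra ℂ a} (X Y : PairCat t) (hY : Subsingleton Y.obj) : EP t X Y = 0 := by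
  have h1 : 𝟙 Y = 0 := by
    ext y
    exact hY.elim _ _
  refine finsum_eq_zero_of_forall_eq_zero fun i => ?_
  have h2 : Subsingleton (PairExt t X Y i) := by
    refine subsingleton_of_forall_eq 0 fun x => ?_
    rw [← x.comp_mk₀_id, h1, Abelian.Ext.mk₀_zero, Abelian.Ext.comp_zero]
  rw [Module.finrank_zero_of_subsingleton, Nat.cast_zero, mul_zero]

section Transport

variable {l' : Type u} [LieRing l'] [LieAlgebra ℂ l'] {I : Type} [Fintype I] [LinearOrder I]
  {E : ((I → ℂ) × p) ≃ₗ[ℂ] g} {hE : ∀ y : p, E (0, y) = y} {φ : p →ₗ⁅ℂ⁆ l'}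
  {t' : LieSubalgebra ℂ l'} {Y : PairCat h} {H : ℕ → PairCat t'} {N : ℕ}
  {X : ModuleCat.{u} (UEnv l')} {X' : Type u} [AddCommGroup X'] [Module ℂ X'] [Module (UEnv l') X']
  [IsScalarTower ℂ (UEnv l') X'] {Z : ModuleCat.{u} (UEnv g)}

/-- The induced module in the Euler–Poincaré identity may be replaced by an isomorphic one. -/
theorem eulerIdentity_iff (f : X ≃ₗ[UEnv l'] X') (η : IndMod E hE φ X' ≃ₗ[UEnv g] Z) :
    EulerIdentity E hE φ Y H N X ↔ ∃ (hX : IsPairModule t' X) (hZ : IsPairModule h Z),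
      EPWellDefined h ⟨Z, hZ⟩ Y ∧ (∀ i, EPWellDefined t' ⟨X, hX⟩ (H i)) ∧
        EP h ⟨Z, hZ⟩ Y = ∑ i ∈ Finset.range N, (-1) ^ i * EP t' ⟨X, hX⟩ (H i) := by
  let η' : IndMod E hE φ X ≃ₗ[UEnv g] Z := (indEquiv E hE φ f).trans η
  constructor
  · rintro ⟨hX, hI, w, wH, e⟩
    have hZ : IsPairModule h Z :=
      isPairModule_of_surjective (A := ModuleCat.of (UEnv g) (IndMod E hE φ X)) (B := Z)
        η'.toLinearMap η'.surjective hI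
    have iso := pairIso hI hZ η'
    exact ⟨hX, hZ, w.of_iso iso, wH, (ep_of_iso iso Y).symm.trans e⟩
  · rintro ⟨hX, hZ, w, wH, e⟩
    have hI : IsPairModule h (ModuleCat.of (UEnv g) (IndMod E hE φ X)) :=
      isPairModule_of_injective (A := ModuleCat.of (UEnv g) (IndMod E hE φ X)) (B := Z)
        η'.toLinearMap η'.injective hZ
    have iso := pairIso hI hZ η'
    exact ⟨hX, hI, w.of_iso iso.symm, wH, (ep_of_iso iso Y).trans e⟩

end Transport

section Main

variable [FiniteDimensional ℂ g] (ht : IsToral h) (hl : IsLevi p l) (hhl : h ≤ l)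
  {M : Type u} [AddCommGroup M] [Module ℂ M] [LieRingModule g M] [LieModule ℂ g M]
  {X : ModuleCat.{u} (UEnv g)}

/-- The Euler–Poincaré identity for the modules over `l` that are induced from characters of the
Cartan subalgebra. Both sides are alternating sums of dimensions of weight spaces of `M`. -/
theorem eulerIdentity_charMod (ε : EnvModule g M ≃ₗ[UEnv g] X) {m m' : ℕ}
    (E : ((Fin m → ℂ) × p) ≃ₗ[ℂ] g) (hE : ∀ y : p, E (0, y) = y)
    (E' : ((Fin m' → ℂ) × h.comap l.incl) ≃ₗ[ℂ] l) (hE' : ∀ y : h.comap l.incl, E' (0, y) = y)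
    {L : List (Module.Dual ℂ h)} (hL : WeightFlag h (nilradSpace p) L)
    (hM : IsPairModule h (X)) (hA : IsAdmissible h (X))
    (hH : ∀ i : ℕ, IsPairModule (h.comap l.incl) (nilpotentCohomology hl M i))
    (χ : Module.Dual ℂ (h.comap l.incl)) :
    EulerIdentity E hE hl.proj (t := h) (t' := h.comap l.incl) ⟨X, hM⟩
      (fun i => ⟨nilpotentCohomology hl M i, hH i⟩) (L.length + 1)
      (ModuleCat.of _ (PBWModule E' hE' (CharMod χ ((ht.comap hhl).char χ)))) := by
  have ht' := ht.comap hhl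
  let b := hL.subalgebra ht
  have hbs : b.toSubmodule = h.toSubmodule ⊔ nilradSpace p := rfl
  obtain ⟨k, E₃, hE₃⟩ := exists_complement b
  have hd : Disjoint h.toSubmodule (nilradSpace p) := hl.disjoint.mono_left hhl
  obtain ⟨F, hFt, hFn⟩ := exists_extend_dual hd (χ ∘ₗ (comapEquiv hhl).toLinearMap)
  have hFχ : F ∘ₗ h.toSubmodule.subtype = χ ∘ₗ (comapEquiv hhl).toLinearMap := LinearMap.ext hFt
  have hhb : h ≤ b := fun x hx => (le_sup_left : h.toSubmodule ≤ h.toSubmodule ⊔ nilradSpace p) hx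
  have hub : nilradSpace p ≤ b.toSubmodule := hbs ▸ le_sup_right
  have hnp : nilradSpace p ≤ p.toSubmodule := by
    rintro _ ⟨y, -, rfl⟩
    exact y.2
  have hbp : b ≤ p := fun x hx =>
    (sup_le (hhl.trans hl.le : h ≤ p) hnp : h.toSubmodule ⊔ nilradSpace p ≤ p.toSubmodule) hx
  have hb : ∀ y ∈ b, ∃ x : h.comap l.incl, y - ((x : l) : g) ∈ nilradSpace p := by
    intro y hy
    have hy' : y ∈ h.toSubmodule ⊔ nilradSpace p := hy
    obtain ⟨x, hx, z, hz, rfl⟩ := Submodule.mem_sup.1 hy'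
    refine ⟨comapEquiv hhl ⟨x, hx⟩, ?_⟩
    rw [coe_comapEquiv]
    change x + z - x ∈ _
    rwa [add_sub_cancel_left]
  have hχb : ∀ x y : b, (F ∘ₗ b.toSubmodule.subtype) ⁅x, y⁆ = 0 := by
    intro x y
    obtain ⟨x', hx'⟩ := hb x x.2
    obtain ⟨y', hy'⟩ := hb y y.2
    refine hFn _ ?_
    have h0 : ⁅((x' : l) : g), ((y' : l) : g)⁆ = 0 :=
      congrArg (fun z : h.comap l.incl => ((z : l) : g)) (ht'.lie_eq_zero x' y')
    have h1 := lie_mem_nilradSpace (hbp x.2) hy'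
    have h2 := lie_mem_nilradSpace (hl.le (y' : l).2) hx'
    rw [← lie_skew, neg_mem_iff, sub_lie, h0, sub_zero] at h2
    rw [lie_sub] at h1
    have h3 := add_mem h1 h2
    rwa [sub_add_cancel] at h3
  have hP := isPairModule_charMod (E := E₃) (hE := hE₃) (χ := F ∘ₗ b.toSubmodule.subtype)
    (hχ := hχb) ht hhb
  obtain ⟨w, e⟩ := hL.ep_charMod ht hd b hbs E₃ hE₃ F hFn hχb hP ⟨X, hM⟩
    (hA.finite_wt ht.lie_eq_zero)
  obtain ⟨η⟩ := exists_equiv_indMod_charMod (E₁ := E) (hE₁ := hE) (E₂ := E') (hE₂ := hE')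
    (hχ' := ht'.char χ) hl E₃ hE₃ hbp hub (fun x => hhb x.2) hb (χ := F ∘ₗ b.toSubmodule.subtype)
    (hχ := hχb) (fun x hx => hFn _ hx) (fun x => hFt ⟨((x : l) : g), x.2⟩)
  have hX : IsPairModule (h.comap l.incl)
      (ModuleCat.of (UEnv l) (PBWModule E' hE' (CharMod χ (ht'.char χ)))) :=
    isPairModule_charMod ht' le_rfl
  refine (eulerIdentity_iff (X := ModuleCat.of (UEnv l) (PBWModule E' hE' (CharMod χ (ht'.char χ))))
    (X' := PBWModule E' hE' (CharMod χ (ht'.char χ)))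
    (Z := ModuleCat.of _ (PBWModule E₃ hE₃
      (CharMod (F ∘ₗ b.toSubmodule.subtype : Module.Dual ℂ b) hχb)))
    (LinearEquiv.refl (UEnv l) (PBWModule E' hE' (CharMod χ (ht'.char χ)))) η).2
    ⟨hX, hP, w, fun i => ?_, ?_⟩
  · have := finite_wt_nilpotentCohomology hl ε hhl hL ht hM hA i χ
    exact epWellDefined_charMod ht'.lie_eq_zero hX ⟨nilpotentCohomology hl M i, hH i⟩
  · rw [e, hFχ, ← sum_finrank_wt_nilpotentCohomology hl hhl ε ht hM hA hL χ]
    refine Finset.sum_congr rfl fun i _ => ?_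
    rw [ep_charMod ht'.lie_eq_zero hX]

end Main

end ParabolicIdentity

end

theorem proposition5p2 {g : Type u} [LieRing g] [LieAlgebra ℂ g] [FiniteDimensional ℂ g]
    [LieAlgebra.HasCentralRadical ℂ g] (h : LieSubalgebra ℂ g) [h.IsCartanSubalgebra]
    (p l : LieSubalgebra ℂ g) (hp : IsParabolic p) (hl : IsLevi p l) (hhl : h ≤ l)
    (M : Type u) [AddCommGroup M] [Module ℂ M] [LieRingModule g M] [LieModule ℂ g M]
    (hM : IsFGAdmissible h (envObj g M))
    (V : Type u) [AddCommGroup V] [Module ℂ V] [LieRingModule l V] [LieModule ℂ l V]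
    (hV : IsFGAdmissible (h.comap l.incl) (envObj l V)) :
    ∃ (hI : IsPairModule h (parabolicInduction hl V))
      (hH : ∀ i : ℕ, IsPairModule (h.comap l.incl) (nilpotentCohomology hl M i)),
      EPWellDefined h ⟨parabolicInduction hl V, hI⟩ ⟨envObj g M, hM.isPairModule⟩ ∧
      (∀ i : ℕ, EPWellDefined (h.comap l.incl) ⟨envObj l V, hV.isPairModule⟩
        ⟨nilpotentCohomology hl M i, hH i⟩) ∧
      (∃ n : ℕ, ∀ i : ℕ, n ≤ i → Subsingleton (nilpotentCohomology hl M i)) ∧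
      EP h ⟨parabolicInduction hl V, hI⟩ ⟨envObj g M, hM.isPairModule⟩ =
        ∑ᶠ i : ℕ, (-1) ^ i * EP (h.comap l.incl) ⟨envObj l V, hV.isPairModule⟩
          ⟨nilpotentCohomology hl M i, hH i⟩ := by
  have ht : IsToral h := isToral_of_isCartanSubalgebra h
  have ht' : IsToral (h.comap l.incl) := ht.comap hhl
  obtain ⟨L, hL⟩ := exists_weightFlag_nilradSpace ht (hhl.trans hl.le)
  obtain ⟨m, E, hE⟩ := exists_complement p
  obtain ⟨m', E', hE'⟩ := exists_complement (h.comap l.incl)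
  have hH := isPairModule_nilpotentCohomology hl (X := envObj g M)
    (LinearEquiv.refl (UEnv g) (EnvModule g M)) hhl hL ht hM.isPairModule
  have he : ∀ x : h, hl.proj (LieSubalgebra.inclusion (hhl.trans hl.le) x) =
      ((comapEquiv hhl : h →ₗ[ℂ] h.comap l.incl) x : l) := fun x =>
    hl.proj_inclusion ⟨x, hhl x.2⟩
  have key := generation (E := E') (hE := hE') (ht := ht')
    (Q := EulerIdentity E hE hl.proj (t := h) (t' := h.comap l.incl)
      ⟨envObj g M, hM.isPairModule⟩ (fun i => ⟨nilpotentCohomology hl M i, hH i⟩) (L.length + 1))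
    (EulerIdentity.freeWt ht ht' (comapEquiv hhl : h →ₗ[ℂ] h.comap l.incl) (hhl.trans hl.le) he
      fun χ => eulerIdentity_charMod ht hl hhl (X := envObj g M)
        (LinearEquiv.refl (UEnv g) (EnvModule g M)) E hE E' hE' hL hM.isPairModule
        hM.isAdmissible hH χ)
    (fun A B C f k hf hfk hk hA hB => EulerIdentity.of_quotient f k hf hfk hk hA hB)
    (envObj l V) ((isPairModule_iff ht'.lie_eq_zero _).1 hV.isPairModule) hV.finite
  obtain ⟨η⟩ := exists_equiv_parabolicInduction (E := E) (hE := hE) hl (V := V)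
  obtain ⟨hX, hP, w, wH, e⟩ := (eulerIdentity_iff (X := envObj l V) (X' := EnvModule l V)
    (LinearEquiv.refl (UEnv l) (EnvModule l V)) η).1 key
  have hvan : ∀ i, L.length + 1 ≤ i → Subsingleton (nilpotentCohomology hl M i) := fun i hi =>
    subsingleton_nilpotentCohomology hl hhl hL hi
  refine ⟨hP, hH, w, wH, ⟨_, hvan⟩, ?_⟩
  rw [e]
  refine (finsum_eq_sum_of_support_subset _ fun i hi => ?_).symm
  rw [Finset.coe_range, Set.mem_Iio]
  by_contra hni
  exact hi (mul_eq_zero_of_right _ (ep_eq_zero_of_subsingleton _ _ (hvan i (not_lt.1 hni))))
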